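/- **Setting.** Let $P$ be the distribution of an observation $W$ and let $X$ be the covariates, a measurable function of $W$ (for instance a sub-vector). Let $\psi^a,\psi^b$ be measurable real functions of $(w,\eta)$, $\eta\in\mathbf R^p$; let $m(w,\theta,\eta)=\psi^b(w,\eta)-\psi^a(w,\eta)\theta$; let $\eta_0$ be a measurable function of the covariates with values in $\mathcal T\subseteq\mathbf R^p$, and let $\theta_0\in\mathbf R$ satisfy $E[m(W,\theta_0,\eta_0(X))]=0$. Let $W_1,W_2,\dots$ be i.i.d. with law $P$, with covariates $X_i$; put $\eta_i=\eta_0(X_i)$, $m_i=m(W_i,\theta_0,\eta_i)$, $\partial^2_\eta m_i=\partial^2_\eta m(W_i,\theta_0,\eta_i)$, $J_0=E[\psi^a(W_i,\eta_i)]$ and $\sigma^2=E[m_i^2]/J_0^2$. For $2\le K\le n$ the indices $\{1,\dots,n\}$ are randomly split, independently of the sample, into $K$ folds $\mathcal I_1,\dots,\mathcal I_K$ of equal size (of sizes $\lfloor n/K\rfloor$ and $\lfloor n/K\rfloor+1$ if $K\nmid n$). For each fold, $\hat\eta_k$ is an estimator of $\eta_0$ that uses only $\{W_i: i\notin\mathcal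 I_k\}$, and $n_0=n-|\mathcal I_k|$ is the number of these observations (so $n_0=\frac{K-1}{K}n$ if $K\mid n$). Fix $\varphi\in(1/4,1/2)$. In what follows $i,j,\ell$ are distinct in expectations. **Assumption 1 (moment function).** For constants $M,C_0,C_1,C_2,C_3>0$ and $z=a,b$: $\psi^z$ is three times continuously differentiable in $\eta$ at every point of $\mathcal T$; $|J_0|>C_0$; $E[\partial_\eta\psi^z(W_i,\eta_i)\mid X_i]=0$ a.e.; $E[\psi^z(W_i,\eta_i)^4]<M$ and $E\|\partial_\eta\psi^z(W_i,\eta_i)\|^4<M$; the entries of $E[\partial_\eta\psi^z(W_i,\eta_i)\,\partial_\eta\psi^z(W_i,\eta_i)^\top\mid X_i]$ are bounded by $C_1$ in absolute value; and, almost surely, for all $\eta\in\mathcal T$ all second (third) order partial derivatives of $\psi^z(W_i,\cdot)$ at $\eta$ are bounded by $C_2$ ($C_3$) in absolute value. **Assumption 2 (nuisance estimator).** There are measurable functions $\delta_{n_0}(w,x)$ and $b_{n_0}(x',x)$ with values in $\mathbf R^p$ ($n_0\ge1$), constants $M_1,C_b,C_\delta>0$ and positive $\tau_{n_0}\to0$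 such that, with $\tilde b_{n_0}(X_i)=E[b_{n_0}(X_j,X_i)\mid X_i]$ and $$L_k(x)=n_0^{-1/2}\sum_{\ell\notin\mathcal I_k}n_0^{-\varphi}\delta_{n_0}(W_\ell,x)+n_0^{-1}\sum_{\ell\notin\mathcal I_k}n_0^{-\varphi}b_{n_0}(X_\ell,x),\qquad \hat\eta_k(x)-\eta_0(x)=L_k(x)+n_0^{-2\varphi}\hat R_k(x):$$ (a) for each $x$: $\hat R_k(x)=O_p(1)$ as $n\to\infty$, uniformly in $K\le n$ and $k$; $E[\delta_{n_0}(W_\ell,x)\mid X_\ell]=0$ a.e.; and $E\|\delta_{n_0}(W_\ell,x)\|^2>C_\delta$; (b) $E\big[E[\|\delta_{n_0}(W_j,X_i)\|^2\mid X_i]^2\big]\le M_1$; $E\big[E[\|n_0^{-\varphi}b_{n_0}(X_j,X_i)\|^2\mid X_i]^2\big]\le n_0^{2(1-2\varphi)}\tau_{n_0}$; for $s=1,2$, $E\|\delta_{n_0}(W_j,X_i)\|^{2s}<n_0^{(s-1)(1-2\varphi)}M_1$ and $E\|n_0^{-\varphi}b_{n_0}(X_j,X_i)\|^{2s}<n_0^{(2s-1)(1-2\varphi)}\tau_{n_0}$;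 and $C_b<E\|\tilde b_{n_0}(X_i)\|^4<M_1$; (c) with $\hat R_{(i)}=\hat R_k(X_i)$ for $i\in\mathcal I_k$: $E\|\hat R_{(i)}\|^2=O(1)$ uniformly in $K\le n$ and $i\le n$; (d) $n^{-1}\sum_{i=1}^n\|\hat R_{(i)}\|^4=O_p(n^{4\varphi})$ uniformly in $K\le n$. **Assumption 3 (leading terms).** The following limits as $n_0\to\infty$ exist and are finite: $$G_\delta=\lim E\Big[E\big[\delta_{n_0}(W_j,X_i)^\top\partial^2_\eta m_i\,\delta_{n_0}(W_\ell,X_i)\mid W_j,W_\ell\big]^2\Big]/J_0^2,\qquad F_\delta=\lim\tfrac12E\big[\delta_{n_0}(W_j,X_i)^\top\partial^2_\eta m_i\,\delta_{n_0}(W_j,X_i)\big]/J_0,$$ $$F_b=\lim\tfrac12E\big[\tilde b_{n_0}(X_i)^\top\partial^2_\eta m_i\,\tilde b_{n_0}(X_i)\big]/J_0,\qquad G_b=\lim E\big[m_j\,\delta_{n_0}(W_j,X_i)^\top\partial^2_\eta m_i\,\tilde b_{n_0}(X_i)\big]/J_0^2,$$ and $G_\delta>0$, $F_\delta+F_b\ne0$,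 $G_b\neq0$. **Theorem.** With $\Delta_i=L_k(X_i)$ for $i\in\mathcal I_k$, let $$\mathcal T_{n,K}=n^{-1/2}\sum_{i=1}^n\frac{m_i}{J_0}+\frac12n^{-1/2}\sum_{i=1}^n\Delta_i^\top\Big(\frac{\partial^2_\eta m_i}{J_0}\Big)\Delta_i .$$ Under Assumptions 1-3, $\mathcal T_{n,K}$ is square integrable for all $2\le K\le n$, and $$\mathrm{Var}[\mathcal T_{n,K}]=\sigma^2+2\,G_b\Big(1+\frac1{K-1}\Big)^{2\varphi-1/2}n^{1/2-2\varphi}+r_{n,K},\qquad \sup_{2\le K\le n}|r_{n,K}|=o(n^{1/2-2\varphi}).$$ -/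

import Mathlib

open MeasureTheory ProbabilityTheory Filter Topology

noncomputable section

namespace DML

/-- The space `ℝ^p` of values of the nuisance parameter, with its Euclidean norm. -/
abbrev Vec (p : ℕ) : Type := EuclideanSpace ℝ (Fin p)

/-- The `i`-th standard unit vector of `ℝ^p`. -/
def unit {p : ℕ} (i : Fin p) : Vec p := EuclideanSpace.single i 1

/-- The matrix of second-order partial derivatives of `f` at `x`. -/
def hess {p : ℕ} (f : Vec p → ℝ) (x : Vec p) : Matrix (Fin p) (Fin p) ℝ :=
  Matrix.of fun i j => iteratedFDeriv ℝ 2 f x ![unit i, unit j]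

/-- The third-order partial derivatives of `f` at `x`. -/
def third {p : ℕ} (f : Vec p → ℝ) (x : Vec p) (i j k : Fin p) : ℝ :=
  iteratedFDeriv ℝ 3 f x ![unit i, unit j, unit k]

/-- The bilinear form `uᵀ A v`. -/
def bil {p : ℕ} (u : Vec p) (A : Matrix (Fin p) (Fin p) ℝ) (v : Vec p) : ℝ :=
  ∑ i, ∑ j, u i * A i j * v j

/-! ### The moment model -/

/-- A moment model that is linear in the parameter of interest. An observation `w : 𝒲` has
distribution `P` and its covariates are `cov w : 𝒳` (in the classical case `𝒲` is a subset of a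
Euclidean space and `cov` selects some of the coordinates). -/
structure Model (𝒲 𝒳 : Type*) [MeasurableSpace 𝒲] [MeasurableSpace 𝒳] (p : ℕ) where
  /-- distribution of one observation -/
  P : Measure 𝒲
  /-- the covariates contained in an observation -/
  cov : 𝒲 → 𝒳
  /-- the set of possible values of the nuisance parameter -/
  T : Set (Vec p)
  /-- the two functions that define the moment function -/
  ψa : 𝒲 → Vec p → ℝ
  ψb : 𝒲 → Vec p → ℝ
  /-- the true nuisance parameter, a function of the covariates -/
  η₀ : 𝒳 → Vec p
  /-- the true parameter of interest -/
  θ₀ : ℝ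
  isProb : IsProbabilityMeasure P
  measurable_cov : Measurable cov
  measurable_ψa : Measurable (Function.uncurry ψa)
  measurable_ψb : Measurable (Function.uncurry ψb)
  measurable_η₀ : Measurable η₀
  η₀_mem : ∀ x, η₀ x ∈ T

attribute [instance] Model.isProb

namespace Model

variable {𝒲 𝒳 : Type*} [MeasurableSpace 𝒲] [MeasurableSpace 𝒳] {p : ℕ} (S : Model 𝒲 𝒳 p)

/-- The moment function `m(w, θ, η) = ψᵇ(w, η) - ψᵃ(w, η) θ`. -/
def m (w : 𝒲) (θ : ℝ) (η : Vec p) : ℝ := S.ψb w η - S.ψa w η * θ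

/-- The moment function at the true parameter values, `m(w, θ₀, η₀(x))`. -/
def m₀ (w : 𝒲) : ℝ := S.m w S.θ₀ (S.η₀ (S.cov w))

/-- `∂²_η m(w, θ₀, η)` at `η = η₀(x)`. -/
def hess₀ (w : 𝒲) : Matrix (Fin p) (Fin p) ℝ :=
  hess (fun η => S.m w S.θ₀ η) (S.η₀ (S.cov w))

/-- `J₀ = E[ψᵃ(W, η₀(X))]`. -/
def J₀ : ℝ := ∫ w, S.ψa w (S.η₀ (S.cov w)) ∂S.P

/-- The first-order asymptotic variance `σ² = E[m²] / E[ψᵃ]²`. -/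
def σsq : ℝ := (∫ w, S.m₀ w ^ 2 ∂S.P) / S.J₀ ^ 2

/-- The parameter of interest satisfies the moment condition `E[m(W, θ₀, η₀(X))] = 0`. -/
def MomentCondition : Prop := Integrable S.m₀ S.P ∧ ∫ w, S.m₀ w ∂S.P = 0

/-- The σ-algebra on the space of observations generated by the covariates. -/
abbrev covσ : MeasurableSpace 𝒲 := MeasurableSpace.comap S.cov inferInstance

/-- The gradient `∂_η ψ(w, η)` at `η = η₀(x)`. -/
def grad₀ (ψ : 𝒲 → Vec p → ℝ) (w : 𝒲) : Vec p := gradient (ψ w) (S.η₀ (S.cov w))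

/-- The smoothness, Neyman orthogonality, moment and boundedness conditions on one of the two
functions `ψ = ψᵃ, ψᵇ`. -/
structure RegularFun (ψ : 𝒲 → Vec p → ℝ) (M C₁ C₂ C₃ : ℝ) : Prop where
  smooth : ∀ w, ∀ η ∈ S.T, ContDiffAt ℝ 3 (ψ w) η
  orthogonal : S.P[S.grad₀ ψ | S.covσ] =ᵐ[S.P] 0
  moment : ∫⁻ w, ‖ψ w (S.η₀ (S.cov w))‖ₑ ^ 4 ∂S.P < ENNReal.ofReal M
  moment_grad : ∫⁻ w, ‖S.grad₀ ψ w‖ₑ ^ 4 ∂S.P < ENNReal.ofReal M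
  cond_grad : ∀ i j, ∀ᵐ w ∂S.P,
    |(S.P[fun v => S.grad₀ ψ v i * S.grad₀ ψ v j | S.covσ]) w| ≤ C₁
  bound_second : ∀ᵐ w ∂S.P, ∀ η ∈ S.T, ∀ i j, |hess (ψ w) η i j| ≤ C₂
  bound_third : ∀ᵐ w ∂S.P, ∀ η ∈ S.T, ∀ i j k, |third (ψ w) η i j k| ≤ C₃

/-- The assumption on the moment function. -/
def MomentAssumption : Prop :=
  ∃ M C₀ C₁ C₂ C₃ : ℝ, 0 < M ∧ 0 < C₀ ∧ 0 < C₁ ∧ 0 < C₂ ∧ 0 < C₃ ∧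
    C₀ < |S.J₀| ∧ S.RegularFun S.ψa M C₁ C₂ C₃ ∧ S.RegularFun S.ψb M C₁ C₂ C₃

end Model

/-! ### The sample and the folds -/

/-- `W 0, W 1, …` are independent observations with distribution `P`. -/
structure IsSample {Ω 𝒲 : Type*} [MeasurableSpace Ω] [MeasurableSpace 𝒲]
    (μ : Measure Ω) (P : Measure 𝒲) (W : ℕ → Ω → 𝒲) : Prop where
  measurable : ∀ i, Measurable (W i)
  indep : iIndepFun W μ
  law : ∀ i, μ.map (W i) = P

/-- The set of indices `i < n` that are not in the fold with label `k`, where `c i` is the label of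
the fold that contains `i`. -/
def train (n : ℕ) (c : ℕ → ℕ) (k : ℕ) : Finset ℕ := (Finset.range n).filter fun i => c i ≠ k

/-- `fold n K ω i` is the label of the fold that contains the index `i` when the indices `i < n`
are randomly split, independently of the sample, into `K` folds of equal size (of sizes
`⌊n/K⌋` and `⌊n/K⌋ + 1` if `K` does not divide `n`). -/
structure IsSplit {Ω 𝒲 : Type*} [MeasurableSpace Ω] [MeasurableSpace 𝒲]
    (μ : Measure Ω) (W : ℕ → Ω → 𝒲) (fold : ℕ → ℕ → Ω → ℕ → ℕ) : Prop where
  measurable : ∀ n K, 2 ≤ K → K ≤ n → Measurable (fold n K)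
  indep : ∀ n K, 2 ≤ K → K ≤ n → IndepFun (fold n K) (fun ω i => W i ω) μ
  label_lt : ∀ n K, 2 ≤ K → K ≤ n → ∀ ω, ∀ i < n, fold n K ω i < K
  balanced : ∀ n K, 2 ≤ K → K ≤ n → ∀ ω, ∀ k < K,
    ((Finset.range n).filter fun i => fold n K ω i = k).card = n / K ∨
    ((Finset.range n).filter fun i => fold n K ω i = k).card = n / K + 1

/-! ### The nuisance parameter estimator -/

/-- An estimator of the nuisance parameter together with the functions in its stochastic expansion.
`est A w x` is the estimate at the point `x` that uses only the observations `w i` with `i ∈ A`;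
`δ n₀` and `b n₀` are the functions in the variance and in the bias term of the expansion when the
estimator uses `n₀` observations. -/
structure Nuisance (𝒲 𝒳 : Type*) [MeasurableSpace 𝒲] [MeasurableSpace 𝒳] (p : ℕ) where
  est : Finset ℕ → (ℕ → 𝒲) → 𝒳 → Vec p
  δ : ℕ → 𝒲 → 𝒳 → Vec p
  b : ℕ → 𝒳 → 𝒳 → Vec p
  measurable_est : ∀ A, Measurable (Function.uncurry (est A))
  est_dependsOn : ∀ A x, DependsOn (fun w => est A w x) (A : Set ℕ)
  measurable_δ : ∀ n₀, Measurable (Function.uncurry (δ n₀))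
  measurable_b : ∀ n₀, Measurable (Function.uncurry (b n₀))

section Expansion

variable {Ω 𝒲 𝒳 : Type*} [MeasurableSpace Ω] [MeasurableSpace 𝒲] [MeasurableSpace 𝒳] {p : ℕ}
  (S : Model 𝒲 𝒳 p) (N : Nuisance 𝒲 𝒳 p) (φ₁ φ₂ : ℝ)

/-- The leading terms of the estimation error at `x` of the estimator that uses the `n₀ = #A`
observations in `A`:
`n₀^{-1/2} ∑_{ℓ ∈ A} n₀^{-φ₁} δ_{n₀}(W_ℓ, x) + n₀^{-1} ∑_{ℓ ∈ A} n₀^{-φ₂} b_{n₀}(X_ℓ, x)`. -/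
def lead (A : Finset ℕ) (w : ℕ → 𝒲) (x : 𝒳) : Vec p :=
  (A.card : ℝ) ^ (-(1 / 2) : ℝ) • ∑ l ∈ A, (A.card : ℝ) ^ (-φ₁) • N.δ A.card (w l) x +
    (A.card : ℝ)⁻¹ • ∑ l ∈ A, (A.card : ℝ) ^ (-φ₂) • N.b A.card (S.cov (w l)) x

/-- The remainder `R̂(x)` of the expansion, determined by
`η̂(x) - η₀(x) = lead + n₀^{-2 min(φ₁, φ₂)} R̂(x)`. -/
def remainder (A : Finset ℕ) (w : ℕ → 𝒲) (x : 𝒳) : Vec p :=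
  (A.card : ℝ) ^ (2 * min φ₁ φ₂) • (N.est A w x - S.η₀ x - lead S N φ₁ φ₂ A w x)

/-- `b̃_{n₀}(x) = E[b_{n₀}(X_j, X_i) | X_i = x]` for `j ≠ i`. -/
def btilde (n₀ : ℕ) (x : 𝒳) : Vec p := ∫ v, N.b n₀ (S.cov v) x ∂S.P

/-- The assumption on the stochastic expansion of the nuisance parameter estimator, with constants
`M₁, C_b, C_δ` and a sequence `τ`. Since `W_i` and `W_j` are independent, the conditional
expectation given `X_i` of a function of `(W_j, X_i)` is the integral over the distribution of
`W_j`. -/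
structure ExpansionConditions (μ : Measure Ω) (W : ℕ → Ω → 𝒲) (fold : ℕ → ℕ → Ω → ℕ → ℕ)
    (M₁ Cb Cδ : ℝ) (τ : ℕ → ℝ) : Prop where
  remainder_bdd : ∀ x, ∀ ε : ℝ, 0 < ε → ∃ B : ℝ, ∀ᶠ n in atTop, ∀ K, 2 ≤ K → K ≤ n → ∀ k < K,
    μ {ω | B < ‖remainder S N φ₁ φ₂ (train n (fold n K ω) k) (fun l => W l ω) x‖}
      ≤ ENNReal.ofReal ε
  δ_centered : ∀ n₀ ≥ 1, ∀ x, S.P[fun w => N.δ n₀ w x | S.covσ] =ᵐ[S.P] 0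
  δ_lower : ∀ n₀ ≥ 1, ∀ x, ENNReal.ofReal Cδ < ∫⁻ w, ‖N.δ n₀ w x‖ₑ ^ 2 ∂S.P
  δ_cond : ∀ n₀ ≥ 1,
    ∫⁻ w, (∫⁻ v, ‖N.δ n₀ v (S.cov w)‖ₑ ^ 2 ∂S.P) ^ 2 ∂S.P ≤ ENNReal.ofReal M₁
  b_cond : ∀ n₀ : ℕ, n₀ ≥ 1 →
    ∫⁻ w, (∫⁻ v, ‖(n₀ : ℝ) ^ (-φ₂) • N.b n₀ (S.cov v) (S.cov w)‖ₑ ^ 2 ∂S.P) ^ 2 ∂S.P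
      ≤ ENNReal.ofReal ((n₀ : ℝ) ^ (2 * (1 - 2 * φ₁)) * τ n₀)
  δ_moment : ∀ n₀ : ℕ, n₀ ≥ 1 → ∀ s ∈ ({1, 2} : Finset ℕ),
    ∫⁻ w, ∫⁻ v, ‖N.δ n₀ v (S.cov w)‖ₑ ^ (2 * s) ∂S.P ∂S.P
      < ENNReal.ofReal ((n₀ : ℝ) ^ (((s : ℝ) - 1) * (1 - 2 * φ₁)) * M₁)
  btilde_lower : ∀ n₀ ≥ 1, ENNReal.ofReal Cb < ∫⁻ w, ‖btilde S N n₀ (S.cov w)‖ₑ ^ 4 ∂S.P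
  btilde_upper : ∀ n₀ ≥ 1, ∫⁻ w, ‖btilde S N n₀ (S.cov w)‖ₑ ^ 4 ∂S.P < ENNReal.ofReal M₁
  b_moment : ∀ n₀ : ℕ, n₀ ≥ 1 → ∀ s ∈ ({1, 2} : Finset ℕ),
    ∫⁻ w, ∫⁻ v, ‖(n₀ : ℝ) ^ (-φ₂) • N.b n₀ (S.cov v) (S.cov w)‖ₑ ^ (2 * s) ∂S.P ∂S.P
      < ENNReal.ofReal ((n₀ : ℝ) ^ ((2 * (s : ℝ) - 1) * (1 - 2 * φ₁)) * τ n₀)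
  remainder_sq : ∃ B : ℝ, ∀ᶠ n in atTop, ∀ K, 2 ≤ K → K ≤ n → ∀ i < n,
    ∫⁻ ω, ‖remainder S N φ₁ φ₂ (train n (fold n K ω) (fold n K ω i)) (fun l => W l ω)
      (S.cov (W i ω))‖ₑ ^ 2 ∂μ ≤ ENNReal.ofReal B
  remainder_fourth : ∀ ε : ℝ, 0 < ε → ∃ B : ℝ, ∀ᶠ n : ℕ in atTop, ∀ K, 2 ≤ K → K ≤ n →
    μ {ω | B * (n : ℝ) ^ (4 * min φ₁ φ₂) <
        (n : ℝ)⁻¹ * ∑ i ∈ Finset.range n, ‖remainder S N φ₁ φ₂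
          (train n (fold n K ω) (fold n K ω i)) (fun l => W l ω) (S.cov (W i ω))‖ ^ 4}
      ≤ ENNReal.ofReal ε

/-- The assumption on the nuisance parameter estimator. -/
def ExpansionAssumption (μ : Measure Ω) (W : ℕ → Ω → 𝒲) (fold : ℕ → ℕ → Ω → ℕ → ℕ) : Prop :=
  ∃ (M₁ Cb Cδ : ℝ) (τ : ℕ → ℝ), 0 < M₁ ∧ 0 < Cb ∧ 0 < Cδ ∧ (∀ n₀, 0 < τ n₀) ∧
    Tendsto τ atTop (𝓝 0) ∧ ExpansionConditions S N φ₁ φ₂ μ W fold M₁ Cb Cδ τ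

/-- The assumption on the leading terms: the four limits exist, with the given values, and are
nondegenerate. In a pair `q`, `q.1` is `W_j`, and `q.2` is `W_ℓ` in `Gδ` and `W_i` elsewhere. -/
structure LeadingTerms (Gδ Fδ Fb Gb : ℝ) : Prop where
  lim_Gδ : Tendsto (fun n₀ => (∫ q : 𝒲 × 𝒲,
      (∫ w, bil (N.δ n₀ q.1 (S.cov w)) (S.hess₀ w) (N.δ n₀ q.2 (S.cov w)) ∂S.P) ^ 2
        ∂(S.P.prod S.P)) / S.J₀ ^ 2) atTop (𝓝 Gδ)
  lim_Fδ : Tendsto (fun n₀ => (1 / 2) * (∫ q : 𝒲 × 𝒲,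
      bil (N.δ n₀ q.1 (S.cov q.2)) (S.hess₀ q.2) (N.δ n₀ q.1 (S.cov q.2))
        ∂(S.P.prod S.P)) / S.J₀) atTop (𝓝 Fδ)
  lim_Fb : Tendsto (fun n₀ => (1 / 2) * (∫ w,
      bil (btilde S N n₀ (S.cov w)) (S.hess₀ w) (btilde S N n₀ (S.cov w)) ∂S.P) / S.J₀)
      atTop (𝓝 Fb)
  lim_Gb : Tendsto (fun n₀ => (∫ q : 𝒲 × 𝒲,
      S.m₀ q.1 * bil (N.δ n₀ q.1 (S.cov q.2)) (S.hess₀ q.2) (btilde S N n₀ (S.cov q.2))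
        ∂(S.P.prod S.P)) / S.J₀ ^ 2) atTop (𝓝 Gb)
  Gδ_pos : 0 < Gδ
  F_ne : Fδ + Fb ≠ 0
  Gb_ne : Gb ≠ 0

/-- `𝒯*_n = n^{-1/2} ∑_{i < n} m(W_i, θ₀, η_i) / J₀`. -/
def Tstar (W : ℕ → Ω → 𝒲) (n : ℕ) (ω : Ω) : ℝ :=
  (n : ℝ) ^ (-(1 / 2) : ℝ) * ∑ i ∈ Finset.range n, S.m₀ (W i ω) / S.J₀

/-- `Δ_i`, the leading terms of the estimation error of `η̂_i`. -/
def Δ (W : ℕ → Ω → 𝒲) (fold : ℕ → ℕ → Ω → ℕ → ℕ) (n K i : ℕ) (ω : Ω) : Vec p :=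
  lead S N φ₁ φ₂ (train n (fold n K ω) (fold n K ω i)) (fun l => W l ω) (S.cov (W i ω))

/-- `𝒯ⁿˡ_{n,K} = (1/2) n^{-1/2} ∑_{i < n} Δ_iᵀ (∂²_η m(W_i, θ₀, η_i) / J₀) Δ_i`. -/
def Tnl (W : ℕ → Ω → 𝒲) (fold : ℕ → ℕ → Ω → ℕ → ℕ) (n K : ℕ) (ω : Ω) : ℝ :=
  (1 / 2) * (n : ℝ) ^ (-(1 / 2) : ℝ) * ∑ i ∈ Finset.range n,
    bil (Δ S N φ₁ φ₂ W fold n K i ω) (S.J₀⁻¹ • S.hess₀ (W i ω)) (Δ S N φ₁ φ₂ W fold n K i ω)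

/-- The second-order approximation `𝒯_{n,K} = 𝒯*_n + 𝒯ⁿˡ_{n,K}` of the centred and scaled DML2
estimator. -/
def Tapprox (W : ℕ → Ω → 𝒲) (fold : ℕ → ℕ → Ω → ℕ → ℕ) (n K : ℕ) (ω : Ω) : ℝ :=
  Tstar S W n ω + Tnl S N φ₁ φ₂ W fold n K ω

end Expansion

end DML

end

/-! Write the approximation as `Tstar` + `Tnl`, so that its variance is Var `Tstar` + 2 Cov + Var
`Tnl`. The first summand is exactly σ². The last is negligible by size alone: every quadratic form
in `Tnl` has L² norm O(n^(-2φ)), so Var `Tnl` = O(n^(1-4φ)). This is of the order of the square of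
n^(1/2-2φ), which tends to 0 because φ > 1/4. The second-order term of the variance is therefore the
covariance.

For the L² bound, freeze X_i. The leading terms of the estimation error become a sum of independent
centred vectors `err`, one for each training observation, plus the deterministic vector `bias`. A
Rosenthal-type inequality (`IsSample.lintegral_sum_pow_four_le`) shows that their fourth moment is
O(n₀^(-4φ)) (`lintegral_lead_pow_four_le`). Since the Hessian is bounded, this controls the square
of the quadratic form (`exists_lintegral_quad_sq_le`).

For the covariance, fix a training set A of size n₀ and an index i outside A, and correlate the form
at i with each m_j. If j is neither i nor in A, independence gives 0. The index j = i is a single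
term, and Cauchy–Schwarz suffices for it. Every j in A gives the same number `crossMoment`: with X_i
frozen, E m = 0 and E `err` = 0 remove all terms except m (`err`ᵀ H `err` + 2 `err`ᵀ H `bias`). In
it, the product of the δ-part of `err` with `bias` has scale n₀^(-1/2-2φ) and yields the limit 2
G_b; the part quadratic in `err` is smaller by n₀^(-φ), and the centred b-part is smaller by a
factor that vanishes with τ and 1/n₀ (`tendsto_crossMoment`).

Summing over j and i, twice the covariance is n₀ `crossMoment` / J₀ up to smaller terms, that is,
about 2 G_b n₀^(1/2-2φ). As n₀ is n(K-1)/K up to a relative error of at most 2/n, whatever K is,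
this is the stated term uniformly in K (`eventually_abs_rpow_mul_sub_le`). All bounds for fixed
folds are uniform over the realized split, which is independent of the sample, so they can be
integrated over it. -/

namespace DML

open scoped ENNReal

set_option linter.unusedSectionVars false

/-! ### Freezing one of two independent variables. -/

section Independence

variable {Ω α β : Type*} [MeasurableSpace Ω] [MeasurableSpace α] [MeasurableSpace β]
  {μ : Measure Ω} [IsProbabilityMeasure μ]

/-- The joint law is the product of the marginals, so this is Tonelli. Both integrals are
transported back to Ω, which lets the lemma serve for a frozen observation as well as for a frozen
split. -/
theorem lintegral_of_indepFun {U : Ω → α} {V : Ω → β} (hU : Measurable U) (hV : Measurable V)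
    (h : IndepFun U V μ) {F : α → β → ℝ≥0∞} (hF : Measurable (Function.uncurry F)) :
    ∫⁻ ω, F (U ω) (V ω) ∂μ = ∫⁻ ω', ∫⁻ ω, F (U ω') (V ω) ∂μ ∂μ := by
  have h1 := (indepFun_iff_map_prod_eq_prod_map_map hU.aemeasurable hV.aemeasurable).1 h
  have := Measure.isProbabilityMeasure_map (μ := μ) hU.aemeasurable
  have := Measure.isProbabilityMeasure_map (μ := μ) hV.aemeasurable
  calc ∫⁻ ω, F (U ω) (V ω) ∂μ
      = ∫⁻ q, Function.uncurry F q ∂(μ.map fun ω => (U ω, V ω)) := by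
        rw [lintegral_map hF (hU.prodMk hV)]; rfl
    _ = ∫⁻ u, ∫⁻ v, F u v ∂(μ.map V) ∂(μ.map U) := by
        rw [h1, lintegral_prod _ hF.aemeasurable]; rfl
    _ = _ := by
        rw [lintegral_map _ hU]
        · refine lintegral_congr fun ω' => ?_
          exact lintegral_map (hF.comp measurable_prodMk_left) hV
        · exact hF.lintegral_prod_right'

theorem integral_of_indepFun {U : Ω → α} {V : Ω → β} (hU : Measurable U) (hV : Measurable V)
    (h : IndepFun U V μ) {F : α → β → ℝ} (hF : Measurable (Function.uncurry F))
    (hi : Integrable (fun ω => F (U ω) (V ω)) μ) :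
    ∫ ω, F (U ω) (V ω) ∂μ = ∫ ω', ∫ ω, F (U ω') (V ω) ∂μ ∂μ := by
  have h1 := (indepFun_iff_map_prod_eq_prod_map_map hU.aemeasurable hV.aemeasurable).1 h
  have := Measure.isProbabilityMeasure_map (μ := μ) hU.aemeasurable
  have := Measure.isProbabilityMeasure_map (μ := μ) hV.aemeasurable
  have hi' : Integrable (Function.uncurry F) ((μ.map U).prod (μ.map V)) := by
    rw [← h1]
    exact (integrable_map_measure hF.aestronglyMeasurable (hU.prodMk hV).aemeasurable).2 hi
  calc ∫ ω, F (U ω) (V ω) ∂μ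
      = ∫ q, Function.uncurry F q ∂(μ.map fun ω => (U ω, V ω)) := by
        rw [integral_map (hU.prodMk hV).aemeasurable hF.aestronglyMeasurable]; rfl
    _ = ∫ u, ∫ v, F u v ∂(μ.map V) ∂(μ.map U) := by
        rw [h1, integral_prod _ hi']; rfl
    _ = _ := by
        rw [integral_map hU.aemeasurable]
        · refine integral_congr_ae (ae_of_all _ fun ω' => ?_)
          exact integral_map hV.aemeasurable
            (hF.comp measurable_prodMk_left).aestronglyMeasurable
        · exact (hF.stronglyMeasurable.integral_prod_right').aestronglyMeasurable

end Independence

/-! ### Cauchy–Schwarz and other L^p tools. -/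

section CauchySchwarz

variable {α : Type*} [MeasurableSpace α] {ν : Measure α}

/-- Hölder with exponents 2 and 2. The bounds on second moments are written as squares, so no roots
appear in the conclusion. -/
theorem lintegral_enorm_mul_le {f g : α → ℝ} (hf : AEStronglyMeasurable f ν)
    (hg : AEStronglyMeasurable g ν)
    {a b : ℝ} (ha : 0 ≤ a) (hfa : ∫⁻ x, ‖f x‖ₑ ^ 2 ∂ν ≤ ENNReal.ofReal (a ^ 2))
    (hb : 0 ≤ b) (hgb : ∫⁻ x, ‖g x‖ₑ ^ 2 ∂ν ≤ ENNReal.ofReal (b ^ 2)) :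
    ∫⁻ x, ‖f x * g x‖ₑ ∂ν ≤ ENNReal.ofReal (a * b) := by
  have h := ENNReal.lintegral_mul_le_Lp_mul_Lq ν Real.HolderConjugate.two_two hf.enorm hg.enorm
  simp only [Pi.mul_apply, ENNReal.rpow_two] at h
  simp only [enorm_mul]
  refine h.trans ?_
  have key : ∀ {c : ℝ} {y : ℝ≥0∞}, 0 ≤ c → y ≤ ENNReal.ofReal (c ^ 2) →
      y ^ (1 / 2 : ℝ) ≤ ENNReal.ofReal c := by
    intro c y hc hy
    calc y ^ (1 / 2 : ℝ) ≤ (ENNReal.ofReal (c ^ 2)) ^ (1 / 2 : ℝ) :=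
          ENNReal.rpow_le_rpow hy (by norm_num)
      _ = ENNReal.ofReal c := by
          rw [ENNReal.ofReal_rpow_of_nonneg (by positivity) (by norm_num), ← Real.sqrt_eq_rpow,
            Real.sqrt_sq hc]
  rw [ENNReal.ofReal_mul ha]
  exact mul_le_mul' (key ha hfa) (key hb hgb)

theorem abs_integral_mul_le {f g : α → ℝ} (hf : AEStronglyMeasurable f ν)
    (hg : AEStronglyMeasurable g ν)
    {a b : ℝ} (ha : 0 ≤ a) (hfa : ∫⁻ x, ‖f x‖ₑ ^ 2 ∂ν ≤ ENNReal.ofReal (a ^ 2))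
    (hb : 0 ≤ b) (hgb : ∫⁻ x, ‖g x‖ₑ ^ 2 ∂ν ≤ ENNReal.ofReal (b ^ 2)) :
    |∫ x, f x * g x ∂ν| ≤ a * b := by
  have h := (enorm_integral_le_lintegral_enorm (μ := ν) fun x => f x * g x).trans
    (lintegral_enorm_mul_le hf hg ha hfa hb hgb)
  rwa [Real.enorm_eq_ofReal_abs, ENNReal.ofReal_le_ofReal_iff (by positivity)] at h

end CauchySchwarz

/-- Since 1/4 + 1/4 = 1/2, a product of two L⁴ functions is in L² and can be paired with a third
factor. -/
instance holderTriple_four_four_two : ENNReal.HolderTriple 4 4 2 where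
  inv_add_inv_eq_inv := by
    rw [← ENNReal.toReal_eq_toReal_iff' (by simp) (by simp), ENNReal.toReal_add (by simp) (by simp)]
    norm_num [ENNReal.toReal_inv]

theorem memLp_nat_iff {α E : Type*} [MeasurableSpace α] [NormedAddCommGroup E] {ν : Measure α}
    {f : α → E} (hf : AEStronglyMeasurable f ν) (k : ℕ) (hk : k ≠ 0) :
    MemLp f k ν ↔ ∫⁻ x, ‖f x‖ₑ ^ k ∂ν < ∞ := by
  have h := eLpNorm_lt_top_iff_lintegral_rpow_enorm_lt_top (f := f) (μ := ν) (p := k)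
    (by simpa using hk) (by simp)
  simp only [ENNReal.toReal_natCast, ENNReal.rpow_natCast] at h
  exact ⟨fun h' => h.1 h'.2, fun h' => ⟨hf, h.2 h'⟩⟩

theorem integrable_pow_four {α : Type*} [MeasurableSpace α] {ν : Measure α} [IsFiniteMeasure ν]
    {g : α → ℝ} (hg : MemLp g 4 ν) : Integrable (fun x => g x ^ 4) ν := by
  refine (hg.integrable_norm_pow (p := 4) (by norm_num)).congr (ae_of_all _ fun x => ?_)
  simp only [Real.norm_eq_abs]
  exact Even.pow_abs (by decide) _

/-! ### Sums over an i.i.d. sample. -/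

section Sample

variable {Ω 𝒲 : Type*} [MeasurableSpace Ω] [MeasurableSpace 𝒲]
  {μ : Measure Ω} [IsProbabilityMeasure μ] {P : Measure 𝒲} {W : ℕ → Ω → 𝒲}

theorem IsSample.measurePreserving (hW : IsSample μ P W) (i : ℕ) :
    MeasurePreserving (W i) μ P := ⟨hW.measurable i, hW.law i⟩

theorem IsSample.indepFun_tuple (hW : IsSample μ P W) {i : ℕ} {A : Finset ℕ} (hi : i ∉ A) :
    IndepFun (W i) (fun ω (l : A) => W l ω) μ := by
  have h := hW.indep.indepFun_finset {i} A (by simpa using hi) hW.measurable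
  have h2 : Measurable fun y : (({i} : Finset ℕ) → 𝒲) => y ⟨i, by simp⟩ := measurable_pi_apply _
  exact h.comp h2 measurable_id

theorem IsSample.measurable_tuple (hW : IsSample μ P W) (A : Finset ℕ) :
    Measurable (fun ω (l : A) => W l ω) := measurable_pi_lambda _ fun l => hW.measurable l

/-- This replaces conditioning on W_i: because i is outside A, the observation W_i can be frozen at
a point and integrated out last. -/
theorem IsSample.lintegral_decouple (hW : IsSample μ P W) {i : ℕ} {A : Finset ℕ} (hi : i ∉ A)
    {F : 𝒲 → (A → 𝒲) → ℝ≥0∞} (hF : Measurable (Function.uncurry F)) :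
    ∫⁻ ω, F (W i ω) (fun l => W l ω) ∂μ = ∫⁻ x, ∫⁻ ω, F x (fun l => W l ω) ∂μ ∂P := by
  rw [lintegral_of_indepFun (hW.measurable i) (hW.measurable_tuple A) (hW.indepFun_tuple hi) hF,
    (hW.measurePreserving i).lintegral_comp (f := fun x => ∫⁻ ω, F x (fun l => W l ω) ∂μ)]
  exact Measurable.lintegral_prod_right'
    (f := fun q : 𝒲 × Ω => F q.1 (fun l => W l q.2))
    (hF.comp (measurable_fst.prodMk ((hW.measurable_tuple A).comp measurable_snd)))

theorem IsSample.integral_decouple (hW : IsSample μ P W) {i : ℕ} {A : Finset ℕ} (hi : i ∉ A)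
    {F : 𝒲 → (A → 𝒲) → ℝ} (hF : Measurable (Function.uncurry F))
    (hint : Integrable (fun ω => F (W i ω) (fun l => W l ω)) μ) :
    ∫ ω, F (W i ω) (fun l => W l ω) ∂μ = ∫ x, ∫ ω, F x (fun l => W l ω) ∂μ ∂P := by
  rw [integral_of_indepFun (hW.measurable i) (hW.measurable_tuple A) (hW.indepFun_tuple hi) hF hint,
    ← hW.law i, integral_map (hW.measurable i).aemeasurable]
  refine StronglyMeasurable.aestronglyMeasurable ?_
  exact StronglyMeasurable.integral_prod_right'
    (f := fun q : 𝒲 × Ω => F q.1 (fun l => W l q.2))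
    (hF.comp (measurable_fst.prodMk
      ((hW.measurable_tuple A).comp measurable_snd))).stronglyMeasurable

variable (hW : IsSample μ P W)
include hW

theorem IsSample.memLp_comp {f : 𝒲 → ℝ} {q : ℝ≥0∞} (hf : MemLp f q P) (i : ℕ) :
    MemLp (fun ω => f (W i ω)) q μ := hf.comp_measurePreserving (hW.measurePreserving i)

theorem IsSample.integral_comp {f : 𝒲 → ℝ} (hf : Measurable f) (i : ℕ) :
    ∫ ω, f (W i ω) ∂μ = ∫ w, f w ∂P := by
  rw [← hW.law i, integral_map (hW.measurable i).aemeasurable hf.aestronglyMeasurable]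

theorem IsSample.memLp_sum {f : 𝒲 → ℝ} {q : ℝ≥0∞} (hf : MemLp f q P) (A : Finset ℕ) :
    MemLp (fun ω => ∑ l ∈ A, f (W l ω)) q μ :=
  memLp_finsetSum _ fun l _ => hW.memLp_comp hf l

theorem IsSample.integral_sum {f : 𝒲 → ℝ} (hf : Measurable f) (hi : Integrable f P)
    (A : Finset ℕ) : ∫ ω, ∑ l ∈ A, f (W l ω) ∂μ = A.card * ∫ w, f w ∂P := by
  have h : ∀ l ∈ A, Integrable (fun ω => f (W l ω)) μ :=
    fun l _ => (hW.measurePreserving l).integrable_comp_of_integrable hi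
  rw [integral_finsetSum _ h]
  simp [hW.integral_comp hf]

/-- Functions of one observation and of a tuple of other observations are independent. -/
theorem IsSample.indepFun_comp_tuple {i : ℕ} {A : Finset ℕ} (hi : i ∉ A) {f : 𝒲 → ℝ}
    (hf : Measurable f) {g : (A → 𝒲) → ℝ} (hg : Measurable g) :
    IndepFun (fun ω => f (W i ω)) (fun ω => g fun l => W l ω) μ :=
  (hW.indepFun_tuple hi).comp hf hg

theorem IsSample.indepFun_sum {i : ℕ} {A : Finset ℕ} (hi : i ∉ A) {f g : 𝒲 → ℝ}
    (hf : Measurable f) (hg : Measurable g) :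
    IndepFun (fun ω => f (W i ω)) (fun ω => ∑ l ∈ A, g (W l ω)) μ := by
  have h := hW.indepFun_comp_tuple hi hf (g := fun y => ∑ l, g (y l))
    (Finset.measurable_sum _ fun l _ => hg.comp (measurable_pi_apply l))
  have e : ∀ ω, ∑ l : A, g (W l ω) = ∑ l ∈ A, g (W l ω) :=
    fun ω => Finset.sum_coe_sort A fun l => g (W l ω)
  simpa only [e] using h

/-- A fourth moment inequality for sums of centred independent variables. -/
theorem IsSample.integral_sum_pow_four_le {f : 𝒲 → ℝ} (hf : Measurable f) (h4 : MemLp f 4 P)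
    (h0 : ∫ w, f w ∂P = 0) (A : Finset ℕ) :
    ∫ ω, (∑ l ∈ A, f (W l ω)) ^ 4 ∂μ ≤
      3 * A.card * ∫ w, f w ^ 4 ∂P + 4 * A.card ^ 2 * (∫ w, f w ^ 2 ∂P) ^ 2 := by
  have hP : IsProbabilityMeasure P := by
    rw [← hW.law 0]; exact Measure.isProbabilityMeasure_map (hW.measurable 0).aemeasurable
  have h2 : MemLp f 2 P := h4.mono_exponent (by norm_num)
  have h1 : Integrable f P := h2.integrable (by norm_num)
  -- The variance of the partial sum is needed for the mixed term X²S² in the induction for the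
  -- fourth moment.
  have hsq : ∀ A : Finset ℕ, ∫ ω, (∑ l ∈ A, f (W l ω)) ^ 2 ∂μ = A.card * ∫ w, f w ^ 2 ∂P := by
    intro A
    induction A using Finset.induction_on with
    | empty => simp
    | insert i A hi ih =>
      have hind := hW.indepFun_sum hi hf hf
      have hS2 : MemLp (fun ω => ∑ l ∈ A, f (W l ω)) 2 μ := hW.memLp_sum h2 A
      have hX2 : MemLp (fun ω => f (W i ω)) 2 μ := hW.memLp_comp h2 i
      have hXS := hind.integral_fun_mul_eq_mul_integral hX2.1 hS2.1
      rw [hW.integral_comp hf, h0, zero_mul] at hXS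
      have hXSi : Integrable (fun ω => f (W i ω) * ∑ l ∈ A, f (W l ω)) μ :=
        hX2.integrable_mul hS2
      have : ∀ ω, (∑ l ∈ insert i A, f (W l ω)) ^ 2 = f (W i ω) ^ 2 +
          2 * (f (W i ω) * ∑ l ∈ A, f (W l ω)) + (∑ l ∈ A, f (W l ω)) ^ 2 := by
        intro ω; rw [Finset.sum_insert hi]; ring
      simp_rw [this]
      have e2 := integral_add (hX2.integrable_sq.add (hXSi.const_mul 2)) hS2.integrable_sq
      have e1 := integral_add hX2.integrable_sq (hXSi.const_mul 2)
      simp only [Pi.add_apply] at e1 e2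
      rw [e2, e1, integral_const_mul, hXS, ih,
        hW.integral_comp (hf.pow_const 2), Finset.card_insert_of_notMem hi]
      push_cast; ring
  induction A using Finset.induction_on with
  | empty => simp
  | insert i A hi ih =>
    have hS4 : MemLp (fun ω => ∑ l ∈ A, f (W l ω)) 4 μ := hW.memLp_sum h4 A
    have hX4 : MemLp (fun ω => f (W i ω)) 4 μ := hW.memLp_comp h4 i
    have hS2 : MemLp (fun ω => ∑ l ∈ A, f (W l ω)) 2 μ := hS4.mono_exponent (by norm_num)
    have hX2 : MemLp (fun ω => f (W i ω)) 2 μ := hX4.mono_exponent (by norm_num)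
    have hind := hW.indepFun_sum hi hf hf
    have hind3 : IndepFun (fun ω => f (W i ω)) (fun ω => (∑ l ∈ A, f (W l ω)) ^ 3) μ :=
      hind.comp measurable_id (measurable_id.pow_const 3)
    have hind2 : IndepFun (fun ω => f (W i ω) ^ 2) (fun ω => (∑ l ∈ A, f (W l ω)) ^ 2) μ :=
      hind.comp (measurable_id.pow_const 2) (measurable_id.pow_const 2)
    have hS3 : Integrable (fun ω => (∑ l ∈ A, f (W l ω)) ^ 3) μ := by
      have := (hS4.mul (r := 2) hS4).integrable_mul hS2
      refine this.congr (ae_of_all _ fun ω => ?_)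
      simp only [Pi.mul_apply]; ring
    have hXS3 := hind3.integral_fun_mul_eq_mul_integral hX2.1 hS3.1
    rw [hW.integral_comp hf, h0, zero_mul] at hXS3
    have hXS2 := hind2.integral_fun_mul_eq_mul_integral hX2.integrable_sq.1 hS2.integrable_sq.1
    rw [hW.integral_comp (hf.pow_const 2), hsq] at hXS2
    have hXS3i : Integrable (fun ω => f (W i ω) * (∑ l ∈ A, f (W l ω)) ^ 3) μ :=
      hind3.integrable_mul (hX2.integrable (by norm_num)) hS3
    have hXS2i : Integrable (fun ω => f (W i ω) ^ 2 * (∑ l ∈ A, f (W l ω)) ^ 2) μ :=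
      hind2.integrable_mul hX2.integrable_sq hS2.integrable_sq
    -- With X the new summand and S the old sum, 4X³S ≤ 2X⁴ + 2X²S² absorbs the only odd term that
    -- is not integrated exactly; 4XS³ is kept because its mean is 0.
    have hbd : ∀ ω, (∑ l ∈ insert i A, f (W l ω)) ^ 4 ≤ (∑ l ∈ A, f (W l ω)) ^ 4 +
        4 * (f (W i ω) * (∑ l ∈ A, f (W l ω)) ^ 3) +
        8 * (f (W i ω) ^ 2 * (∑ l ∈ A, f (W l ω)) ^ 2) + 3 * f (W i ω) ^ 4 := by
      intro ω
      rw [Finset.sum_insert hi]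
      nlinarith [sq_nonneg (f (W i ω) * (f (W i ω) - ∑ l ∈ A, f (W l ω)))]
    have hint1 := (integrable_pow_four hS4).add (hXS3i.const_mul 4)
    have hint2 := hint1.add (hXS2i.const_mul 8)
    have hint3 := hint2.add ((integrable_pow_four hX4).const_mul 3)
    have hmono := integral_mono (integrable_pow_four (hW.memLp_sum h4 (insert i A))) hint3 hbd
    refine hmono.trans ?_
    have e3 := integral_add hint2 ((integrable_pow_four hX4).const_mul 3)
    have e2 := integral_add hint1 (hXS2i.const_mul 8)
    have e1 := integral_add (integrable_pow_four hS4) (hXS3i.const_mul 4)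
    simp only [integral_const_mul, Pi.add_apply] at e1 e2 e3
    rw [hXS3] at e1
    rw [hXS2] at e2
    rw [hW.integral_comp (hf.pow_const 4)] at e3
    simp only [Pi.add_apply]
    rw [e3, e2, e1, Finset.card_insert_of_notMem hi]
    push_cast
    -- The induction closes because 4(N+1)² - 4N² ≥ 8N, with N the number of old summands.
    nlinarith [sq_nonneg (∫ w, f w ^ 2 ∂P), ih]

/-- No integrability is needed in this form: if f is not in L⁴ and A is nonempty, the right side is
infinite. -/
theorem IsSample.lintegral_sum_pow_four_le {f : 𝒲 → ℝ} (hf : Measurable f)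
    (h0 : ∫ w, f w ∂P = 0) (A : Finset ℕ) :
    ∫⁻ ω, ‖∑ l ∈ A, f (W l ω)‖ₑ ^ 4 ∂μ ≤
      3 * A.card * ∫⁻ w, ‖f w‖ₑ ^ 4 ∂P + 4 * A.card ^ 2 * (∫⁻ w, ‖f w‖ₑ ^ 2 ∂P) ^ 2 := by
  have hP : IsProbabilityMeasure P := by
    rw [← hW.law 0]; exact Measure.isProbabilityMeasure_map (hW.measurable 0).aemeasurable
  rcases A.eq_empty_or_nonempty with rfl | hA
  · simp
  by_cases h4 : MemLp f 4 P
  swap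
  · have : ∫⁻ w, ‖f w‖ₑ ^ 4 ∂P = ∞ := by
      by_contra hne
      exact h4 ((memLp_nat_iff hf.aestronglyMeasurable 4 (by norm_num)).2 (lt_top_iff_ne_top.2 hne))
    rw [this, ENNReal.mul_top, top_add]
    · exact le_top
    · simp [hA.ne_empty]
  have h2 : MemLp f 2 P := h4.mono_exponent (by norm_num)
  have hpow4 : ∀ x : ℝ, ‖x‖ₑ ^ 4 = ENNReal.ofReal (x ^ 4) := by
    intro x
    rw [Real.enorm_eq_ofReal_abs, ← ENNReal.ofReal_pow (abs_nonneg _), Even.pow_abs (by decide)]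
  have hpow2 : ∀ x : ℝ, ‖x‖ₑ ^ 2 = ENNReal.ofReal (x ^ 2) := by
    intro x
    rw [Real.enorm_eq_ofReal_abs, ← ENNReal.ofReal_pow (abs_nonneg _), Even.pow_abs (by decide)]
  simp_rw [hpow4, hpow2]
  rw [← ofReal_integral_eq_lintegral_ofReal (integrable_pow_four (hW.memLp_sum h4 A))
      (ae_of_all _ fun _ => by positivity),
    ← ofReal_integral_eq_lintegral_ofReal (integrable_pow_four h4) (ae_of_all _ fun _ => by positivity),
    ← ofReal_integral_eq_lintegral_ofReal h2.integrable_sq (ae_of_all _ fun _ => by positivity),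
    ← ENNReal.ofReal_natCast A.card, show (3 : ℝ≥0∞) = ENNReal.ofReal 3 by simp,
    show (4 : ℝ≥0∞) = ENNReal.ofReal 4 by simp,
    ← ENNReal.ofReal_pow (by positivity), ← ENNReal.ofReal_pow (integral_nonneg fun _ => sq_nonneg _),
    ← ENNReal.ofReal_mul (by positivity), ← ENNReal.ofReal_mul (by positivity),
    ← ENNReal.ofReal_mul (by positivity), ← ENNReal.ofReal_mul (by positivity),
    ← ENNReal.ofReal_add _ (by positivity)]
  · exact ENNReal.ofReal_le_ofReal (hW.integral_sum_pow_four_le hf h4 h0 A)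
  · exact mul_nonneg (by positivity) (integral_nonneg fun _ => by positivity)

/-- The expectation of a product of a centred variable and two sums of centred variables that are
independent except that one term of each sum depends on the same observation as the variable. -/
theorem IsSample.integral_mul_sum_mul_sum {m f g : 𝒲 → ℝ} (hm : Measurable m) (hf : Measurable f)
    (hg : Measurable g) (hm4 : MemLp m 4 P) (hf4 : MemLp f 4 P) (hg4 : MemLp g 4 P)
    (hm0 : ∫ w, m w ∂P = 0) (hf0 : ∫ w, f w ∂P = 0) (hg0 : ∫ w, g w ∂P = 0)
    {A : Finset ℕ} {j : ℕ} (hj : j ∈ A) (a b : ℝ) :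
    Integrable (fun ω => m (W j ω) * ((∑ l ∈ A, f (W l ω) + a) * (∑ l ∈ A, g (W l ω) + b))) μ ∧
    ∫ ω, m (W j ω) * ((∑ l ∈ A, f (W l ω) + a) * (∑ l ∈ A, g (W l ω) + b)) ∂μ =
      ∫ w, m w * (f w * g w + f w * b + a * g w) ∂P := by
  have hP : IsProbabilityMeasure P := by
    rw [← hW.law 0]; exact Measure.isProbabilityMeasure_map (hW.measurable 0).aemeasurable
  -- Separating the index j leaves sums over B that are independent of W_j. Of the four products
  -- below, only the one without a sum over B has nonzero mean, which is why the answer does not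
  -- depend on the size of A.
  obtain ⟨B, hjB, rfl⟩ : ∃ B, j ∉ B ∧ insert j B = A :=
    ⟨A.erase j, by simp, Finset.insert_erase hj⟩
  have hfa : MemLp (fun w => f w + a) 4 P := hf4.add (memLp_const a)
  have hgb : MemLp (fun w => g w + b) 4 P := hg4.add (memLp_const b)
  have hmfa : MemLp (fun w => m w * (f w + a)) 2 P := hfa.mul (r := 2) hm4
  have hmgb : MemLp (fun w => m w * (g w + b)) 2 P := hgb.mul (r := 2) hm4
  have hm2 : MemLp m 2 P := hm4.mono_exponent (by norm_num)
  have hF : MemLp (fun ω => ∑ l ∈ B, f (W l ω)) 2 μ :=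
    hW.memLp_sum (hf4.mono_exponent (by norm_num)) B
  have hG : MemLp (fun ω => ∑ l ∈ B, g (W l ω)) 2 μ :=
    hW.memLp_sum (hg4.mono_exponent (by norm_num)) B
  have hF0 : ∫ ω, ∑ l ∈ B, f (W l ω) ∂μ = 0 := by
    rw [hW.integral_sum hf (hf4.integrable (by norm_num)), hf0, mul_zero]
  have hG0 : ∫ ω, ∑ l ∈ B, g (W l ω) ∂μ = 0 := by
    rw [hW.integral_sum hg (hg4.integrable (by norm_num)), hg0, mul_zero]
  have hmm := hm.mul (hf.add_const a)
  have hmm' := hm.mul (hg.add_const b)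
  have i1 : Integrable (fun w => m w * ((f w + a) * (g w + b))) P :=
    hm2.integrable_mul (hgb.mul (r := 2) hfa)
  have I1 : Integrable (fun ω => m (W j ω) * ((f (W j ω) + a) * (g (W j ω) + b))) μ :=
    (hW.measurePreserving j).integrable_comp_of_integrable i1
  have ind2 := hW.indepFun_sum hjB hmm hg
  have ind3 := hW.indepFun_sum hjB hmm' hf
  have I2 : Integrable (fun ω => m (W j ω) * (f (W j ω) + a) * ∑ l ∈ B, g (W l ω)) μ :=
    (hW.memLp_comp hmfa j).integrable_mul hG
  have I3 : Integrable (fun ω => m (W j ω) * (g (W j ω) + b) * ∑ l ∈ B, f (W l ω)) μ :=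
    (hW.memLp_comp hmgb j).integrable_mul hF
  have ind4 : IndepFun (fun ω => m (W j ω))
      (fun ω => (∑ l ∈ B, f (W l ω)) * ∑ l ∈ B, g (W l ω)) μ := by
    have h := hW.indepFun_comp_tuple hjB hm (g := fun y => (∑ l, f (y l)) * ∑ l, g (y l))
      ((Finset.measurable_sum _ fun l _ => hf.comp (measurable_pi_apply l)).mul
        (Finset.measurable_sum _ fun l _ => hg.comp (measurable_pi_apply l)))
    have e : ∀ (h : 𝒲 → ℝ) ω, ∑ l : B, h (W l ω) = ∑ l ∈ B, h (W l ω) :=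
      fun h ω => Finset.sum_coe_sort B fun l => h (W l ω)
    simpa only [e] using h
  have I4 : Integrable (fun ω => m (W j ω) * ((∑ l ∈ B, f (W l ω)) * ∑ l ∈ B, g (W l ω))) μ :=
    ind4.integrable_mul ((hW.memLp_comp hm2 j).integrable (by norm_num)) (hF.integrable_mul hG)
  have E2 := ind2.integral_fun_mul_eq_mul_integral
    (hW.memLp_comp hmfa j).1 hG.1
  have E3 := ind3.integral_fun_mul_eq_mul_integral
    (hW.memLp_comp hmgb j).1 hF.1
  have E4 := ind4.integral_fun_mul_eq_mul_integral
    (hW.memLp_comp hm2 j).1 (hF.integrable_mul hG).1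
  rw [hG0, mul_zero] at E2
  rw [hF0, mul_zero] at E3
  rw [hW.integral_comp hm, hm0, zero_mul] at E4
  have hexp : ∀ ω, m (W j ω) * ((∑ l ∈ insert j B, f (W l ω) + a) *
      (∑ l ∈ insert j B, g (W l ω) + b)) =
      m (W j ω) * ((f (W j ω) + a) * (g (W j ω) + b)) +
      m (W j ω) * (f (W j ω) + a) * (∑ l ∈ B, g (W l ω)) +
      m (W j ω) * (g (W j ω) + b) * (∑ l ∈ B, f (W l ω)) +
      m (W j ω) * ((∑ l ∈ B, f (W l ω)) * ∑ l ∈ B, g (W l ω)) := by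
    intro ω
    rw [Finset.sum_insert hjB, Finset.sum_insert hjB]; ring
  simp_rw [hexp]
  refine ⟨((I1.add I2).add I3).add I4, ?_⟩
  have e1 := integral_add ((I1.add I2).add I3) I4
  have e2 := integral_add (I1.add I2) I3
  have e3 := integral_add I1 I2
  simp only [Pi.add_apply, Pi.mul_apply] at e1 e2 e3 E2 E3 E4
  rw [e1, e2, e3, E2, E3, E4, hW.integral_comp (f := fun w => m w * ((f w + a) * (g w + b)))
    (by fun_prop)]
  -- The product of the two constants drops out because m is centred.
  have hab : ∫ w, m w * (a * b) ∂P = 0 := by rw [integral_mul_const, hm0, zero_mul]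
  have i5 : Integrable (fun w => m w * (a * b)) P := (hm2.integrable (by norm_num)).mul_const _
  calc (∫ w, m w * ((f w + a) * (g w + b)) ∂P) + 0 + 0 + 0
      = (∫ w, m w * ((f w + a) * (g w + b)) ∂P) - ∫ w, m w * (a * b) ∂P := by rw [hab]; ring
    _ = ∫ w, (m w * ((f w + a) * (g w + b)) - m w * (a * b)) ∂P := (integral_sub i1 i5).symm
    _ = _ := by congr 1; ext w; ring

end Sample

end DML

namespace DML

open scoped ENNReal

set_option linter.unusedSectionVars false

/-! ### Quadratic forms, and the Hessian of the moment function. -/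

section Bilinear

variable {p : ℕ}

theorem bil_add_left (u u' : Vec p) (A : Matrix (Fin p) (Fin p) ℝ) (v : Vec p) :
    bil (u + u') A v = bil u A v + bil u' A v := by
  simp only [bil, ← Finset.sum_add_distrib, PiLp.add_apply]
  exact Finset.sum_congr rfl fun i _ => Finset.sum_congr rfl fun j _ => by ring

theorem bil_smul_left (c : ℝ) (u : Vec p) (A : Matrix (Fin p) (Fin p) ℝ) (v : Vec p) :
    bil (c • u) A v = c * bil u A v := by
  simp only [bil, Finset.mul_sum, PiLp.smul_apply, smul_eq_mul, mul_assoc]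

theorem bil_smul_right (c : ℝ) (u : Vec p) (A : Matrix (Fin p) (Fin p) ℝ) (v : Vec p) :
    bil u A (c • v) = c * bil u A v := by
  simp only [bil, Finset.mul_sum, PiLp.smul_apply, smul_eq_mul]
  exact Finset.sum_congr rfl fun i _ => Finset.sum_congr rfl fun j _ => by ring

theorem bil_smul_matrix (c : ℝ) (u : Vec p) (A : Matrix (Fin p) (Fin p) ℝ) (v : Vec p) :
    bil u (c • A) v = c * bil u A v := by
  simp only [bil, Finset.mul_sum, Matrix.smul_apply, smul_eq_mul]
  exact Finset.sum_congr rfl fun i _ => Finset.sum_congr rfl fun j _ => by ring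

theorem bil_comm {A : Matrix (Fin p) (Fin p) ℝ} (hA : ∀ i j, A i j = A j i) (u v : Vec p) :
    bil u A v = bil v A u := by
  unfold bil
  rw [Finset.sum_comm]
  exact Finset.sum_congr rfl fun i _ => Finset.sum_congr rfl fun j _ => by rw [hA]; ring

theorem abs_bil_le {A : Matrix (Fin p) (Fin p) ℝ} {h : ℝ} (hA : ∀ i j, |A i j| ≤ h)
    (u v : Vec p) : |bil u A v| ≤ (p ^ 2 * h) * (‖u‖ * ‖v‖) := by
  have hterm : ∀ i j, |u i * A i j * v j| ≤ h * (‖u‖ * ‖v‖) := by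
    intro i j
    have h1 : |u i| ≤ ‖u‖ := by simpa using PiLp.norm_apply_le u i
    have h2 : |v j| ≤ ‖v‖ := by simpa using PiLp.norm_apply_le v j
    rw [abs_mul, abs_mul]
    calc |u i| * |A i j| * |v j| = |A i j| * (|u i| * |v j|) := by ring
      _ ≤ h * (‖u‖ * ‖v‖) := mul_le_mul (hA i j)
          (mul_le_mul h1 h2 (abs_nonneg _) (norm_nonneg _)) (by positivity)
          ((abs_nonneg _).trans (hA i j))
  calc |bil u A v| ≤ ∑ i, ∑ j, |u i * A i j * v j| :=
        (Finset.abs_sum_le_sum_abs _ _).trans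
          (Finset.sum_le_sum fun i _ => Finset.abs_sum_le_sum_abs _ _)
    _ ≤ ∑ _i : Fin p, ∑ _j : Fin p, h * (‖u‖ * ‖v‖) :=
        Finset.sum_le_sum fun i _ => Finset.sum_le_sum fun j _ => hterm i j
    _ = _ := by simp; ring

theorem measurable_bil {α : Type*} [MeasurableSpace α] {u v : α → Vec p}
    {A : α → Matrix (Fin p) (Fin p) ℝ} (hu : Measurable u)
    (hA : ∀ i j, Measurable fun x => A x i j) (hv : Measurable v) :
    Measurable fun x => bil (u x) (A x) (v x) :=
  Finset.measurable_sum _ fun i _ => Finset.measurable_sum _ fun j _ =>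
    (((EuclideanSpace.proj (𝕜 := ℝ) i).measurable.comp hu).mul (hA i j)).mul
      ((EuclideanSpace.proj (𝕜 := ℝ) j).measurable.comp hv)

end Bilinear

section Hessian

variable {p : ℕ}

theorem hess_apply (f : Vec p → ℝ) (x : Vec p) (i j : Fin p) :
    hess f x i j = fderiv ℝ (fderiv ℝ f) x (unit i) (unit j) := by
  simp [hess, iteratedFDeriv_two_apply]

theorem hess_symm {f : Vec p → ℝ} {x : Vec p} (hf : ContDiffAt ℝ 3 f x) (i j : Fin p) :
    hess f x i j = hess f x j i := by
  rw [hess_apply, hess_apply]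
  exact hf.isSymmSndFDerivAt (by simp; norm_num) _ _

/-- A directional derivative as a limsup along steps 1/n: a countable limsup of measurable functions
is measurable even where no derivative exists. -/
theorem limsup_difference_quotient {f : Vec p → ℝ} {f' : Vec p →L[ℝ] ℝ} {x : Vec p}
    (hf : HasFDerivAt f f' x) (v : Vec p) :
    limsup (fun n : ℕ => (n : ℝ) * (f (x + (n : ℝ)⁻¹ • v) - f x)) atTop = f' v :=
  ((hf.lim_real v).comp tendsto_natCast_atTop_atTop).limsup_eq

/-- Second-order partial derivatives of a jointly measurable function are measurable, along a
measurable choice of points at which the function is sufficiently smooth. -/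
theorem measurable_hess {α : Type*} [MeasurableSpace α] {f : α → Vec p → ℝ}
    (hf : Measurable (Function.uncurry f)) {g : α → Vec p} (hg : Measurable g)
    (hsm : ∀ a, ContDiffAt ℝ 3 (f a) (g a)) (i j : Fin p) :
    Measurable fun a => hess (f a) (g a) i j := by
  -- G is a jointly measurable function on the whole product that equals the partial derivative in a
  -- neighbourhood of each point `g a`. This is enough to differentiate it once more there by the
  -- same device.
  let G : α × Vec p → ℝ := fun q =>
    limsup (fun n : ℕ => (n : ℝ) * (f q.1 (q.2 + (n : ℝ)⁻¹ • unit j) - f q.1 q.2)) atTop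
  have hG : Measurable G := by
    refine Measurable.limsup fun n => Measurable.const_mul (Measurable.sub ?_ hf) _
    exact hf.comp (measurable_fst.prodMk (measurable_snd.add_const _))
  have hG' : ∀ a, ∀ᶠ y in 𝓝 (g a), G (a, y) = fderiv ℝ (f a) y (unit j) := by
    intro a
    filter_upwards [(hsm a).eventually (by simp)] with y hy
    exact limsup_difference_quotient (hy.differentiableAt (by simp)).hasFDerivAt _
  have hd : ∀ a, HasFDerivAt (fun y => G (a, y))
      ((ContinuousLinearMap.apply ℝ ℝ (unit j)).comp (fderiv ℝ (fderiv ℝ (f a)) (g a))) (g a) := by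
    intro a
    have h1 : DifferentiableAt ℝ (fderiv ℝ (f a)) (g a) :=
      ((hsm a).fderiv_right (m := 1) (by norm_num)).differentiableAt (by simp)
    have h2 := (ContinuousLinearMap.apply ℝ ℝ (unit j)).hasFDerivAt.comp (g a) h1.hasFDerivAt
    exact h2.congr_of_eventuallyEq (hG' a)
  have heq : (fun a => hess (f a) (g a) i j) = fun a =>
      limsup (fun n : ℕ => (n : ℝ) * (G (a, g a + (n : ℝ)⁻¹ • unit i) - G (a, g a))) atTop := by
    ext a
    rw [limsup_difference_quotient (hd a) (unit i), hess_apply]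
    rfl
  rw [heq]
  refine Measurable.limsup fun n => Measurable.const_mul (Measurable.sub ?_ ?_) _
  · exact hG.comp (measurable_id.prodMk (hg.add_const _))
  · exact hG.comp (measurable_id.prodMk hg)

end Hessian

namespace Model

variable {𝒲 𝒳 : Type*} [MeasurableSpace 𝒲] [MeasurableSpace 𝒳] {p : ℕ} (S : Model 𝒲 𝒳 p)

theorem measurable_η₀_cov : Measurable fun w => S.η₀ (S.cov w) :=
  S.measurable_η₀.comp S.measurable_cov

theorem measurable_m : Measurable (Function.uncurry fun w η => S.m w S.θ₀ η) :=
  S.measurable_ψb.sub (S.measurable_ψa.mul_const _)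

theorem measurable_m₀ : Measurable S.m₀ :=
  S.measurable_m.comp (measurable_id.prodMk S.measurable_η₀_cov)

variable {S}

theorem RegularFun.memLp {ψ : 𝒲 → Vec p → ℝ} {M C₁ C₂ C₃ : ℝ}
    (h : S.RegularFun ψ M C₁ C₂ C₃) (hψ : Measurable (Function.uncurry ψ)) :
    MemLp (fun w => ψ w (S.η₀ (S.cov w))) 4 S.P :=
  (memLp_nat_iff (hψ.comp (measurable_id.prodMk S.measurable_η₀_cov)).aestronglyMeasurable 4
    (by norm_num)).2 (h.moment.trans ENNReal.ofReal_lt_top)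

theorem MomentAssumption.J₀_ne_zero (h : S.MomentAssumption) : S.J₀ ≠ 0 := by
  obtain ⟨M, C₀, C₁, C₂, C₃, -, h0, -, -, -, hJ, -⟩ := h
  exact abs_pos.1 (h0.trans hJ)

theorem MomentAssumption.memLp_m₀ (h : S.MomentAssumption) : MemLp S.m₀ 4 S.P := by
  obtain ⟨M, C₀, C₁, C₂, C₃, -, -, -, -, -, -, ha, hb⟩ := h
  have h1 := (ha.memLp S.measurable_ψa).const_mul S.θ₀
  have h2 := (hb.memLp S.measurable_ψb).sub h1
  refine (memLp_congr_ae (ae_of_all _ fun w => ?_)).1 h2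
  simp [m₀, m, mul_comm]

theorem MomentAssumption.contDiffAt_m (h : S.MomentAssumption) (w : 𝒲) :
    ContDiffAt ℝ 3 (fun η => S.m w S.θ₀ η) (S.η₀ (S.cov w)) := by
  obtain ⟨M, C₀, C₁, C₂, C₃, -, -, -, -, -, -, ha, hb⟩ := h
  exact (hb.smooth w _ (S.η₀_mem _)).sub ((ha.smooth w _ (S.η₀_mem _)).mul contDiffAt_const)

theorem MomentAssumption.measurable_hess₀ (h : S.MomentAssumption) (i j : Fin p) :
    Measurable fun w => S.hess₀ w i j :=
  measurable_hess S.measurable_m S.measurable_η₀_cov h.contDiffAt_m i j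

theorem MomentAssumption.hess₀_symm (h : S.MomentAssumption) (w : 𝒲) (i j : Fin p) :
    S.hess₀ w i j = S.hess₀ w j i := hess_symm (h.contDiffAt_m w) i j

/-- Differentiation is linear and m = ψᵇ - θ₀ψᵃ, so the bounds on the two second derivatives, which
hold at the true value because it lies in `T`, add up. -/
theorem MomentAssumption.hess₀_bounded (h : S.MomentAssumption) :
    ∃ H : ℝ, 0 ≤ H ∧ ∀ᵐ w ∂S.P, ∀ i j, |S.hess₀ w i j| ≤ H := by
  obtain ⟨M, C₀, C₁, C₂, C₃, -, -, -, hC₂, -, -, ha, hb⟩ := h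
  refine ⟨C₂ + |S.θ₀| * C₂, by positivity, ?_⟩
  filter_upwards [ha.bound_second, hb.bound_second] with w h1 h2 i j
  have hx := S.η₀_mem (S.cov w)
  have ca : ContDiffAt ℝ (2 : ℕ) (S.ψa w) (S.η₀ (S.cov w)) :=
    (ha.smooth w _ hx).of_le (by norm_num)
  have cb : ContDiffAt ℝ (2 : ℕ) (S.ψb w) (S.η₀ (S.cov w)) :=
    (hb.smooth w _ hx).of_le (by norm_num)
  have hfun : (fun η => S.m w S.θ₀ η) = S.ψb w - fun y => S.θ₀ • S.ψa w y := by
    ext η; simp [m, mul_comm]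
  have : S.hess₀ w i j = hess (S.ψb w) (S.η₀ (S.cov w)) i j -
      S.θ₀ * hess (S.ψa w) (S.η₀ (S.cov w)) i j := by
    have h3 := iteratedFDeriv_sub_apply cb (ca.const_smul S.θ₀)
    rw [iteratedFDeriv_const_smul_apply' ca] at h3
    simp only [hess₀, hess, Matrix.of_apply, hfun, h3]
    rfl
  rw [this]
  refine (abs_sub _ _).trans (add_le_add (h2 _ hx i j) ?_)
  rw [abs_mul]
  exact mul_le_mul_of_nonneg_left (h1 _ hx i j) (abs_nonneg _)

end Model

end DML

namespace DML

open scoped ENNReal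

set_option linter.unusedSectionVars false

/-! ### Moments of one centred summand of the expansion. -/

section Auxiliary

/-- Every term is at most the largest one. The power of the cardinality is not sharp; this only
affects constants, as it is applied to sums of three terms or of p coordinates. -/
theorem sum_pow_le_card_pow_mul_sum {ι : Type*} (s : Finset ι) (a : ι → ℝ≥0∞) {k : ℕ}
    (hk : k ≠ 0) : (∑ i ∈ s, a i) ^ k ≤ (s.card : ℝ≥0∞) ^ k * ∑ i ∈ s, a i ^ k := by
  rcases s.eq_empty_or_nonempty with rfl | hs
  · simp [hk]
  obtain ⟨i, hi, hmax⟩ := s.exists_max_image a hs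
  calc (∑ i ∈ s, a i) ^ k ≤ (s.card * a i) ^ k := by
        gcongr
        simpa [nsmul_eq_mul] using Finset.sum_le_card_nsmul s a (a i) hmax
    _ = (s.card : ℝ≥0∞) ^ k * a i ^ k := mul_pow _ _ _
    _ ≤ _ := by
        gcongr
        exact Finset.single_le_sum (f := fun i => a i ^ k) (fun _ _ => zero_le) hi

theorem add_add_pow_le (a b c : ℝ≥0∞) {k : ℕ} (hk : k ≠ 0) :
    (a + b + c) ^ k ≤ 3 ^ k * (a ^ k + b ^ k + c ^ k) := by
  simpa [Fin.sum_univ_three] using sum_pow_le_card_pow_mul_sum Finset.univ ![a, b, c] hk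

theorem enorm_le_sum_enorm {p : ℕ} (v : Vec p) : ‖v‖ₑ ≤ ∑ s, ‖v s‖ₑ := by
  have h : ‖v‖ ≤ ∑ s, ‖v s‖ := by
    rw [EuclideanSpace.norm_eq]
    exact Real.sqrt_le_iff.2 ⟨Finset.sum_nonneg fun _ _ => norm_nonneg _,
      Finset.sum_sq_le_sq_sum_of_nonneg fun _ _ => norm_nonneg _⟩
  simp only [← ofReal_norm]
  rw [← ENNReal.ofReal_sum_of_nonneg fun _ _ => norm_nonneg _]
  exact ENNReal.ofReal_le_ofReal h

theorem enorm_apply_le {p : ℕ} (v : Vec p) (s : Fin p) : ‖v s‖ₑ ≤ ‖v‖ₑ := by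
  simp only [← ofReal_norm]
  exact ENNReal.ofReal_le_ofReal (PiLp.norm_apply_le v s)

theorem lintegral_le_of_three {α : Type*} [MeasurableSpace α] {ν : Measure α}
    {F f g h : α → ℝ≥0∞} {a b c A B C : ℝ} (k : ℕ) (ha : 0 ≤ a) (hb : 0 ≤ b) (hc : 0 ≤ c)
    (hA : 0 ≤ A) (hB : 0 ≤ B) (hC : 0 ≤ C)
    (hf : Measurable f) (hg : Measurable g)
    (hF : ∀ x, F x ≤ k * (ENNReal.ofReal a * f x + ENNReal.ofReal b * g x + ENNReal.ofReal c * h x))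
    (hfA : ∫⁻ x, f x ∂ν ≤ ENNReal.ofReal A) (hgB : ∫⁻ x, g x ∂ν ≤ ENNReal.ofReal B)
    (hhC : ∫⁻ x, h x ∂ν ≤ ENNReal.ofReal C) :
    ∫⁻ x, F x ∂ν ≤ ENNReal.ofReal (k * (a * A + b * B + c * C)) := by
  refine (lintegral_mono hF).trans ?_
  rw [lintegral_const_mul' _ _ (by simp), lintegral_add_left (by fun_prop),
    lintegral_add_left (by fun_prop), lintegral_const_mul' _ _ (by simp),
    lintegral_const_mul' _ _ (by simp), lintegral_const_mul' _ _ (by simp),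
    ENNReal.ofReal_mul (by positivity), ENNReal.ofReal_natCast,
    ENNReal.ofReal_add (by positivity) (by positivity), ENNReal.ofReal_add (by positivity)
    (by positivity), ENNReal.ofReal_mul ha, ENNReal.ofReal_mul hb, ENNReal.ofReal_mul hc]
  gcongr

end Auxiliary

section Expansion

variable {Ω 𝒲 𝒳 : Type*} [MeasurableSpace Ω] [MeasurableSpace 𝒲] [MeasurableSpace 𝒳] {p : ℕ}
  (S : Model 𝒲 𝒳 p) (N : Nuisance 𝒲 𝒳 p) (φ : ℝ)

/-- The contribution of one observation `v` to the leading terms at `x`, centred given `x`. -/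
noncomputable def err (n₀ : ℕ) (v : 𝒲) (x : 𝒳) : Vec p :=
  (n₀ : ℝ) ^ (-(1 / 2) : ℝ) • (n₀ : ℝ) ^ (-φ) • N.δ n₀ v x +
    (n₀ : ℝ)⁻¹ • (n₀ : ℝ) ^ (-φ) • (N.b n₀ (S.cov v) x - btilde S N n₀ x)

/-- The expectation of the leading terms given `x`. -/
noncomputable def bias (n₀ : ℕ) (x : 𝒳) : Vec p := (n₀ : ℝ) ^ (-φ) • btilde S N n₀ x

/-- The mean b̃ is subtracted in every summand and restored once; it is restored with weight n₀⁻¹ ·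
n₀ = 1, hence the need for A to be nonempty. -/
theorem lead_eq {A : Finset ℕ} (hA : A.Nonempty) (w : ℕ → 𝒲) (x : 𝒳) :
    lead S N φ φ A w x = ∑ l ∈ A, err S N φ A.card (w l) x + bias S N φ A.card x := by
  have h : (A.card : ℝ) ≠ 0 := by exact_mod_cast hA.card_pos.ne'
  simp only [lead, err, bias, Finset.sum_add_distrib, smul_sub, Finset.sum_sub_distrib,
    Finset.smul_sum, Finset.sum_const]
  rw [← Nat.cast_smul_eq_nsmul ℝ A.card, smul_inv_smul₀ h]
  abel

theorem measurable_btilde (n₀ : ℕ) : Measurable (btilde S N n₀) := by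
  have h : Measurable (Function.uncurry fun v x => N.b n₀ (S.cov v) x) :=
    (N.measurable_b n₀).comp ((S.measurable_cov.comp measurable_fst).prodMk measurable_snd)
  exact (h.stronglyMeasurable.integral_prod_left (μ := S.P)).measurable

theorem measurable_bias (n₀ : ℕ) : Measurable (bias S N φ n₀) :=
  (measurable_btilde S N n₀).const_smul ((n₀ : ℝ) ^ (-φ))

theorem measurable_b_cov (n₀ : ℕ) :
    Measurable fun q : 𝒲 × 𝒲 => N.b n₀ (S.cov q.1) (S.cov q.2) :=
  (N.measurable_b n₀).comp
    ((S.measurable_cov.comp measurable_fst).prodMk (S.measurable_cov.comp measurable_snd))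

theorem measurable_δ_cov (n₀ : ℕ) : Measurable fun q : 𝒲 × 𝒲 => N.δ n₀ q.1 (S.cov q.2) :=
  (N.measurable_δ n₀).comp (measurable_fst.prodMk (S.measurable_cov.comp measurable_snd))

theorem measurable_err (n₀ : ℕ) :
    Measurable fun q : 𝒲 × 𝒲 => err S N φ n₀ q.1 (S.cov q.2) := by
  have h1 := measurable_δ_cov S N n₀
  have h2 := measurable_b_cov S N n₀
  have h3 : Measurable fun q : 𝒲 × 𝒲 => btilde S N n₀ (S.cov q.2) :=
    (measurable_btilde S N n₀).comp (S.measurable_cov.comp measurable_snd)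
  exact ((h1.const_smul ((n₀ : ℝ) ^ (-φ))).const_smul ((n₀ : ℝ) ^ (-(1 / 2) : ℝ))).add
    (((h2.sub h3).const_smul ((n₀ : ℝ) ^ (-φ))).const_smul ((n₀ : ℝ)⁻¹))

theorem enorm_err_le {n₀ : ℕ} (v : 𝒲) (x : 𝒳) :
    ‖err S N φ n₀ v x‖ₑ ≤
      ENNReal.ofReal ((n₀ : ℝ) ^ (-(1 / 2) : ℝ) * (n₀ : ℝ) ^ (-φ)) * ‖N.δ n₀ v x‖ₑ +
      ENNReal.ofReal ((n₀ : ℝ)⁻¹) * ‖(n₀ : ℝ) ^ (-φ) • N.b n₀ (S.cov v) x‖ₑ +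
      ENNReal.ofReal ((n₀ : ℝ)⁻¹ * (n₀ : ℝ) ^ (-φ)) * ‖btilde S N n₀ x‖ₑ := by
  have hs : ∀ (c : ℝ) (u : Vec p), 0 ≤ c → ‖c • u‖ₑ = ENNReal.ofReal c * ‖u‖ₑ := by
    intro c u hc
    rw [enorm_smul, Real.enorm_eq_ofReal hc]
  rw [err, smul_sub, smul_sub, ← add_sub_assoc]
  refine (enorm_sub_le).trans (add_le_add ((enorm_add_le _ _).trans ?_) ?_)
  · rw [smul_smul, hs _ _ (by positivity), hs _ _ (by positivity)]
  · rw [smul_smul, hs _ _ (by positivity)]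

variable {S N φ} {μ : Measure Ω} {W : ℕ → Ω → 𝒲} {fold : ℕ → ℕ → Ω → ℕ → ℕ} {M₁ Cb Cδ : ℝ}
  {τ : ℕ → ℝ}

/-- The δ-part has order n₀^(-2-4φ) · n₀^(1-2φ) and the b-part n₀^(-4) · n₀^(3(1-2φ)) τ; both
exponents equal -1-6φ. The b̃-part, n₀^(-4-4φ), is smaller. The constant is 81 = 3⁴, for a fourth
power of three terms. -/
theorem err_pow_four_le (he : ExpansionConditions S N φ φ μ W fold M₁ Cb Cδ τ)
    (hφ : φ ∈ Set.Ioo (1 / 4 : ℝ) (1 / 2)) (hM : 0 < M₁) {T : ℝ} (hτ0 : ∀ n, 0 < τ n)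
    (hτ : ∀ n, τ n ≤ T) {n₀ : ℕ} (hn : 1 ≤ n₀) :
    ∫⁻ w, ∫⁻ v, ‖err S N φ n₀ v (S.cov w)‖ₑ ^ 4 ∂S.P ∂S.P ≤
      ENNReal.ofReal (81 * (2 * M₁ + T) * (n₀ : ℝ) ^ (-1 - 6 * φ)) := by
  have hn1 : (1 : ℝ) ≤ n₀ := by exact_mod_cast hn
  have hn0 : (0 : ℝ) < n₀ := by linarith
  have hd := (he.δ_moment n₀ hn 2 (by simp)).le
  have hb := (he.b_moment n₀ hn 2 (by simp)).le
  have ht := (he.btilde_upper n₀ hn).le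
  have key : ∀ w, ∫⁻ v, ‖err S N φ n₀ v (S.cov w)‖ₑ ^ 4 ∂S.P ≤ (81 : ℕ) *
      (ENNReal.ofReal (((n₀ : ℝ) ^ (-(1 / 2) : ℝ) * (n₀ : ℝ) ^ (-φ)) ^ 4) *
        (∫⁻ v, ‖N.δ n₀ v (S.cov w)‖ₑ ^ (2 * 2) ∂S.P) +
      ENNReal.ofReal (((n₀ : ℝ)⁻¹) ^ 4) *
        (∫⁻ v, ‖(n₀ : ℝ) ^ (-φ) • N.b n₀ (S.cov v) (S.cov w)‖ₑ ^ (2 * 2) ∂S.P) +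
      ENNReal.ofReal (((n₀ : ℝ)⁻¹ * (n₀ : ℝ) ^ (-φ)) ^ 4) * ‖btilde S N n₀ (S.cov w)‖ₑ ^ 4) := by
    intro w
    have hm1 : Measurable fun v => ‖N.δ n₀ v (S.cov w)‖ₑ ^ 4 :=
      (((measurable_δ_cov S N n₀).comp (measurable_prodMk_right (y := w))).enorm).pow_const 4
    have hm2 : Measurable fun v => ‖(n₀ : ℝ) ^ (-φ) • N.b n₀ (S.cov v) (S.cov w)‖ₑ ^ 4 :=
      ((((measurable_b_cov S N n₀).comp (measurable_prodMk_right (y := w))).const_smul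
        ((n₀ : ℝ) ^ (-φ))).enorm).pow_const 4
    calc _ ≤ ∫⁻ v, (81 : ℕ) * (ENNReal.ofReal (((n₀ : ℝ) ^ (-(1 / 2) : ℝ) * (n₀ : ℝ) ^ (-φ)) ^ 4) *
        ‖N.δ n₀ v (S.cov w)‖ₑ ^ (2 * 2) +
      ENNReal.ofReal (((n₀ : ℝ)⁻¹) ^ 4) *
        ‖(n₀ : ℝ) ^ (-φ) • N.b n₀ (S.cov v) (S.cov w)‖ₑ ^ (2 * 2) +
      ENNReal.ofReal (((n₀ : ℝ)⁻¹ * (n₀ : ℝ) ^ (-φ)) ^ 4) *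
        ‖btilde S N n₀ (S.cov w)‖ₑ ^ 4) ∂S.P := by
          refine lintegral_mono fun v => ?_
          refine (pow_le_pow_left' (enorm_err_le S N φ v (S.cov w)) 4).trans
            ((add_add_pow_le _ _ _ (by norm_num : 4 ≠ 0)).trans ?_)
          rw [ENNReal.ofReal_pow (by positivity), ENNReal.ofReal_pow (by positivity),
            ENNReal.ofReal_pow (by positivity)]
          simp only [mul_pow]
          norm_num
      _ = _ := by
          rw [lintegral_const_mul' _ _ (by simp), lintegral_add_left (by fun_prop),
            lintegral_add_left (by fun_prop), lintegral_const_mul' _ _ (by simp),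
            lintegral_const_mul' _ _ (by simp), lintegral_const]
          simp
  have hmd : Measurable fun w => ∫⁻ v, ‖N.δ n₀ v (S.cov w)‖ₑ ^ (2 * 2) ∂S.P :=
    (((measurable_δ_cov S N n₀).enorm).pow_const _).lintegral_prod_left'
  have hmb : Measurable fun w =>
      ∫⁻ v, ‖(n₀ : ℝ) ^ (-φ) • N.b n₀ (S.cov v) (S.cov w)‖ₑ ^ (2 * 2) ∂S.P :=
    ((((measurable_b_cov S N n₀).const_smul ((n₀ : ℝ) ^ (-φ))).enorm).pow_const
      _).lintegral_prod_left'
  refine (lintegral_le_of_three 81 (by positivity) (by positivity) (by positivity)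
    (by positivity) (by have := (hτ0 n₀).le; positivity) hM.le hmd hmb key hd hb ht).trans ?_
  refine ENNReal.ofReal_le_ofReal ?_
  have e1 : ((n₀ : ℝ) ^ (-(1 / 2) : ℝ) * (n₀ : ℝ) ^ (-φ)) ^ 4 *
      ((n₀ : ℝ) ^ ((((2 : ℕ) : ℝ) - 1) * (1 - 2 * φ)) * M₁) = M₁ * (n₀ : ℝ) ^ (-1 - 6 * φ) := by
    rw [← Real.rpow_add hn0, ← Real.rpow_natCast, ← Real.rpow_mul hn0.le, ← mul_assoc,
      ← Real.rpow_add hn0, mul_comm]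
    congr 2; push_cast; ring
  have e2 : ((n₀ : ℝ)⁻¹) ^ 4 * ((n₀ : ℝ) ^ ((2 * ((2 : ℕ) : ℝ) - 1) * (1 - 2 * φ)) * τ n₀) =
      τ n₀ * (n₀ : ℝ) ^ (-1 - 6 * φ) := by
    rw [← Real.rpow_neg_one, ← Real.rpow_natCast, ← Real.rpow_mul hn0.le, ← mul_assoc,
      ← Real.rpow_add hn0, mul_comm]
    congr 2; push_cast; ring
  have e3 : ((n₀ : ℝ)⁻¹ * (n₀ : ℝ) ^ (-φ)) ^ 4 * M₁ ≤ M₁ * (n₀ : ℝ) ^ (-1 - 6 * φ) := by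
    rw [← Real.rpow_neg_one, ← Real.rpow_add hn0, ← Real.rpow_natCast, ← Real.rpow_mul hn0.le,
      mul_comm]
    refine mul_le_mul_of_nonneg_left (Real.rpow_le_rpow_of_exponent_le hn1 ?_) hM.le
    push_cast; linarith [hφ.1, hφ.2]
  rw [e1, e2]
  have hpos : (0 : ℝ) ≤ (n₀ : ℝ) ^ (-1 - 6 * φ) := by positivity
  push_cast
  nlinarith [mul_le_mul_of_nonneg_right (hτ n₀) hpos]

/-- Here the conditional second moments `δ_cond` and `b_cond` give the exponent -2-4φ. The
inequality for three terms is used twice, which gives 9² · 9 = 729. -/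
theorem err_cond_sq_le (he : ExpansionConditions S N φ φ μ W fold M₁ Cb Cδ τ)
    (hM : 0 < M₁) {T : ℝ} (hτ0 : ∀ n, 0 < τ n)
    (hτ : ∀ n, τ n ≤ T) {n₀ : ℕ} (hn : 1 ≤ n₀) :
    ∫⁻ w, (∫⁻ v, ‖err S N φ n₀ v (S.cov w)‖ₑ ^ 2 ∂S.P) ^ 2 ∂S.P ≤
      ENNReal.ofReal (729 * (2 * M₁ + T) * (n₀ : ℝ) ^ (-2 - 4 * φ)) := by
  have hn1 : (1 : ℝ) ≤ n₀ := by exact_mod_cast hn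
  have hn0 : (0 : ℝ) < n₀ := by linarith
  have hd := he.δ_cond n₀ hn
  have hb := he.b_cond n₀ hn
  have ht := (he.btilde_upper n₀ hn).le
  have key : ∀ w, (∫⁻ v, ‖err S N φ n₀ v (S.cov w)‖ₑ ^ 2 ∂S.P) ^ 2 ≤ (729 : ℕ) *
      (ENNReal.ofReal (((n₀ : ℝ) ^ (-(1 / 2) : ℝ) * (n₀ : ℝ) ^ (-φ)) ^ 4) *
        (∫⁻ v, ‖N.δ n₀ v (S.cov w)‖ₑ ^ 2 ∂S.P) ^ 2 +
      ENNReal.ofReal (((n₀ : ℝ)⁻¹) ^ 4) *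
        (∫⁻ v, ‖(n₀ : ℝ) ^ (-φ) • N.b n₀ (S.cov v) (S.cov w)‖ₑ ^ 2 ∂S.P) ^ 2 +
      ENNReal.ofReal (((n₀ : ℝ)⁻¹ * (n₀ : ℝ) ^ (-φ)) ^ 4) * ‖btilde S N n₀ (S.cov w)‖ₑ ^ 4) := by
    intro w
    have hm1 : Measurable fun v => ‖N.δ n₀ v (S.cov w)‖ₑ ^ 2 :=
      (((measurable_δ_cov S N n₀).comp (measurable_prodMk_right (y := w))).enorm).pow_const 2
    have hm2 : Measurable fun v => ‖(n₀ : ℝ) ^ (-φ) • N.b n₀ (S.cov v) (S.cov w)‖ₑ ^ 2 :=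
      ((((measurable_b_cov S N n₀).comp (measurable_prodMk_right (y := w))).const_smul
        ((n₀ : ℝ) ^ (-φ))).enorm).pow_const 2
    have h1 : ∫⁻ v, ‖err S N φ n₀ v (S.cov w)‖ₑ ^ 2 ∂S.P ≤ 9 *
        (ENNReal.ofReal (((n₀ : ℝ) ^ (-(1 / 2) : ℝ) * (n₀ : ℝ) ^ (-φ)) ^ 2) *
          (∫⁻ v, ‖N.δ n₀ v (S.cov w)‖ₑ ^ 2 ∂S.P) +
        ENNReal.ofReal (((n₀ : ℝ)⁻¹) ^ 2) *
          (∫⁻ v, ‖(n₀ : ℝ) ^ (-φ) • N.b n₀ (S.cov v) (S.cov w)‖ₑ ^ 2 ∂S.P) +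
        ENNReal.ofReal (((n₀ : ℝ)⁻¹ * (n₀ : ℝ) ^ (-φ)) ^ 2) *
          ‖btilde S N n₀ (S.cov w)‖ₑ ^ 2) := by
      calc _ ≤ ∫⁻ v, 9 * (ENNReal.ofReal (((n₀ : ℝ) ^ (-(1 / 2) : ℝ) * (n₀ : ℝ) ^ (-φ)) ^ 2) *
          ‖N.δ n₀ v (S.cov w)‖ₑ ^ 2 +
        ENNReal.ofReal (((n₀ : ℝ)⁻¹) ^ 2) *
          ‖(n₀ : ℝ) ^ (-φ) • N.b n₀ (S.cov v) (S.cov w)‖ₑ ^ 2 +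
        ENNReal.ofReal (((n₀ : ℝ)⁻¹ * (n₀ : ℝ) ^ (-φ)) ^ 2) *
          ‖btilde S N n₀ (S.cov w)‖ₑ ^ 2) ∂S.P := by
            refine lintegral_mono fun v => ?_
            refine (pow_le_pow_left' (enorm_err_le S N φ v (S.cov w)) 2).trans
              ((add_add_pow_le _ _ _ two_ne_zero).trans ?_)
            rw [ENNReal.ofReal_pow (by positivity), ENNReal.ofReal_pow (by positivity),
              ENNReal.ofReal_pow (by positivity)]
            simp only [mul_pow]
            norm_num
        _ = _ := by
            rw [lintegral_const_mul' _ _ (by simp), lintegral_add_left (by fun_prop),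
              lintegral_add_left (by fun_prop), lintegral_const_mul' _ _ (by simp),
              lintegral_const_mul' _ _ (by simp), lintegral_const]
            simp
    refine (pow_le_pow_left' h1 2).trans ?_
    rw [mul_pow]
    refine (mul_le_mul' le_rfl (add_add_pow_le _ _ _ two_ne_zero)).trans (le_of_eq ?_)
    have q : ∀ y : ℝ, ENNReal.ofReal (y ^ 4) = ENNReal.ofReal (y ^ 2) ^ 2 := fun y => by
      rw [← ENNReal.ofReal_pow (sq_nonneg _), ← pow_mul]
    rw [q, q, q]
    push_cast
    ring
  have hmd : Measurable fun w => (∫⁻ v, ‖N.δ n₀ v (S.cov w)‖ₑ ^ 2 ∂S.P) ^ 2 :=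
    ((((measurable_δ_cov S N n₀).enorm).pow_const _).lintegral_prod_left').pow_const 2
  have hmb : Measurable fun w =>
      (∫⁻ v, ‖(n₀ : ℝ) ^ (-φ) • N.b n₀ (S.cov v) (S.cov w)‖ₑ ^ 2 ∂S.P) ^ 2 :=
    (((((measurable_b_cov S N n₀).const_smul ((n₀ : ℝ) ^ (-φ))).enorm).pow_const
      _).lintegral_prod_left').pow_const 2
  refine (lintegral_le_of_three 729 (by positivity) (by positivity) (by positivity)
    hM.le (by have := (hτ0 n₀).le; positivity) hM.le hmd hmb key hd hb ht).trans ?_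
  refine ENNReal.ofReal_le_ofReal ?_
  have e1 : ((n₀ : ℝ) ^ (-(1 / 2) : ℝ) * (n₀ : ℝ) ^ (-φ)) ^ 4 * M₁ =
      M₁ * (n₀ : ℝ) ^ (-2 - 4 * φ) := by
    rw [← Real.rpow_add hn0, ← Real.rpow_natCast, ← Real.rpow_mul hn0.le, mul_comm]
    congr 2; push_cast; ring
  have e2 : ((n₀ : ℝ)⁻¹) ^ 4 * ((n₀ : ℝ) ^ (2 * (1 - 2 * φ)) * τ n₀) =
      τ n₀ * (n₀ : ℝ) ^ (-2 - 4 * φ) := by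
    rw [← Real.rpow_neg_one, ← Real.rpow_natCast, ← Real.rpow_mul hn0.le, ← mul_assoc,
      ← Real.rpow_add hn0, mul_comm]
    congr 2; push_cast; ring
  have e3 : ((n₀ : ℝ)⁻¹ * (n₀ : ℝ) ^ (-φ)) ^ 4 * M₁ ≤ M₁ * (n₀ : ℝ) ^ (-2 - 4 * φ) := by
    rw [← Real.rpow_neg_one, ← Real.rpow_add hn0, ← Real.rpow_natCast, ← Real.rpow_mul hn0.le,
      mul_comm]
    refine mul_le_mul_of_nonneg_left (Real.rpow_le_rpow_of_exponent_le hn1 ?_) hM.le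
    push_cast; linarith
  rw [e1, e2]
  have hpos : (0 : ℝ) ≤ (n₀ : ℝ) ^ (-2 - 4 * φ) := by positivity
  push_cast
  nlinarith [mul_le_mul_of_nonneg_right (hτ n₀) hpos]

end Expansion

end DML

namespace DML

open scoped ENNReal

set_option linter.unusedSectionVars false

theorem add_pow_four_le (a b : ℝ≥0∞) : (a + b) ^ 4 ≤ 81 * (a ^ 4 + b ^ 4) := by
  have h := add_add_pow_le a b 0 (by norm_num : 4 ≠ 0)
  norm_num at h
  exact h

/-! ### Fourth moment of the leading terms. -/

section Expansion

variable {Ω 𝒲 𝒳 : Type*} [MeasurableSpace Ω] [MeasurableSpace 𝒲] [MeasurableSpace 𝒳] {p : ℕ}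
  {S : Model 𝒲 𝒳 p} {N : Nuisance 𝒲 𝒳 p} {φ : ℝ}
  {μ : Measure Ω} [IsProbabilityMeasure μ] {W : ℕ → Ω → 𝒲} {fold : ℕ → ℕ → Ω → ℕ → ℕ}
  {M₁ Cb Cδ : ℝ} {τ : ℕ → ℝ}

variable (S N φ) in
theorem measurable_sum_err (n₀ : ℕ) (A : Finset ℕ) : Measurable fun q : 𝒲 × (A → 𝒲) =>
    ∑ l : A, err S N φ n₀ (q.2 l) (S.cov q.1) := by
  refine Finset.measurable_sum _ fun l _ => ?_
  have h : Measurable fun q : 𝒲 × (A → 𝒲) => (q.2 l, q.1) :=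
    ((measurable_pi_apply l).comp measurable_snd).prodMk measurable_fst
  have h2 := measurable_err S N φ n₀
  have h3 := h2.comp h
  exact h3

theorem bias_pow_four_le (he : ExpansionConditions S N φ φ μ W fold M₁ Cb Cδ τ)
    {n₀ : ℕ} (hn : 1 ≤ n₀) :
    ∫⁻ w, ‖bias S N φ n₀ (S.cov w)‖ₑ ^ 4 ∂S.P ≤
      ENNReal.ofReal (M₁ * (n₀ : ℝ) ^ (-4 * φ)) := by
  have hn0 : (0 : ℝ) < n₀ := by exact_mod_cast hn
  have h : ∀ w, ‖bias S N φ n₀ (S.cov w)‖ₑ ^ 4 =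
      ENNReal.ofReal ((n₀ : ℝ) ^ (-4 * φ)) * ‖btilde S N n₀ (S.cov w)‖ₑ ^ 4 := by
    intro w
    rw [bias, enorm_smul, mul_pow, Real.enorm_eq_ofReal (by positivity),
      ← ENNReal.ofReal_pow (by positivity), ← Real.rpow_natCast, ← Real.rpow_mul hn0.le]
    congr 3; push_cast; ring
  simp_rw [h]
  rw [lintegral_const_mul' _ _ (by simp), mul_comm M₁, ENNReal.ofReal_mul (by positivity)]
  gcongr
  exact (he.btilde_upper n₀ hn).le

theorem ae_memLp_δ (he : ExpansionConditions S N φ φ μ W fold M₁ Cb Cδ τ)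
    {n₀ : ℕ} (hn : 1 ≤ n₀) : ∀ᵐ w ∂S.P, MemLp (fun v => N.δ n₀ v (S.cov w)) 4 S.P := by
  have hm : Measurable fun w => ∫⁻ v, ‖N.δ n₀ v (S.cov w)‖ₑ ^ (2 * 2) ∂S.P :=
    (((measurable_δ_cov S N n₀).enorm).pow_const _).lintegral_prod_left'
  filter_upwards [ae_lt_top hm ((he.δ_moment n₀ hn 2 (by simp)).trans ENNReal.ofReal_lt_top).ne]
    with w hw
  exact (memLp_nat_iff ((measurable_δ_cov S N n₀).comp
    (measurable_prodMk_right (y := w))).aestronglyMeasurable 4 (by norm_num)).2 hw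

theorem ae_memLp_b (he : ExpansionConditions S N φ φ μ W fold M₁ Cb Cδ τ)
    {n₀ : ℕ} (hn : 1 ≤ n₀) :
    ∀ᵐ w ∂S.P, MemLp (fun v => N.b n₀ (S.cov v) (S.cov w)) 4 S.P := by
  have hn0 : (0 : ℝ) < n₀ := by exact_mod_cast hn
  have hmb : Measurable fun w =>
      ∫⁻ v, ‖(n₀ : ℝ) ^ (-φ) • N.b n₀ (S.cov v) (S.cov w)‖ₑ ^ (2 * 2) ∂S.P :=
    ((((measurable_b_cov S N n₀).const_smul ((n₀ : ℝ) ^ (-φ))).enorm).pow_const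
      _).lintegral_prod_left'
  filter_upwards [ae_lt_top hmb ((he.b_moment n₀ hn 2 (by simp)).trans ENNReal.ofReal_lt_top).ne]
    with w hw
  have h := (memLp_nat_iff (((measurable_b_cov S N n₀).const_smul ((n₀ : ℝ) ^ (-φ))).comp
    (measurable_prodMk_right (y := w))).aestronglyMeasurable 4 (by norm_num)).2 hw
  have h2 := h.const_smul ((n₀ : ℝ) ^ (-φ))⁻¹
  refine (memLp_congr_ae (ae_of_all _ fun v => ?_)).1 h2
  have hne : (n₀ : ℝ) ^ (-φ) ≠ 0 := (Real.rpow_pos_of_pos hn0 _).ne'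
  simp [smul_smul, hne]

/-- With the covariates x frozen, δ has mean 0 because its conditional mean given X is 0, and b - b̃
has mean 0 by the definition of b̃. Integrability of b holds only for almost every x, by finiteness
of the iterated moment. -/
theorem ae_err_centered (he : ExpansionConditions S N φ φ μ W fold M₁ Cb Cδ τ)
    {n₀ : ℕ} (hn : 1 ≤ n₀) :
    ∀ᵐ w ∂S.P, MemLp (fun v => err S N φ n₀ v (S.cov w)) 4 S.P ∧
      ∫ v, err S N φ n₀ v (S.cov w) ∂S.P = 0 := by
  filter_upwards [ae_memLp_δ he hn, ae_memLp_b he hn] with w h1 h2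
  have h3 : MemLp (fun v => N.b n₀ (S.cov v) (S.cov w) - btilde S N n₀ (S.cov w)) 4 S.P :=
    h2.sub (memLp_const _)
  have h1' := (h1.const_smul ((n₀ : ℝ) ^ (-φ))).const_smul ((n₀ : ℝ) ^ (-(1 / 2) : ℝ))
  have h3' := (h3.const_smul ((n₀ : ℝ) ^ (-φ))).const_smul ((n₀ : ℝ)⁻¹)
  refine ⟨h1'.add h3', ?_⟩
  have hδ : ∫ v, N.δ n₀ v (S.cov w) ∂S.P = 0 := by
    rw [← integral_condExp (m := S.covσ) S.measurable_cov.comap_le,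
      integral_congr_ae (he.δ_centered n₀ hn (S.cov w))]
    simp
  have hb : ∫ v, (N.b n₀ (S.cov v) (S.cov w) - btilde S N n₀ (S.cov w)) ∂S.P = 0 := by
    rw [integral_sub (h2.integrable (by norm_num)) (integrable_const _)]
    simp [btilde]
  have e := integral_add (h1'.integrable (by norm_num)) (h3'.integrable (by norm_num))
  simp only [Pi.smul_apply] at e
  simp only [err]
  rw [e, integral_smul, integral_smul, integral_smul, integral_smul, hδ, hb]
  simp

variable (hW : IsSample μ S.P W)
include hW

/-- The fourth moment inequality is applied to each coordinate with w frozen. Then n₀ · n₀^(-1-6φ) ≤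
n₀^(-4φ) and n₀² · n₀^(-2-4φ) = n₀^(-4φ). The constants are 3159 = 3 · 81 + 4 · 729, and p⁵ = p⁴ · p
from passing to p coordinates. -/
theorem lintegral_sum_err_le (he : ExpansionConditions S N φ φ μ W fold M₁ Cb Cδ τ)
    (hφ : φ ∈ Set.Ioo (1 / 4 : ℝ) (1 / 2)) (hM : 0 < M₁) {T : ℝ} (hτ0 : ∀ n, 0 < τ n)
    (hτ : ∀ n, τ n ≤ T) {A : Finset ℕ} (hA : A.Nonempty) :
    ∫⁻ w, ∫⁻ ω, ‖∑ l ∈ A, err S N φ A.card (W l ω) (S.cov w)‖ₑ ^ 4 ∂μ ∂S.P ≤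
      ENNReal.ofReal ((p : ℝ) ^ 5 * (3159 * (2 * M₁ + T)) * (A.card : ℝ) ^ (-4 * φ)) := by
  have hn : 1 ≤ A.card := hA.card_pos
  have hn1 : (1 : ℝ) ≤ A.card := by exact_mod_cast hn
  have hn0 : (0 : ℝ) < A.card := by linarith
  have hT : 0 ≤ T := (hτ0 0).le.trans (hτ 0)
  have key : ∀ᵐ w ∂S.P, ∫⁻ ω, ‖∑ l ∈ A, err S N φ A.card (W l ω) (S.cov w)‖ₑ ^ 4 ∂μ ≤
      (p : ℝ≥0∞) ^ 5 * (3 * A.card * ∫⁻ v, ‖err S N φ A.card v (S.cov w)‖ₑ ^ 4 ∂S.P +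
        4 * A.card ^ 2 * (∫⁻ v, ‖err S N φ A.card v (S.cov w)‖ₑ ^ 2 ∂S.P) ^ 2) := by
    filter_upwards [ae_err_centered he hn] with w hw
    have hme : ∀ s, Measurable fun v => err S N φ A.card v (S.cov w) s := fun s =>
      (EuclideanSpace.proj (𝕜 := ℝ) s).measurable.comp
        ((measurable_err S N φ A.card).comp (measurable_prodMk_right (y := w)))
    have hcent : ∀ s, ∫ v, err S N φ A.card v (S.cov w) s ∂S.P = 0 := by
      intro s
      have := (EuclideanSpace.proj (𝕜 := ℝ) s).integral_comp_comm (hw.1.integrable (by norm_num))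
      rw [hw.2, map_zero] at this
      exact this
    calc ∫⁻ ω, ‖∑ l ∈ A, err S N φ A.card (W l ω) (S.cov w)‖ₑ ^ 4 ∂μ
        ≤ ∫⁻ ω, (p : ℝ≥0∞) ^ 4 * ∑ s, ‖∑ l ∈ A, err S N φ A.card (W l ω) (S.cov w) s‖ₑ ^ 4 ∂μ := by
          refine lintegral_mono fun ω => ?_
          refine (pow_le_pow_left' (enorm_le_sum_enorm _) 4).trans
            ((sum_pow_le_card_pow_mul_sum _ _ (by norm_num)).trans (le_of_eq ?_))
          simp
      _ = (p : ℝ≥0∞) ^ 4 *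
          ∑ s, ∫⁻ ω, ‖∑ l ∈ A, err S N φ A.card (W l ω) (S.cov w) s‖ₑ ^ 4 ∂μ := by
          rw [lintegral_const_mul' _ _ (by simp), lintegral_finsetSum]
          intro s _
          exact ((Finset.measurable_sum _ fun l _ =>
            (hme s).comp (hW.measurable l)).enorm).pow_const 4
      _ ≤ (p : ℝ≥0∞) ^ 4 * ∑ _s : Fin p,
          (3 * A.card * ∫⁻ v, ‖err S N φ A.card v (S.cov w)‖ₑ ^ 4 ∂S.P +
          4 * A.card ^ 2 * (∫⁻ v, ‖err S N φ A.card v (S.cov w)‖ₑ ^ 2 ∂S.P) ^ 2) := by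
          gcongr with s
          refine (hW.lintegral_sum_pow_four_le (hme s) (hcent s) A).trans ?_
          gcongr <;> exact enorm_apply_le _ s
      _ = _ := by simp; ring
  refine (lintegral_mono_ae key).trans ?_
  have hm4 : Measurable fun w => ∫⁻ v, ‖err S N φ A.card v (S.cov w)‖ₑ ^ 4 ∂S.P :=
    (((measurable_err S N φ A.card).enorm).pow_const _).lintegral_prod_left'
  rw [lintegral_const_mul' _ _ (by simp), lintegral_add_left (by fun_prop),
    lintegral_const_mul' _ _ (ENNReal.mul_ne_top (by simp) (by simp)),
    lintegral_const_mul' _ _ (ENNReal.mul_ne_top (by simp) (by simp))]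
  calc _ ≤ (p : ℝ≥0∞) ^ 5 *
      (3 * A.card * ENNReal.ofReal (81 * (2 * M₁ + T) * (A.card : ℝ) ^ (-1 - 6 * φ)) +
      4 * A.card ^ 2 * ENNReal.ofReal (729 * (2 * M₁ + T) * (A.card : ℝ) ^ (-2 - 4 * φ))) := by
        gcongr
        · exact err_pow_four_le he hφ hM hτ0 hτ hn
        · exact err_cond_sq_le he hM hτ0 hτ hn
    _ = ENNReal.ofReal ((p : ℝ) ^ 5 *
      (3 * A.card * (81 * (2 * M₁ + T) * (A.card : ℝ) ^ (-1 - 6 * φ)) +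
      4 * (A.card : ℝ) ^ 2 * (729 * (2 * M₁ + T) * (A.card : ℝ) ^ (-2 - 4 * φ)))) := by
        rw [ENNReal.ofReal_mul (p := (p : ℝ) ^ 5) (by positivity),
          ENNReal.ofReal_add (by positivity) (by positivity),
          ENNReal.ofReal_mul (p := 3 * (A.card : ℝ)) (by positivity),
          ENNReal.ofReal_mul (p := 4 * (A.card : ℝ) ^ 2) (by positivity),
          ENNReal.ofReal_mul (p := (3 : ℝ)) (by positivity),
          ENNReal.ofReal_mul (p := (4 : ℝ)) (by positivity), ENNReal.ofReal_pow (by positivity),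
          ENNReal.ofReal_pow (by positivity)]
        simp
    _ ≤ _ := by
        refine ENNReal.ofReal_le_ofReal ?_
        rw [mul_assoc ((p : ℝ) ^ 5)]
        refine mul_le_mul_of_nonneg_left ?_ (by positivity)
        have e1 : (A.card : ℝ) * (A.card : ℝ) ^ (-1 - 6 * φ) ≤ (A.card : ℝ) ^ (-4 * φ) := by
          rw [← Real.rpow_one_add' hn0.le (by linarith [hφ.1])]
          exact Real.rpow_le_rpow_of_exponent_le hn1 (by linarith [hφ.1])
        have e2 : (A.card : ℝ) ^ 2 * (A.card : ℝ) ^ (-2 - 4 * φ) = (A.card : ℝ) ^ (-4 * φ) := by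
          rw [← Real.rpow_natCast, ← Real.rpow_add hn0]
          congr 1; push_cast; ring
        have hc : 0 ≤ 2 * M₁ + T := by positivity
        nlinarith [mul_le_mul_of_nonneg_left e1 hc]

/-- Cross-fitting enters through `i ∉ A`: W_i is independent of the training observations and may be
frozen, after which the sum and the bias are bounded separately. -/
theorem lintegral_lead_pow_four_le (he : ExpansionConditions S N φ φ μ W fold M₁ Cb Cδ τ)
    (hφ : φ ∈ Set.Ioo (1 / 4 : ℝ) (1 / 2)) (hM : 0 < M₁) {T : ℝ} (hτ0 : ∀ n, 0 < τ n)
    (hτ : ∀ n, τ n ≤ T) {A : Finset ℕ} (hA : A.Nonempty) {i : ℕ} (hi : i ∉ A) :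
    ∫⁻ ω, ‖lead S N φ φ A (fun l => W l ω) (S.cov (W i ω))‖ₑ ^ 4 ∂μ ≤
      ENNReal.ofReal (81 * ((p : ℝ) ^ 5 * (3159 * (2 * M₁ + T)) + M₁) *
        (A.card : ℝ) ^ (-4 * φ)) := by
  have hn : 1 ≤ A.card := hA.card_pos
  have hn0 : (0 : ℝ) < A.card := by exact_mod_cast hn
  have hT : 0 ≤ T := (hτ0 0).le.trans (hτ 0)
  have hmsum : Measurable fun q : 𝒲 × (A → 𝒲) =>
      ∑ l : A, err S N φ A.card (q.2 l) (S.cov q.1) :=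
    measurable_sum_err S N φ A.card A
  have hmb : Measurable fun w => bias S N φ A.card (S.cov w) :=
    (measurable_bias S N φ _).comp S.measurable_cov
  have hsum : ∀ ω w, ∑ l : A, err S N φ A.card (W l ω) (S.cov w) =
      ∑ l ∈ A, err S N φ A.card (W l ω) (S.cov w) := fun ω w =>
    Finset.sum_coe_sort A fun l => err S N φ A.card (W l ω) (S.cov w)
  have hpt : ∀ ω, ‖lead S N φ φ A (fun l => W l ω) (S.cov (W i ω))‖ₑ ^ 4 ≤
      81 * (‖∑ l : A, err S N φ A.card (W l ω) (S.cov (W i ω))‖ₑ ^ 4 +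
        ‖bias S N φ A.card (S.cov (W i ω))‖ₑ ^ 4) := by
    intro ω
    rw [lead_eq S N φ hA, hsum]
    refine (pow_le_pow_left' (enorm_add_le _ _) 4).trans ?_
    exact add_pow_four_le _ _
  refine (lintegral_mono hpt).trans ?_
  have hm1 : Measurable fun ω => ‖bias S N φ A.card (S.cov (W i ω))‖ₑ ^ 4 :=
    ((hmb.comp (hW.measurable i)).enorm).pow_const 4
  have h1 : ∫⁻ ω, ‖∑ l : A, err S N φ A.card (W l ω) (S.cov (W i ω))‖ₑ ^ 4 ∂μ =
      ∫⁻ w, ∫⁻ ω, ‖∑ l ∈ A, err S N φ A.card (W l ω) (S.cov w)‖ₑ ^ 4 ∂μ ∂S.P := by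
    simp_rw [← hsum]
    exact hW.lintegral_decouple hi
      (F := fun w y => ‖∑ l : A, err S N φ A.card (y l) (S.cov w)‖ₑ ^ 4)
      ((hmsum.enorm).pow_const 4)
  have h2 : ∫⁻ ω, ‖bias S N φ A.card (S.cov (W i ω))‖ₑ ^ 4 ∂μ =
      ∫⁻ w, ‖bias S N φ A.card (S.cov w)‖ₑ ^ 4 ∂S.P :=
    (hW.measurePreserving i).lintegral_comp (f := fun w => ‖bias S N φ A.card (S.cov w)‖ₑ ^ 4)
      ((hmb.enorm).pow_const 4)
  rw [lintegral_const_mul' _ _ (by simp), lintegral_add_right _ hm1, h1, h2]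
  calc _ ≤ 81 * (ENNReal.ofReal ((p : ℝ) ^ 5 * (3159 * (2 * M₁ + T)) * (A.card : ℝ) ^ (-4 * φ)) +
      ENNReal.ofReal (M₁ * (A.card : ℝ) ^ (-4 * φ))) := by
        gcongr
        · exact lintegral_sum_err_le hW he hφ hM hτ0 hτ hA
        · exact bias_pow_four_le he hn
    _ = _ := by
        rw [← ENNReal.ofReal_add (by positivity) (by positivity), ← add_mul, mul_assoc 81,
          ENNReal.ofReal_mul (p := 81) (by norm_num)]
        simp

end Expansion

end DML

/-! ### Correlation of the quadratic forms with the first-order term. -/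

namespace DML

open scoped ENNReal

set_option linter.unusedSectionVars false

theorem exists_lintegral_sq_le {α E : Type*} [MeasurableSpace α] [NormedAddCommGroup E]
    {ν : Measure α} {f : α → E} (hf : MemLp f 2 ν) :
    ∃ a : ℝ, 0 ≤ a ∧ ∫⁻ x, ‖f x‖ₑ ^ 2 ∂ν ≤ ENNReal.ofReal (a ^ 2) := by
  have h := ((memLp_nat_iff hf.1 2 two_ne_zero).1 hf).ne
  refine ⟨√(∫⁻ x, ‖f x‖ₑ ^ 2 ∂ν).toReal, Real.sqrt_nonneg _, ?_⟩
  rw [Real.sq_sqrt ENNReal.toReal_nonneg, ENNReal.ofReal_toReal h]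

/-- Entrywise application of `IsSample.integral_mul_sum_mul_sum`; the symmetry of H merges the two
terms linear in F into one with factor 2. -/
theorem IsSample.integral_mul_bil_sum {Ω 𝒲 : Type*} [MeasurableSpace Ω] [MeasurableSpace 𝒲]
    {μ : Measure Ω} [IsProbabilityMeasure μ] {P : Measure 𝒲} {W : ℕ → Ω → 𝒲} {p : ℕ}
    (hW : IsSample μ P W) {m : 𝒲 → ℝ} {F : 𝒲 → Vec p} (hm : Measurable m)
    (hF : Measurable F) (hm4 : MemLp m 4 P) (hF4 : MemLp F 4 P) (hm0 : ∫ w, m w ∂P = 0)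
    (hF0 : ∫ w, F w ∂P = 0) {A : Finset ℕ} {j : ℕ} (hj : j ∈ A)
    {H : Matrix (Fin p) (Fin p) ℝ} (hH : ∀ s t, H s t = H t s) (a : Vec p) :
    ∫ ω, m (W j ω) * bil (∑ l ∈ A, F (W l ω) + a) H (∑ l ∈ A, F (W l ω) + a) ∂μ =
      ∫ w, m w * (bil (F w) H (F w) + 2 * bil (F w) H a) ∂P := by
  have hP : IsProbabilityMeasure P := by
    rw [← hW.law 0]; exact Measure.isProbabilityMeasure_map (hW.measurable 0).aemeasurable
  have hm2 : MemLp m 2 P := hm4.mono_exponent (by norm_num)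
  have hFs : ∀ s, Measurable fun w => F w s := fun s =>
    (EuclideanSpace.proj (𝕜 := ℝ) s).measurable.comp hF
  have hFs4 : ∀ s, MemLp (fun w => F w s) 4 P := fun s =>
    (EuclideanSpace.proj (𝕜 := ℝ) s).comp_memLp' hF4
  have hFs0 : ∀ s, ∫ w, F w s ∂P = 0 := by
    intro s
    have := (EuclideanSpace.proj (𝕜 := ℝ) s).integral_comp_comm (hF4.integrable (by norm_num))
    rw [hF0, map_zero] at this
    exact this
  have key := fun s t => hW.integral_mul_sum_mul_sum hm (hFs s) (hFs t) hm4 (hFs4 s) (hFs4 t) hm0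
    (hFs0 s) (hFs0 t) hj (a s) (a t)
  have hint : ∀ s t, Integrable (fun w => m w * (F w s * F w t + F w s * a t + a s * F w t)) P := by
    intro s t
    have h1 : MemLp (fun w => F w s * F w t) 2 P := (hFs4 t).mul (r := 2) (hFs4 s)
    have h2 : MemLp (fun w => F w s * a t) 2 P :=
      ((hFs4 s).mono_exponent (by norm_num)).mul_const (a t)
    have h3 : MemLp (fun w => a s * F w t) 2 P :=
      ((hFs4 t).mono_exponent (by norm_num)).const_mul (a s)
    exact hm2.integrable_mul ((h1.add h2).add h3)
  have e1 : ∀ ω, m (W j ω) * bil (∑ l ∈ A, F (W l ω) + a) H (∑ l ∈ A, F (W l ω) + a) =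
      ∑ s, ∑ t, H s t * (m (W j ω) *
        ((∑ l ∈ A, F (W l ω) s + a s) * (∑ l ∈ A, F (W l ω) t + a t))) := by
    intro ω
    simp only [bil, Finset.mul_sum, PiLp.add_apply, WithLp.ofLp_sum, Finset.sum_apply]
    exact Finset.sum_congr rfl fun s _ => Finset.sum_congr rfl fun t _ => by ring
  have e2 : ∀ w, m w * (bil (F w) H (F w) + 2 * bil (F w) H a) =
      ∑ s, ∑ t, H s t * (m w * (F w s * F w t + F w s * a t + a s * F w t)) := by
    intro w
    rw [two_mul]
    nth_rw 3 [bil_comm hH]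
    simp only [bil, ← Finset.sum_add_distrib, Finset.mul_sum]
    exact Finset.sum_congr rfl fun s _ => Finset.sum_congr rfl fun t _ => by ring
  have i1 : ∀ s t, Integrable (fun ω => H s t * (m (W j ω) *
      ((∑ l ∈ A, F (W l ω) s + a s) * (∑ l ∈ A, F (W l ω) t + a t)))) μ :=
    fun s t => (key s t).1.const_mul _
  have i2 : ∀ s t, Integrable (fun w => H s t *
      (m w * (F w s * F w t + F w s * a t + a s * F w t))) P :=
    fun s t => (hint s t).const_mul _
  rw [integral_congr_ae (ae_of_all _ e1), integral_congr_ae (ae_of_all _ e2),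
    integral_finsetSum _ fun s _ => integrable_finsetSum _ fun t _ => i1 s t,
    integral_finsetSum _ fun s _ => integrable_finsetSum _ fun t _ => i2 s t]
  refine Finset.sum_congr rfl fun s _ => ?_
  rw [integral_finsetSum _ fun t _ => i1 s t, integral_finsetSum _ fun t _ => i2 s t]
  refine Finset.sum_congr rfl fun t _ => ?_
  rw [integral_const_mul, integral_const_mul, (key s t).2]

theorem IsSample.measurable_seq {Ω 𝒲 : Type*} [MeasurableSpace Ω] [MeasurableSpace 𝒲]
    {μ : Measure Ω} {P : Measure 𝒲} {W : ℕ → Ω → 𝒲} (hW : IsSample μ P W) :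
    Measurable fun ω l => W l ω := measurable_pi_lambda _ hW.measurable

section Expansion

variable {Ω 𝒲 𝒳 : Type*} [MeasurableSpace Ω] [MeasurableSpace 𝒲] [MeasurableSpace 𝒳] {p : ℕ}
  (S : Model 𝒲 𝒳 p) (N : Nuisance 𝒲 𝒳 p) (φ : ℝ)

/-- The quadratic form in the leading terms at the `i`-th observation, for an estimator that uses
the observations in `A`. -/
noncomputable def quad (A : Finset ℕ) (i : ℕ) (w : ℕ → 𝒲) : ℝ :=
  bil (lead S N φ φ A w (S.cov (w i))) (S.J₀⁻¹ • S.hess₀ (w i)) (lead S N φ φ A w (S.cov (w i)))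

theorem measurable_lead (A : Finset ℕ) (i : ℕ) :
    Measurable fun w : ℕ → 𝒲 => lead S N φ φ A w (S.cov (w i)) := by
  have h : ∀ l, Measurable fun w : ℕ → 𝒲 => (w l, w i) := fun l =>
    (measurable_pi_apply l).prodMk (measurable_pi_apply i)
  have h1 : ∀ l, Measurable fun w : ℕ → 𝒲 => N.δ A.card (w l) (S.cov (w i)) := by
    intro l
    have h2 := measurable_δ_cov S N A.card
    have h3 := h2.comp (h l)
    exact h3
  have h2 : ∀ l, Measurable fun w : ℕ → 𝒲 => N.b A.card (S.cov (w l)) (S.cov (w i)) := by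
    intro l
    have h2 := measurable_b_cov S N A.card
    have h3 := h2.comp (h l)
    exact h3
  unfold lead
  have s1 : ∀ l, Measurable fun w : ℕ → 𝒲 => (A.card : ℝ) ^ (-φ) • N.δ A.card (w l) (S.cov (w i)) :=
    fun l => (h1 l).const_smul ((A.card : ℝ) ^ (-φ))
  have s2 : ∀ l, Measurable fun w : ℕ → 𝒲 =>
      (A.card : ℝ) ^ (-φ) • N.b A.card (S.cov (w l)) (S.cov (w i)) :=
    fun l => (h2 l).const_smul ((A.card : ℝ) ^ (-φ))
  have t1 := (Finset.measurable_sum A fun l _ => s1 l).const_smul ((A.card : ℝ) ^ (-(1 / 2) : ℝ))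
  have t2 := (Finset.measurable_sum A fun l _ => s2 l).const_smul ((A.card : ℝ)⁻¹)
  have h := t1.add t2
  exact h

theorem measurable_sum_err_add_bias (n₀ : ℕ) (A : Finset ℕ) : Measurable fun q : 𝒲 × (A → 𝒲) =>
    ∑ l : A, err S N φ n₀ (q.2 l) (S.cov q.1) + bias S N φ n₀ (S.cov q.1) := by
  have h1 := measurable_sum_err S N φ n₀ A
  have h2 := (measurable_bias S N φ n₀).comp S.measurable_cov
  have h3 := h1.add (h2.comp measurable_fst)
  exact h3

variable {S}

theorem measurable_scaled_hess (hS : S.MomentAssumption) (s t : Fin p) :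
    Measurable fun w => (S.J₀⁻¹ • S.hess₀ w) s t :=
  (hS.measurable_hess₀ s t).const_mul _

theorem measurable_quad (hS : S.MomentAssumption) (A : Finset ℕ) (i : ℕ) :
    Measurable (quad S N φ A i) :=
  measurable_bil (measurable_lead S N φ A i)
    (fun s t => (measurable_scaled_hess hS s t).comp (measurable_pi_apply i))
    (measurable_lead S N φ A i)

theorem lead_congr {A : Finset ℕ} {w w' : ℕ → 𝒲} (h : ∀ l ∈ A, w l = w' l) (x : 𝒳) :
    lead S N φ φ A w x = lead S N φ φ A w' x := by
  unfold lead
  congr 2 <;> exact Finset.sum_congr rfl fun l hl => by rw [h l hl]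

variable {N φ} {μ : Measure Ω} [IsProbabilityMeasure μ] {W : ℕ → Ω → 𝒲}
  {fold : ℕ → ℕ → Ω → ℕ → ℕ} {M₁ Cb Cδ : ℝ} {τ : ℕ → ℝ} (hW : IsSample μ S.P W)
include hW

/-- The form is at most a constant times ‖`lead`‖², since the Hessian is bounded almost surely, so
its square is governed by the fourth moment of `lead`. The constant depends on neither A nor i. -/
theorem exists_lintegral_quad_sq_le (hS : S.MomentAssumption)
    (he : ExpansionAssumption S N φ φ μ W fold) (hφ : φ ∈ Set.Ioo (1 / 4 : ℝ) (1 / 2)) :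
    ∃ C : ℝ, 0 ≤ C ∧ ∀ A : Finset ℕ, A.Nonempty → ∀ i ∉ A,
      ∫⁻ ω, ‖quad S N φ A i fun l => W l ω‖ₑ ^ 2 ∂μ ≤
        ENNReal.ofReal ((C * (A.card : ℝ) ^ (-2 * φ)) ^ 2) := by
  obtain ⟨M₁, Cb, Cδ, τ, hM, -, -, hτ0, hτlim, he⟩ := he
  obtain ⟨T, hT⟩ := hτlim.bddAbove_range
  have hT : ∀ n, τ n ≤ T := fun n => hT ⟨n, rfl⟩
  have hT0 : 0 ≤ T := (hτ0 0).le.trans (hT 0)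
  obtain ⟨H, hH0, hH⟩ := hS.hess₀_bounded
  set B := (p : ℝ) ^ 2 * (|S.J₀⁻¹| * H)
  set D := 81 * ((p : ℝ) ^ 5 * (3159 * (2 * M₁ + T)) + M₁)
  have hD : 0 ≤ D := by positivity
  refine ⟨B * √D, by positivity, fun A hA i hi => ?_⟩
  have hn0 : (0 : ℝ) < A.card := by exact_mod_cast hA.card_pos
  have hb : ∀ᵐ ω ∂μ, ‖quad S N φ A i fun l => W l ω‖ₑ ^ 2 ≤ ENNReal.ofReal (B ^ 2) *
      ‖lead S N φ φ A (fun l => W l ω) (S.cov (W i ω))‖ₑ ^ 4 := by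
    filter_upwards [(hW.measurePreserving i).quasiMeasurePreserving.ae hH] with ω hω
    have h1 := abs_bil_le (A := S.J₀⁻¹ • S.hess₀ (W i ω)) (h := |S.J₀⁻¹| * H)
      (fun s t => by
        rw [Matrix.smul_apply, smul_eq_mul, abs_mul]
        exact mul_le_mul_of_nonneg_left (hω s t) (abs_nonneg _))
      (lead S N φ φ A (fun l => W l ω) (S.cov (W i ω)))
      (lead S N φ φ A (fun l => W l ω) (S.cov (W i ω)))
    have h2 : ‖quad S N φ A i fun l => W l ω‖ₑ ≤ ENNReal.ofReal B *
        ‖lead S N φ φ A (fun l => W l ω) (S.cov (W i ω))‖ₑ ^ 2 := by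
      rw [Real.enorm_eq_ofReal_abs, ← ofReal_norm, ← ENNReal.ofReal_pow (norm_nonneg _),
        ← ENNReal.ofReal_mul (by positivity), sq]
      exact ENNReal.ofReal_le_ofReal h1
    refine (pow_le_pow_left' h2 2).trans (le_of_eq ?_)
    rw [mul_pow, ENNReal.ofReal_pow (by positivity), ← pow_mul]
  refine (lintegral_mono_ae hb).trans ?_
  rw [lintegral_const_mul' _ _ (by simp)]
  refine (mul_le_mul' le_rfl (lintegral_lead_pow_four_le hW he hφ hM hτ0 hT hA hi)).trans
    (le_of_eq ?_)
  have hpow : (A.card : ℝ) ^ (-4 * φ) = ((A.card : ℝ) ^ (-2 * φ)) ^ 2 := by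
    rw [← Real.rpow_natCast ((A.card : ℝ) ^ (-2 * φ)), ← Real.rpow_mul hn0.le]
    congr 1; push_cast; ring
  rw [← ENNReal.ofReal_mul (sq_nonneg B), hpow, mul_pow (B * √D), mul_pow B, Real.sq_sqrt hD,
    mul_assoc (B ^ 2)]

theorem memLp_quad (hS : S.MomentAssumption) (he : ExpansionAssumption S N φ φ μ W fold)
    (hφ : φ ∈ Set.Ioo (1 / 4 : ℝ) (1 / 2)) {A : Finset ℕ} (hA : A.Nonempty) {i : ℕ} (hi : i ∉ A) :
    MemLp (fun ω => quad S N φ A i fun l => W l ω) 2 μ := by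
  obtain ⟨C, -, hC⟩ := exists_lintegral_quad_sq_le hW hS he hφ
  exact (memLp_nat_iff ((measurable_quad N φ hS A i).comp
    hW.measurable_seq).aestronglyMeasurable 2 two_ne_zero).2
    ((hC A hA i hi).trans_lt ENNReal.ofReal_lt_top)

/-- The quadratic form is uncorrelated with the moment function at any other observation that is
not used by the estimator. -/
theorem integral_m₀_mul_quad_eq_zero (hS : S.MomentAssumption) (hθ : S.MomentCondition)
    {A : Finset ℕ} {i j : ℕ} (hji : j ≠ i) (hj : j ∉ A) :
    ∫ ω, S.m₀ (W j ω) * quad S N φ A i (fun l => W l ω) ∂μ = 0 := by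
  classical
  set B := insert i A
  have hiB : i ∈ B := Finset.mem_insert_self i A
  -- This exhibits the form as a function of the finite tuple indexed by B. The value off B is
  -- immaterial, as the form reads only coordinates in B.
  let ext : (B → 𝒲) → ℕ → 𝒲 := fun y l => if h : l ∈ B then y ⟨l, h⟩ else y ⟨i, hiB⟩
  have hext : Measurable ext := by
    refine measurable_pi_lambda _ fun l => ?_
    by_cases h : l ∈ B
    · simp only [ext, h, dif_pos]; exact measurable_pi_apply _
    · simp only [ext, h, dif_neg, not_false_eq_true]; exact measurable_pi_apply _
  have hq : ∀ ω, quad S N φ A i (ext fun l => W l ω) = quad S N φ A i (fun l => W l ω) := by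
    intro ω
    have hi' : (ext fun l => W l ω) i = W i ω := by simp [ext, hiB]
    have hl : ∀ l ∈ A, (ext fun l => W l ω) l = W l ω := fun l hl => by
      simp [ext, B, hl]
    simp only [quad, hi', lead_congr N φ hl]
  have hjB : j ∉ B := by simp [B, hji, hj]
  have hind := hW.indepFun_comp_tuple hjB S.measurable_m₀ (g := fun y => quad S N φ A i (ext y))
    ((measurable_quad N φ hS A i).comp hext)
  simp only [hq] at hind
  rw [hind.integral_fun_mul_eq_mul_integral
    (S.measurable_m₀.comp (hW.measurable j)).aestronglyMeasurable
    ((measurable_quad N φ hS A i).comp hW.measurable_seq).aestronglyMeasurable,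
    hW.integral_comp S.measurable_m₀, hθ.2, zero_mul]

omit hW in
variable (S N φ) in
/-- The covariance between the quadratic form and the moment function at one of the observations
that the estimator uses. -/
noncomputable def crossMoment (n₀ : ℕ) : ℝ :=
  ∫ w, ∫ v, S.m₀ v * (bil (err S N φ n₀ v (S.cov w)) (S.J₀⁻¹ • S.hess₀ w)
      (err S N φ n₀ v (S.cov w)) +
    2 * bil (err S N φ n₀ v (S.cov w)) (S.J₀⁻¹ • S.hess₀ w) (bias S N φ n₀ (S.cov w))) ∂S.P ∂S.P

/-- Freezing W_i turns the Hessian and the bias into constants, and only the summand of observation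
j can correlate with m_j. The result depends on A through its size alone. -/
theorem integral_m₀_mul_quad_eq_crossMoment (hS : S.MomentAssumption) (hθ : S.MomentCondition)
    (he : ExpansionAssumption S N φ φ μ W fold)
    (hφ : φ ∈ Set.Ioo (1 / 4 : ℝ) (1 / 2))
    {A : Finset ℕ} {i j : ℕ} (hi : i ∉ A) (hj : j ∈ A) :
    ∫ ω, S.m₀ (W j ω) * quad S N φ A i (fun l => W l ω) ∂μ = crossMoment S N φ A.card := by
  have hA : A.Nonempty := ⟨j, hj⟩
  have hn : 1 ≤ A.card := hA.card_pos
  have hm2 : MemLp S.m₀ 2 S.P := hS.memLp_m₀.mono_exponent (by norm_num)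
  have hint : Integrable (fun ω => S.m₀ (W j ω) * quad S N φ A i (fun l => W l ω)) μ :=
    (hW.memLp_comp hm2 j).integrable_mul (memLp_quad hW hS he hφ hA hi)
  obtain ⟨M₁, Cb, Cδ, τ, hM, -, -, hτ0, hτlim, he⟩ := he
  let L : 𝒲 → (A → 𝒲) → Vec p := fun w y =>
    ∑ l : A, err S N φ A.card (y l) (S.cov w) + bias S N φ A.card (S.cov w)
  have hL : Measurable (Function.uncurry L) := measurable_sum_err_add_bias S N φ A.card A
  let F : 𝒲 → (A → 𝒲) → ℝ := fun w y =>
    S.m₀ (y ⟨j, hj⟩) * bil (L w y) (S.J₀⁻¹ • S.hess₀ w) (L w y)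
  have hF : Measurable (Function.uncurry F) := by
    have h1 : Measurable fun q : 𝒲 × (A → 𝒲) => S.m₀ (q.2 ⟨j, hj⟩) :=
      S.measurable_m₀.comp ((measurable_pi_apply _).comp measurable_snd)
    exact h1.mul (measurable_bil hL
      (fun s t => (measurable_scaled_hess hS s t).comp measurable_fst) hL)
  have hLsum : ∀ w ω, L w (fun l => W l ω) =
      ∑ l ∈ A, err S N φ A.card (W l ω) (S.cov w) + bias S N φ A.card (S.cov w) := by
    intro w ω
    simp only [L]
    rw [Finset.sum_coe_sort A fun l => err S N φ A.card (W l ω) (S.cov w)]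
  have hFq : ∀ ω, F (W i ω) (fun l => W l ω) =
      S.m₀ (W j ω) * quad S N φ A i (fun l => W l ω) := by
    intro ω
    simp only [F, hLsum, quad, lead_eq S N φ hA]
  simp_rw [← hFq] at hint ⊢
  rw [hW.integral_decouple hi hF hint, crossMoment]
  refine integral_congr_ae ?_
  filter_upwards [ae_err_centered he hn] with w hw
  simp only [F, hLsum]
  refine hW.integral_mul_bil_sum S.measurable_m₀ ?_ hS.memLp_m₀ hw.1 hθ.2 hw.2 hj ?_ _
  · have h1 := measurable_err S N φ A.card
    have h2 := h1.comp (measurable_prodMk_right (y := w))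
    exact h2
  · intro s t
    simp only [Matrix.smul_apply]
    rw [hS.hess₀_symm]

/-- The indices j split into A, giving equal terms, the single index i, giving the error, and the
rest, giving 0. -/
theorem exists_abs_integral_Tstar_mul_quad_sub_le (hS : S.MomentAssumption)
    (hθ : S.MomentCondition) (he : ExpansionAssumption S N φ φ μ W fold)
    (hφ : φ ∈ Set.Ioo (1 / 4 : ℝ) (1 / 2)) :
    ∃ C : ℝ, 0 ≤ C ∧ ∀ (n : ℕ) (A : Finset ℕ), A ⊆ Finset.range n → A.Nonempty → ∀ i ∉ A, i < n →
      |∫ ω, Tstar S W n ω * quad S N φ A i (fun l => W l ω) ∂μ -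
        (n : ℝ) ^ (-(1 / 2) : ℝ) * (A.card * (crossMoment S N φ A.card / S.J₀))| ≤
        (n : ℝ) ^ (-(1 / 2) : ℝ) * (C * (A.card : ℝ) ^ (-2 * φ)) := by
  obtain ⟨C, hC0, hC⟩ := exists_lintegral_quad_sq_le hW hS he hφ
  have hm2 : MemLp S.m₀ 2 S.P := hS.memLp_m₀.mono_exponent (by norm_num)
  obtain ⟨a, ha0, ha⟩ := exists_lintegral_sq_le hm2
  refine ⟨a * C / |S.J₀|, by positivity, fun n A hAn hA i hi hin => ?_⟩
  have hint : ∀ j, Integrable (fun ω => S.m₀ (W j ω) * quad S N φ A i (fun l => W l ω)) μ :=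
    fun j => (hW.memLp_comp hm2 j).integrable_mul (memLp_quad hW hS he hφ hA hi)
  -- Here m_i depends on the same observation as the Hessian and the evaluation point, so no
  -- cancellation is claimed.
  have hself : |∫ ω, S.m₀ (W i ω) * quad S N φ A i (fun l => W l ω) ∂μ| ≤
      a * (C * (A.card : ℝ) ^ (-2 * φ)) := by
    refine abs_integral_mul_le (hW.memLp_comp hm2 i).1 (memLp_quad hW hS he hφ hA hi).1
      ha0 ?_ (by positivity) (hC A hA i hi)
    rw [(hW.measurePreserving i).lintegral_comp (f := fun w => ‖S.m₀ w‖ₑ ^ 2)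
      (S.measurable_m₀.enorm.pow_const 2)]
    exact ha
  have hsum : ∫ ω, Tstar S W n ω * quad S N φ A i (fun l => W l ω) ∂μ =
      (n : ℝ) ^ (-(1 / 2) : ℝ) * (A.card * (crossMoment S N φ A.card / S.J₀)) +
      (n : ℝ) ^ (-(1 / 2) : ℝ) *
        ((∫ ω, S.m₀ (W i ω) * quad S N φ A i (fun l => W l ω) ∂μ) / S.J₀) := by
    have h1 : ∀ ω, Tstar S W n ω * quad S N φ A i (fun l => W l ω) =
        ∑ j ∈ Finset.range n, (n : ℝ) ^ (-(1 / 2) : ℝ) * S.J₀⁻¹ *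
          (S.m₀ (W j ω) * quad S N φ A i (fun l => W l ω)) := by
      intro ω
      simp only [Tstar, Finset.mul_sum, Finset.sum_mul]
      exact Finset.sum_congr rfl fun j _ => by ring
    simp_rw [h1]
    rw [integral_finsetSum _ fun j _ => (hint j).const_mul _]
    simp_rw [integral_const_mul]
    rw [← Finset.mul_sum]
    have h2 : ∑ j ∈ Finset.range n, ∫ ω, S.m₀ (W j ω) * quad S N φ A i (fun l => W l ω) ∂μ =
        A.card * crossMoment S N φ A.card +
          ∫ ω, S.m₀ (W i ω) * quad S N φ A i (fun l => W l ω) ∂μ := by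
      have hsub : insert i A ⊆ Finset.range n :=
        Finset.insert_subset (Finset.mem_range.2 hin) hAn
      rw [← Finset.sum_subset hsub, Finset.sum_insert hi, add_comm]
      · rw [Finset.sum_congr rfl fun j hj =>
          integral_m₀_mul_quad_eq_crossMoment hW hS hθ he hφ hi hj]
        simp
      · intro j _ hj
        rw [Finset.mem_insert, not_or] at hj
        exact integral_m₀_mul_quad_eq_zero hW hS hθ hj.1 hj.2
    rw [h2]; ring
  rw [hsum, add_sub_cancel_left, abs_mul, abs_of_nonneg (by positivity), abs_div]
  refine mul_le_mul_of_nonneg_left ?_ (by positivity)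
  rw [div_mul_eq_mul_div, mul_assoc]
  gcongr

end Expansion

end DML

/-! ### Limit of the cross moment. -/

namespace DML

open scoped ENNReal

set_option linter.unusedSectionVars false

theorem integrable_and_abs_integral_le {α : Type*} [MeasurableSpace α] {ν : Measure α}
    {F f g : α → ℝ} (hF : AEStronglyMeasurable F ν) (hf : AEStronglyMeasurable f ν)
    (hg : AEStronglyMeasurable g ν) (hle : ∀ᵐ x ∂ν, |F x| ≤ |f x * g x|)
    {a b : ℝ} (ha : 0 ≤ a) (hfa : ∫⁻ x, ‖f x‖ₑ ^ 2 ∂ν ≤ ENNReal.ofReal (a ^ 2))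
    (hb : 0 ≤ b) (hgb : ∫⁻ x, ‖g x‖ₑ ^ 2 ∂ν ≤ ENNReal.ofReal (b ^ 2)) :
    Integrable F ν ∧ |∫ x, F x ∂ν| ≤ a * b := by
  have h : ∫⁻ x, ‖F x‖ₑ ∂ν ≤ ENNReal.ofReal (a * b) := by
    refine (lintegral_mono_ae ?_).trans (lintegral_enorm_mul_le hf hg ha hfa hb hgb)
    filter_upwards [hle] with x hx
    rw [Real.enorm_eq_ofReal_abs, Real.enorm_eq_ofReal_abs]
    exact ENNReal.ofReal_le_ofReal hx
  refine ⟨⟨hF, h.trans_lt ENNReal.ofReal_lt_top⟩, ?_⟩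
  have h2 := (enorm_integral_le_lintegral_enorm F).trans h
  rwa [Real.enorm_eq_ofReal_abs, ENNReal.ofReal_le_ofReal_iff (by positivity)] at h2

theorem sq_le_one_add_pow_four (x : ℝ≥0∞) : x ^ 2 ≤ 1 + x ^ 4 := by
  rcases le_total x 1 with h | h
  · exact (pow_le_one₀ zero_le h).trans le_self_add
  · exact (pow_le_pow_right₀ h (by norm_num)).trans le_add_self

section Expansion

variable {Ω 𝒲 𝒳 : Type*} [MeasurableSpace Ω] [MeasurableSpace 𝒲] [MeasurableSpace 𝒳] {p : ℕ}
  {S : Model 𝒲 𝒳 p} {N : Nuisance 𝒲 𝒳 p} {φ : ℝ}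
  {μ : Measure Ω} {W : ℕ → Ω → 𝒲} {fold : ℕ → ℕ → Ω → ℕ → ℕ} {M₁ Cb Cδ : ℝ} {τ : ℕ → ℝ}

theorem lintegral_prod_err_pow_four_le (he : ExpansionConditions S N φ φ μ W fold M₁ Cb Cδ τ)
    (hφ : φ ∈ Set.Ioo (1 / 4 : ℝ) (1 / 2)) (hM : 0 < M₁) {T : ℝ} (hτ0 : ∀ n, 0 < τ n)
    (hτ : ∀ n, τ n ≤ T) {n₀ : ℕ} (hn : 1 ≤ n₀) :
    ∫⁻ q : 𝒲 × 𝒲, ‖err S N φ n₀ q.1 (S.cov q.2)‖ₑ ^ 4 ∂(S.P.prod S.P) ≤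
      ENNReal.ofReal ((√(81 * (2 * M₁ + T)) * (n₀ : ℝ) ^ (-(1 / 2) - 3 * φ)) ^ 2) := by
  have hn0 : (0 : ℝ) < n₀ := by exact_mod_cast hn
  have hT : 0 ≤ T := (hτ0 0).le.trans (hτ 0)
  rw [lintegral_prod_symm' _ ((measurable_err S N φ n₀).enorm.pow_const 4)]
  refine (err_pow_four_le he hφ hM hτ0 hτ hn).trans (le_of_eq ?_)
  rw [mul_pow, Real.sq_sqrt (by positivity), ← Real.rpow_natCast ((n₀ : ℝ) ^ _),
    ← Real.rpow_mul hn0.le]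
  congr 3
  push_cast; ring

theorem lintegral_btilde_sq_le (he : ExpansionConditions S N φ φ μ W fold M₁ Cb Cδ τ)
    (hM : 0 < M₁) {n₀ : ℕ} (hn : 1 ≤ n₀) :
    ∫⁻ w, ‖btilde S N n₀ (S.cov w)‖ₑ ^ 2 ∂S.P ≤ ENNReal.ofReal (1 + M₁) := by
  calc _ ≤ ∫⁻ w, (1 + ‖btilde S N n₀ (S.cov w)‖ₑ ^ 4) ∂S.P :=
        lintegral_mono fun w => sq_le_one_add_pow_four _
    _ = 1 + ∫⁻ w, ‖btilde S N n₀ (S.cov w)‖ₑ ^ 4 ∂S.P := by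
        rw [lintegral_add_left measurable_const]; simp
    _ ≤ 1 + ENNReal.ofReal M₁ := add_le_add le_rfl (he.btilde_upper n₀ hn).le
    _ = _ := by rw [ENNReal.ofReal_add zero_le_one hM.le, ENNReal.ofReal_one]

/-- The two factors live on different coordinates of the product space, so second moments of each
suffice for their product. -/
theorem lintegral_prod_m₀_btilde_le (he : ExpansionConditions S N φ φ μ W fold M₁ Cb Cδ τ)
    (hM : 0 < M₁) {a : ℝ} (ha : ∫⁻ v, ‖S.m₀ v‖ₑ ^ 2 ∂S.P ≤ ENNReal.ofReal (a ^ 2))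
    {n₀ : ℕ} (hn : 1 ≤ n₀) :
    ∫⁻ q : 𝒲 × 𝒲, ‖S.m₀ q.1 * ‖btilde S N n₀ (S.cov q.2)‖‖ₑ ^ 2 ∂(S.P.prod S.P) ≤
      ENNReal.ofReal ((a * √(1 + M₁)) ^ 2) := by
  have hmb : Measurable fun w => btilde S N n₀ (S.cov w) :=
    (measurable_btilde S N n₀).comp S.measurable_cov
  simp only [enorm_mul, mul_pow, enorm_norm]
  rw [lintegral_prod_mul (f := fun v => ‖S.m₀ v‖ₑ ^ 2)
    (g := fun w => ‖btilde S N n₀ (S.cov w)‖ₑ ^ 2)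
    (S.measurable_m₀.enorm.pow_const 2).aemeasurable (hmb.enorm.pow_const 2).aemeasurable,
    ENNReal.ofReal_mul (sq_nonneg a), Real.sq_sqrt (by positivity)]
  exact mul_le_mul' ha (lintegral_btilde_sq_le he hM hn)

/-- The case s = 1 of `b_moment` gives n₀^(1-2φ) τ; the b̃-part contributes n₀^(-2φ), which becomes
the term with 1/n₀ once n₀^(1-2φ) is factored out. -/
theorem lintegral_prod_b_sub_btilde_le (he : ExpansionConditions S N φ φ μ W fold M₁ Cb Cδ τ)
    (hM : 0 < M₁) (hτ0 : ∀ n, 0 < τ n) {n₀ : ℕ} (hn : 1 ≤ n₀) :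
    ∫⁻ q : 𝒲 × 𝒲, ‖(n₀ : ℝ) ^ (-φ) •
        (N.b n₀ (S.cov q.1) (S.cov q.2) - btilde S N n₀ (S.cov q.2))‖ₑ ^ 2 ∂(S.P.prod S.P) ≤
      ENNReal.ofReal (((n₀ : ℝ) ^ (1 / 2 - φ) * √(9 * (τ n₀ + (1 + M₁) / n₀))) ^ 2) := by
  have hn0 : (0 : ℝ) < n₀ := by exact_mod_cast hn
  have hτn := (hτ0 n₀).le
  have hmb : Measurable fun q : 𝒲 × 𝒲 =>
      ‖(n₀ : ℝ) ^ (-φ) • N.b n₀ (S.cov q.1) (S.cov q.2)‖ₑ ^ 2 :=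
    (((measurable_b_cov S N n₀).const_smul ((n₀ : ℝ) ^ (-φ))).enorm).pow_const 2
  have hmt : Measurable fun w => ‖btilde S N n₀ (S.cov w)‖ₑ ^ 2 :=
    ((measurable_btilde S N n₀).comp S.measurable_cov).enorm.pow_const 2
  have hpt : ∀ q : 𝒲 × 𝒲, ‖(n₀ : ℝ) ^ (-φ) •
      (N.b n₀ (S.cov q.1) (S.cov q.2) - btilde S N n₀ (S.cov q.2))‖ₑ ^ 2 ≤
      9 * (‖(n₀ : ℝ) ^ (-φ) • N.b n₀ (S.cov q.1) (S.cov q.2)‖ₑ ^ 2 +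
        ENNReal.ofReal ((n₀ : ℝ) ^ (-2 * φ)) * ‖btilde S N n₀ (S.cov q.2)‖ₑ ^ 2) := by
    intro q
    rw [smul_sub]
    refine (pow_le_pow_left' enorm_sub_le 2).trans ?_
    have h := add_add_pow_le ‖(n₀ : ℝ) ^ (-φ) • N.b n₀ (S.cov q.1) (S.cov q.2)‖ₑ
      ‖(n₀ : ℝ) ^ (-φ) • btilde S N n₀ (S.cov q.2)‖ₑ 0 two_ne_zero
    have e : ‖(n₀ : ℝ) ^ (-φ) • btilde S N n₀ (S.cov q.2)‖ₑ ^ 2 =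
        ENNReal.ofReal ((n₀ : ℝ) ^ (-2 * φ)) * ‖btilde S N n₀ (S.cov q.2)‖ₑ ^ 2 := by
      rw [enorm_smul, mul_pow, Real.enorm_eq_ofReal (by positivity),
        ← ENNReal.ofReal_pow (by positivity), ← Real.rpow_natCast, ← Real.rpow_mul hn0.le]
      congr 3; push_cast; ring
    rw [← e]
    norm_num at h
    exact h
  have hb := (he.b_moment n₀ hn 1 (by simp)).le
  calc _ ≤ ∫⁻ q : 𝒲 × 𝒲, 9 * (‖(n₀ : ℝ) ^ (-φ) • N.b n₀ (S.cov q.1) (S.cov q.2)‖ₑ ^ 2 +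
        ENNReal.ofReal ((n₀ : ℝ) ^ (-2 * φ)) * ‖btilde S N n₀ (S.cov q.2)‖ₑ ^ 2)
          ∂(S.P.prod S.P) := lintegral_mono hpt
    _ = 9 * (∫⁻ w, ∫⁻ v, ‖(n₀ : ℝ) ^ (-φ) • N.b n₀ (S.cov v) (S.cov w)‖ₑ ^ 2 ∂S.P ∂S.P +
        ENNReal.ofReal ((n₀ : ℝ) ^ (-2 * φ)) *
          ∫⁻ w, ‖btilde S N n₀ (S.cov w)‖ₑ ^ 2 ∂S.P) := by
        rw [lintegral_const_mul' _ _ (by simp), lintegral_add_left hmb,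
          lintegral_const_mul' _ _ (by simp), lintegral_prod_symm' _ hmb,
          lintegral_prod_symm' (fun q : 𝒲 × 𝒲 => ‖btilde S N n₀ (S.cov q.2)‖ₑ ^ 2)
            (hmt.comp measurable_snd)]
        simp
    _ ≤ 9 * (ENNReal.ofReal ((n₀ : ℝ) ^ ((2 * ((1 : ℕ) : ℝ) - 1) * (1 - 2 * φ)) * τ n₀) +
        ENNReal.ofReal ((n₀ : ℝ) ^ (-2 * φ)) * ENNReal.ofReal (1 + M₁)) := by
        gcongr
        exact lintegral_btilde_sq_le he hM hn
    _ = ENNReal.ofReal (9 * ((n₀ : ℝ) ^ ((2 * ((1 : ℕ) : ℝ) - 1) * (1 - 2 * φ)) * τ n₀ +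
        (n₀ : ℝ) ^ (-2 * φ) * (1 + M₁))) := by
        rw [← ENNReal.ofReal_mul (by positivity),
          ← ENNReal.ofReal_add (by positivity) (by positivity),
          ENNReal.ofReal_mul (p := 9) (by norm_num)]
        simp
    _ = _ := by
        rw [mul_pow, Real.sq_sqrt (by positivity), ← Real.rpow_natCast ((n₀ : ℝ) ^ (1 / 2 - φ)),
          ← Real.rpow_mul hn0.le]
        have e1 : (2 * ((1 : ℕ) : ℝ) - 1) * (1 - 2 * φ) = 1 + -2 * φ := by push_cast; ring
        have e2 : (1 / 2 - φ) * ((2 : ℕ) : ℝ) = 1 + -2 * φ := by push_cast; ring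
        rw [e1, e2, Real.rpow_add hn0, Real.rpow_one]
        congr 1
        field_simp

/-- The contribution of the variance term of the expansion to the cross moment. -/
noncomputable def mainMoment (S : Model 𝒲 𝒳 p) (N : Nuisance 𝒲 𝒳 p) (n₀ : ℕ) : ℝ :=
  ∫ q : 𝒲 × 𝒲, S.m₀ q.1 * bil (N.δ n₀ q.1 (S.cov q.2)) (S.hess₀ q.2)
    (btilde S N n₀ (S.cov q.2)) ∂(S.P.prod S.P)

/-- After multiplication by n₀^(1/2+2φ), the part quadratic in `err`, of size n₀^(-1/2-3φ), leaves
n₀^(-φ). The centred b-part, of size n₀^(-1-φ) · n₀^(1/2-φ) times the square root, leaves only that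
root. The δ-part against the bias is matched exactly. -/
theorem exists_abs_crossMoment_sub_le (hS : S.MomentAssumption)
    (he : ExpansionConditions S N φ φ μ W fold M₁ Cb Cδ τ)
    (hφ : φ ∈ Set.Ioo (1 / 4 : ℝ) (1 / 2)) (hM : 0 < M₁) {T : ℝ} (hτ0 : ∀ n, 0 < τ n)
    (hτ : ∀ n, τ n ≤ T) :
    ∃ C : ℝ, 0 ≤ C ∧ ∀ n₀ : ℕ, 1 ≤ n₀ →
      |(n₀ : ℝ) ^ (1 / 2 + 2 * φ) * (crossMoment S N φ n₀ / S.J₀) -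
          2 * (mainMoment S N n₀ / S.J₀ ^ 2)| ≤
        C * ((n₀ : ℝ) ^ (-φ) + √(9 * (τ n₀ + (1 + M₁) / n₀))) := by
  have hT : 0 ≤ T := (hτ0 0).le.trans (hτ 0)
  have hJ := hS.J₀_ne_zero
  obtain ⟨H, hH0, hH⟩ := hS.hess₀_bounded
  obtain ⟨a, ha0, ha⟩ := exists_lintegral_sq_le (hS.memLp_m₀.mono_exponent (q := 4) (p := 2)
    (by norm_num))
  set B := (p : ℝ) ^ 2 * H with hB
  have hB0 : 0 ≤ B := by positivity
  set K := √(81 * (2 * M₁ + T)) with hK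
  set R := √(1 + M₁) with hR
  have hH2 : ∀ᵐ q : 𝒲 × 𝒲 ∂(S.P.prod S.P), ∀ s t, |S.hess₀ q.2 s t| ≤ H :=
    Measure.quasiMeasurePreserving_snd.ae hH
  have hmh : ∀ s t, Measurable fun q : 𝒲 × 𝒲 => S.hess₀ q.2 s t := fun s t =>
    (hS.measurable_hess₀ s t).comp measurable_snd
  have hmm : Measurable fun q : 𝒲 × 𝒲 => S.m₀ q.1 := S.measurable_m₀.comp measurable_fst
  have ham : ∫⁻ q : 𝒲 × 𝒲, ‖S.m₀ q.1‖ₑ ^ 2 ∂(S.P.prod S.P) ≤ ENNReal.ofReal (a ^ 2) := by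
    rw [lintegral_prod _ (hmm.enorm.pow_const 2).aemeasurable]
    simpa using ha
  refine ⟨(a * (B * K) + 2 * (B * (a * R))) / S.J₀ ^ 2, by positivity, fun n hn => ?_⟩
  have hn0 : (0 : ℝ) < n := by exact_mod_cast hn
  have hme := measurable_err S N φ n
  have hmδ := measurable_δ_cov S N n
  have hmt : Measurable fun q : 𝒲 × 𝒲 => btilde S N n (S.cov q.2) :=
    ((measurable_btilde S N n).comp S.measurable_cov).comp measurable_snd
  have hmc : Measurable fun q : 𝒲 × 𝒲 => (n : ℝ) ^ (-φ) •
      (N.b n (S.cov q.1) (S.cov q.2) - btilde S N n (S.cov q.2)) :=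
    ((measurable_b_cov S N n).sub hmt).const_smul ((n : ℝ) ^ (-φ))
  have hBsq : ∀ {f : 𝒲 × 𝒲 → ℝ} {x : ℝ},
      ∫⁻ q, ‖f q‖ₑ ^ 2 ∂(S.P.prod S.P) ≤ ENNReal.ofReal (x ^ 2) →
      ∫⁻ q, ‖B * f q‖ₑ ^ 2 ∂(S.P.prod S.P) ≤ ENNReal.ofReal ((B * x) ^ 2) := by
    intro f x h
    have e : ∀ q, ‖B * f q‖ₑ ^ 2 = ENNReal.ofReal (B ^ 2) * ‖f q‖ₑ ^ 2 := fun q => by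
      rw [enorm_mul, mul_pow, Real.enorm_eq_ofReal hB0, ENNReal.ofReal_pow hB0]
    simp_rw [e]
    rw [lintegral_const_mul' _ _ (by simp), mul_pow B x, ENNReal.ofReal_mul (sq_nonneg B)]
    exact mul_le_mul' le_rfl h
  set s := √(9 * (τ n + (1 + M₁) / n)) with hs
  -- the three parts of the integrand
  have h1 := integrable_and_abs_integral_le (ν := S.P.prod S.P)
    (F := fun q : 𝒲 × 𝒲 => S.m₀ q.1 *
      bil (err S N φ n q.1 (S.cov q.2)) (S.hess₀ q.2) (err S N φ n q.1 (S.cov q.2)))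
    (f := fun q => S.m₀ q.1) (g := fun q => B * ‖err S N φ n q.1 (S.cov q.2)‖ ^ 2)
    (a := a) (b := B * (K * (n : ℝ) ^ (-(1 / 2) - 3 * φ)))
    (hmm.mul (measurable_bil hme hmh hme)).aestronglyMeasurable hmm.aestronglyMeasurable
    ((hme.norm.pow_const 2).const_mul B).aestronglyMeasurable
    (by
      filter_upwards [hH2] with q hq
      rw [abs_mul, abs_mul, abs_of_nonneg (a := B * _) (by positivity), sq]
      exact mul_le_mul_of_nonneg_left (abs_bil_le hq _ _) (abs_nonneg _))
    ha0 ham (by positivity)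
    (hBsq (by
      simp only [enorm_pow, enorm_norm, ← pow_mul]
      exact lintegral_prod_err_pow_four_le he hφ hM hτ0 hτ hn))
  have hg := lintegral_prod_m₀_btilde_le he hM ha hn
  obtain ⟨d, hd0, hd⟩ : ∃ d : ℝ, 0 ≤ d ∧
      ∫⁻ q : 𝒲 × 𝒲, ‖N.δ n q.1 (S.cov q.2)‖ₑ ^ 2 ∂(S.P.prod S.P) ≤ ENNReal.ofReal (d ^ 2) := by
    refine exists_lintegral_sq_le ((memLp_nat_iff hmδ.aestronglyMeasurable 2 two_ne_zero).2 ?_)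
    rw [lintegral_prod_symm' _ (hmδ.enorm.pow_const 2)]
    exact (he.δ_moment n hn 1 (by simp)).trans ENNReal.ofReal_lt_top
  have habs : ∀ (u : Vec p) (q : 𝒲 × 𝒲), (∀ s t, |S.hess₀ q.2 s t| ≤ H) →
      |S.m₀ q.1 * bil u (S.hess₀ q.2) (btilde S N n (S.cov q.2))| ≤
        |B * ‖u‖ * (S.m₀ q.1 * ‖btilde S N n (S.cov q.2)‖)| := by
    intro u q hq
    rw [abs_mul, abs_mul, abs_mul B, abs_mul (S.m₀ q.1), abs_norm, abs_norm, abs_of_nonneg hB0]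
    calc _ ≤ |S.m₀ q.1| * (B * (‖u‖ * ‖btilde S N n (S.cov q.2)‖)) :=
          mul_le_mul_of_nonneg_left (abs_bil_le hq _ _) (abs_nonneg _)
      _ = _ := by ring
  -- Only integrability is taken from this one: its integral is `mainMoment` and is not estimated,
  -- so the bound d may depend on n.
  have h2 := integrable_and_abs_integral_le (ν := S.P.prod S.P)
    (F := fun q : 𝒲 × 𝒲 => S.m₀ q.1 *
      bil (N.δ n q.1 (S.cov q.2)) (S.hess₀ q.2) (btilde S N n (S.cov q.2)))
    (f := fun q => B * ‖N.δ n q.1 (S.cov q.2)‖)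
    (g := fun q => S.m₀ q.1 * ‖btilde S N n (S.cov q.2)‖)
    (a := B * d) (b := a * R)
    (hmm.mul (measurable_bil hmδ hmh hmt)).aestronglyMeasurable
    (hmδ.norm.const_mul B).aestronglyMeasurable (hmm.mul hmt.norm).aestronglyMeasurable
    (by filter_upwards [hH2] with q hq using habs _ q hq) (by positivity)
    (hBsq (by simpa only [enorm_norm] using hd)) (by positivity) hg
  have h3 := integrable_and_abs_integral_le (ν := S.P.prod S.P)
    (F := fun q : 𝒲 × 𝒲 => S.m₀ q.1 * bil ((n : ℝ) ^ (-φ) •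
      (N.b n (S.cov q.1) (S.cov q.2) - btilde S N n (S.cov q.2))) (S.hess₀ q.2)
      (btilde S N n (S.cov q.2)))
    (f := fun q => B * ‖(n : ℝ) ^ (-φ) •
      (N.b n (S.cov q.1) (S.cov q.2) - btilde S N n (S.cov q.2))‖)
    (g := fun q => S.m₀ q.1 * ‖btilde S N n (S.cov q.2)‖)
    (a := B * ((n : ℝ) ^ (1 / 2 - φ) * s)) (b := a * R)
    (hmm.mul (measurable_bil hmc hmh hmt)).aestronglyMeasurable
    (hmc.norm.const_mul B).aestronglyMeasurable (hmm.mul hmt.norm).aestronglyMeasurable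
    (by filter_upwards [hH2] with q hq using habs _ q hq) (by positivity)
    (hBsq (by
      simp only [enorm_norm]
      exact lintegral_prod_b_sub_btilde_le he hM hτ0 hn)) (by positivity) hg
  set α := (n : ℝ) ^ (-(1 / 2) : ℝ) with hα
  set κ := (n : ℝ) ^ (-φ) with hκ
  set I1 := ∫ q : 𝒲 × 𝒲, S.m₀ q.1 *
    bil (err S N φ n q.1 (S.cov q.2)) (S.hess₀ q.2) (err S N φ n q.1 (S.cov q.2)) ∂(S.P.prod S.P)
  set I3 := ∫ q : 𝒲 × 𝒲, S.m₀ q.1 * bil (κ •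
      (N.b n (S.cov q.1) (S.cov q.2) - btilde S N n (S.cov q.2))) (S.hess₀ q.2)
      (btilde S N n (S.cov q.2)) ∂(S.P.prod S.P)
  have hcross : crossMoment S N φ n = S.J₀⁻¹ * (I1 + 2 * (α * κ * κ * mainMoment S N n +
      (n : ℝ)⁻¹ * κ * I3)) := by
    have hdec : ∀ w v, S.m₀ v * (bil (err S N φ n v (S.cov w)) (S.J₀⁻¹ • S.hess₀ w)
        (err S N φ n v (S.cov w)) +
        2 * bil (err S N φ n v (S.cov w)) (S.J₀⁻¹ • S.hess₀ w) (bias S N φ n (S.cov w))) =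
      S.J₀⁻¹ * (S.m₀ v * bil (err S N φ n v (S.cov w)) (S.hess₀ w) (err S N φ n v (S.cov w)) +
        2 * (α * κ * κ * (S.m₀ v * bil (N.δ n v (S.cov w)) (S.hess₀ w) (btilde S N n (S.cov w))) +
          (n : ℝ)⁻¹ * κ * (S.m₀ v * bil (κ • (N.b n (S.cov v) (S.cov w) - btilde S N n (S.cov w)))
            (S.hess₀ w) (btilde S N n (S.cov w))))) := by
      intro w v
      have hb : bil (err S N φ n v (S.cov w)) (S.hess₀ w) (bias S N φ n (S.cov w)) =
          α * κ * κ * bil (N.δ n v (S.cov w)) (S.hess₀ w) (btilde S N n (S.cov w)) +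
          (n : ℝ)⁻¹ * κ * bil (κ • (N.b n (S.cov v) (S.cov w) - btilde S N n (S.cov w)))
            (S.hess₀ w) (btilde S N n (S.cov w)) := by
        rw [bias, bil_smul_right, err, bil_add_left, bil_smul_left, bil_smul_left, bil_smul_left]
        ring
      rw [bil_smul_matrix, bil_smul_matrix, hb]
      ring
    simp only [crossMoment, hdec]
    have hint := ((h1.1.add (((h2.1.const_mul (α * κ * κ)).add
      (h3.1.const_mul ((n : ℝ)⁻¹ * κ))).const_mul 2)).const_mul S.J₀⁻¹)
    have hsym := integral_prod_symm _ hint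
    simp only [Pi.add_apply] at hsym
    rw [← hsym, integral_const_mul]
    congr 1
    have e1 := integral_add h1.1 (((h2.1.const_mul (α * κ * κ)).add
      (h3.1.const_mul ((n : ℝ)⁻¹ * κ))).const_mul 2)
    have e2 := integral_add (h2.1.const_mul (α * κ * κ)) (h3.1.const_mul ((n : ℝ)⁻¹ * κ))
    simp only [Pi.add_apply] at e1 e2
    rw [e1, integral_const_mul, e2, integral_const_mul, integral_const_mul]
    rfl
  have hpow : (n : ℝ) ^ (1 / 2 + 2 * φ) * (α * κ * κ) = 1 := by
    rw [hα, hκ, ← Real.rpow_add hn0, ← Real.rpow_add hn0, ← Real.rpow_add hn0]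
    ring_nf; simp
  have hpow1 : (n : ℝ) ^ (1 / 2 + 2 * φ) * (n : ℝ) ^ (-(1 / 2) - 3 * φ) = κ := by
    rw [hκ, ← Real.rpow_add hn0]; congr 1; ring
  have hpow3 : (n : ℝ) ^ (1 / 2 + 2 * φ) * ((n : ℝ)⁻¹ * κ) * (n : ℝ) ^ (1 / 2 - φ) = 1 := by
    rw [hκ, ← Real.rpow_neg_one, ← Real.rpow_add hn0, ← Real.rpow_add hn0, ← Real.rpow_add hn0]
    ring_nf; simp
  have hexp : (n : ℝ) ^ (1 / 2 + 2 * φ) * (crossMoment S N φ n / S.J₀) -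
      2 * (mainMoment S N n / S.J₀ ^ 2) =
      ((n : ℝ) ^ (1 / 2 + 2 * φ) * I1 +
        2 * ((n : ℝ) ^ (1 / 2 + 2 * φ) * ((n : ℝ)⁻¹ * κ)) * I3) / S.J₀ ^ 2 := by
    rw [hcross]
    generalize (n : ℝ) ^ (1 / 2 + 2 * φ) = X at hpow ⊢
    simp only [div_eq_mul_inv]
    linear_combination 2 * mainMoment S N n * (S.J₀ ^ 2)⁻¹ * hpow
  rw [hexp, abs_div, abs_of_nonneg (sq_nonneg S.J₀), div_mul_eq_mul_div]
  refine div_le_div_of_nonneg_right ?_ (sq_nonneg _)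
  have hX : 0 ≤ (n : ℝ) ^ (1 / 2 + 2 * φ) := by positivity
  have hY : 0 ≤ 2 * ((n : ℝ) ^ (1 / 2 + 2 * φ) * ((n : ℝ)⁻¹ * κ)) := by positivity
  have b1 : |(n : ℝ) ^ (1 / 2 + 2 * φ) * I1| ≤ a * (B * K) * κ := by
    rw [abs_mul, abs_of_nonneg hX]
    calc _ ≤ (n : ℝ) ^ (1 / 2 + 2 * φ) * (a * (B * (K * (n : ℝ) ^ (-(1 / 2) - 3 * φ)))) :=
          mul_le_mul_of_nonneg_left h1.2 hX
      _ = _ := by rw [← hpow1]; ring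
  have b3 : |2 * ((n : ℝ) ^ (1 / 2 + 2 * φ) * ((n : ℝ)⁻¹ * κ)) * I3| ≤
      2 * (B * (a * R)) * s := by
    rw [abs_mul, abs_of_nonneg hY]
    calc _ ≤ 2 * ((n : ℝ) ^ (1 / 2 + 2 * φ) * ((n : ℝ)⁻¹ * κ)) *
          (B * ((n : ℝ) ^ (1 / 2 - φ) * s) * (a * R)) :=
          mul_le_mul_of_nonneg_left h3.2 hY
      _ = 2 * (B * (a * R)) * s * ((n : ℝ) ^ (1 / 2 + 2 * φ) * ((n : ℝ)⁻¹ * κ) *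
          (n : ℝ) ^ (1 / 2 - φ)) := by ring
      _ = _ := by rw [hpow3, mul_one]
  have hκ0 : 0 ≤ κ := by positivity
  have hs0 : 0 ≤ s := Real.sqrt_nonneg _
  have c1 : 0 ≤ a * (B * K) * s := by positivity
  have c2 : 0 ≤ 2 * (B * (a * R)) * κ := by positivity
  refine (abs_add_le _ _).trans ((add_le_add b1 b3).trans ?_)
  linarith [add_mul (a * (B * K)) (2 * (B * (a * R))) (κ + s), mul_add (a * (B * K)) κ s,
    mul_add (2 * (B * (a * R))) κ s]

theorem tendsto_crossMoment (hS : S.MomentAssumption) (he : ExpansionAssumption S N φ φ μ W fold)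
    (hφ : φ ∈ Set.Ioo (1 / 4 : ℝ) (1 / 2)) {Gδ Fδ Fb Gb : ℝ}
    (hG : LeadingTerms S N Gδ Fδ Fb Gb) :
    Tendsto (fun n : ℕ => (n : ℝ) ^ (1 / 2 + 2 * φ) * (crossMoment S N φ n / S.J₀)) atTop
      (𝓝 (2 * Gb)) := by
  obtain ⟨M₁, Cb, Cδ, τ, hM, -, -, hτ0, hτlim, he⟩ := he
  obtain ⟨T, hT⟩ := hτlim.bddAbove_range
  have hT : ∀ n, τ n ≤ T := fun n => hT ⟨n, rfl⟩
  obtain ⟨C, hC0, hC⟩ := exists_abs_crossMoment_sub_le hS he hφ hM hτ0 hT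
  have hlim : Tendsto (fun n : ℕ => 2 * (mainMoment S N n / S.J₀ ^ 2)) atTop (𝓝 (2 * Gb)) :=
    hG.lim_Gb.const_mul 2
  have hbound : Tendsto (fun n : ℕ => C * ((n : ℝ) ^ (-φ) + √(9 * (τ n + (1 + M₁) / n)))) atTop
      (𝓝 0) := by
    have h1 : Tendsto (fun n : ℕ => (n : ℝ) ^ (-φ)) atTop (𝓝 0) :=
      (tendsto_rpow_neg_atTop (by linarith [hφ.1])).comp tendsto_natCast_atTop_atTop
    have h2 : Tendsto (fun n : ℕ => (1 + M₁) / (n : ℝ)) atTop (𝓝 0) :=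
      tendsto_const_div_atTop_nhds_zero_nat _
    have h3 := (((hτlim.add h2).const_mul 9).sqrt)
    have h4 := (h1.add h3).const_mul C
    simpa using h4
  have hdiff : Tendsto (fun n : ℕ => (n : ℝ) ^ (1 / 2 + 2 * φ) * (crossMoment S N φ n / S.J₀) -
      2 * (mainMoment S N n / S.J₀ ^ 2)) atTop (𝓝 0) := by
    refine squeeze_zero_norm' ?_ hbound
    filter_upwards [eventually_ge_atTop 1] with n hn using hC n hn
  simpa using hdiff.add hlim

end Expansion

end DML

namespace DML

open scoped ENNReal

set_option linter.unusedSectionVars false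

/-! ### Sizes and measurability of the training sets. -/

section Folds

variable {Ω 𝒲 : Type*} [MeasurableSpace Ω] [MeasurableSpace 𝒲] {μ : Measure Ω} {W : ℕ → Ω → 𝒲}
  {fold : ℕ → ℕ → Ω → ℕ → ℕ}

theorem notMem_train (n : ℕ) (c : ℕ → ℕ) (i : ℕ) : i ∉ train n c (c i) := by simp [train]

theorem train_subset_range (n : ℕ) (c : ℕ → ℕ) (k : ℕ) : train n c k ⊆ Finset.range n :=
  Finset.filter_subset _ _

theorem IsSplit.card_train (h : IsSplit μ W fold) {n K : ℕ} (hK : 2 ≤ K) (hKn : K ≤ n) (ω : Ω)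
    {i : ℕ} (hi : i < n) :
    (train n (fold n K ω) (fold n K ω i)).card = n - n / K ∨
      (train n (fold n K ω) (fold n K ω i)).card = n - n / K - 1 := by
  have h1 := h.balanced n K hK hKn ω _ (h.label_lt n K hK hKn ω i hi)
  have h2 := Finset.card_filter_add_card_filter_not (s := Finset.range n)
    (fun l => fold n K ω l = fold n K ω i)
  rw [Finset.card_range] at h2
  unfold train
  simp only [ne_eq]
  omega

/-- As K ≥ 2 there is a second label, and its fold has at least n/K ≥ 1 elements. -/
theorem IsSplit.train_nonempty (h : IsSplit μ W fold) {n K : ℕ} (hK : 2 ≤ K) (hKn : K ≤ n) (ω : Ω)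
    (k : ℕ) : (train n (fold n K ω) k).Nonempty := by
  obtain ⟨k', hk', hne⟩ : ∃ k' < K, k' ≠ k := by
    rcases eq_or_ne k 0 with rfl | hk
    · exact ⟨1, by omega, one_ne_zero⟩
    · exact ⟨0, by omega, hk.symm⟩
  have h1 : 1 ≤ n / K := (Nat.one_le_div_iff (by omega)).2 hKn
  have h2 : 0 < ((Finset.range n).filter fun i => fold n K ω i = k').card := by
    rcases h.balanced n K hK hKn ω k' hk' with h3 | h3 <;> omega
  obtain ⟨l, hl⟩ := Finset.card_pos.1 h2
  rw [Finset.mem_filter] at hl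
  exact ⟨l, Finset.mem_filter.2 ⟨hl.1, by rw [hl.2]; exact hne⟩⟩

theorem IsSplit.le_four_mul_card_train (h : IsSplit μ W fold) {n K : ℕ} (hK : 2 ≤ K) (hKn : K ≤ n)
    (ω : Ω) {i : ℕ} (hi : i < n) : n ≤ 4 * (train n (fold n K ω) (fold n K ω i)).card := by
  have h1 := h.card_train hK hKn ω hi
  have h2 := (h.train_nonempty hK hKn ω (fold n K ω i)).card_pos
  have h3 : n / K ≤ n / 2 := Nat.div_le_div_left hK (by norm_num)
  -- The size is at least n - n/2 - 1, which is enough except for n = 2, where nonemptiness is used.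
  omega

theorem measurableSet_train_eq (n i : ℕ) (A : Finset ℕ) :
    MeasurableSet {c : ℕ → ℕ | train n c (c i) = A} := by
  have h : {c : ℕ → ℕ | train n c (c i) = A} =
      ⋂ l : ℕ, {c | (l < n ∧ c l ≠ c i) ↔ l ∈ A} := by
    ext c
    simp [Finset.ext_iff, train]
  rw [h]
  refine MeasurableSet.iInter fun l => ?_
  have h1 : MeasurableSet {c : ℕ → ℕ | c l = c i} :=
    measurableSet_eq_fun (measurable_pi_apply l) (measurable_pi_apply i)
  have h2 : MeasurableSet {c : ℕ → ℕ | l < n ∧ c l ≠ c i} := (MeasurableSet.const _).inter h1.compl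
  by_cases hl : l ∈ A
  · simpa [hl] using h2
  · have h3 : {c : ℕ → ℕ | (l < n ∧ c l ≠ c i) ↔ l ∈ A} = {c : ℕ → ℕ | l < n ∧ c l ≠ c i}ᶜ := by
      ext c
      simp [hl]
    rw [h3]
    exact h2.compl

end Folds

theorem abs_integral_sub_le {Ω : Type*} [MeasurableSpace Ω] {μ : Measure Ω}
    [IsProbabilityMeasure μ] {f : Ω → ℝ} (hf : Measurable f) {c e : ℝ}
    (h : ∀ ω, |f ω - c| ≤ e) : |∫ ω, f ω ∂μ - c| ≤ e := by
  have hi : Integrable (fun ω => f ω - c) μ :=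
    Integrable.of_bound (hf.sub_const c).aestronglyMeasurable e (ae_of_all _ h)
  have hif : Integrable f μ :=
    (hi.add (integrable_const c)).congr (ae_of_all _ fun ω => by simp)
  have h1 : ∫ ω, f ω ∂μ - c = ∫ ω, (f ω - c) ∂μ := by
    rw [integral_sub hif (integrable_const c)]; simp
  rw [h1]
  have h2 := norm_integral_le_of_norm_le_const (μ := μ) (f := fun ω => f ω - c) (C := e)
    (ae_of_all _ h)
  simpa using h2

/-! ### Averaging over the split, and the variance decomposition. -/

section Variance

variable {Ω 𝒲 𝒳 : Type*} [MeasurableSpace Ω] [MeasurableSpace 𝒲] [MeasurableSpace 𝒳] {p : ℕ}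
  {S : Model 𝒲 𝒳 p} {N : Nuisance 𝒲 𝒳 p} {φ : ℝ}
  {μ : Measure Ω} [IsProbabilityMeasure μ] {W : ℕ → Ω → 𝒲} {fold : ℕ → ℕ → Ω → ℕ → ℕ}

theorem measurable_Tstar_seq (n : ℕ) :
    Measurable (Tstar S (fun i (w : ℕ → 𝒲) => w i) n) := by
  refine Measurable.const_mul (Finset.measurable_sum _ fun i _ => ?_) _
  exact (S.measurable_m₀.comp (measurable_pi_apply i)).div_const _

section FoldSample

variable (S N φ W fold) in
/-- The quadratic form at the `i`-th observation of the cross-fitted estimator. -/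
noncomputable def foldQuad (n K i : ℕ) (ω : Ω) : ℝ :=
  quad S N φ (train n (fold n K ω) (fold n K ω i)) i fun l => W l ω

variable (hW : IsSample μ S.P W) (hfold : IsSplit μ W fold) (hS : S.MomentAssumption)
include hW hfold hS

/-- The training set takes values in a countable type, so with the discrete σ-algebra on it,
measurability for each fixed set gives joint measurability. -/
theorem measurable_foldQuad {n K : ℕ} (hK : 2 ≤ K) (hKn : K ≤ n) (i : ℕ) :
    Measurable (foldQuad S N φ W fold n K i) := by
  let _ : MeasurableSpace (Finset ℕ) := ⊤
  have hg : Measurable fun c : ℕ → ℕ => train n c (c i) :=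
    measurable_to_countable' fun A => measurableSet_train_eq n i A
  have hF : Measurable fun q : Finset ℕ × (ℕ → 𝒲) => quad S N φ q.1 i q.2 :=
    measurable_from_prod_countable_right fun A => measurable_quad N φ hS A i
  have h1 := (hg.comp (hfold.measurable n K hK hKn)).prodMk hW.measurable_seq
  have h2 := hF.comp h1
  exact h2

theorem lintegral_foldQuad_sq_le {C : ℝ} (hC0 : 0 ≤ C)
    (hC : ∀ A : Finset ℕ, A.Nonempty → ∀ i ∉ A,
      ∫⁻ ω, ‖quad S N φ A i fun l => W l ω‖ₑ ^ 2 ∂μ ≤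
        ENNReal.ofReal ((C * (A.card : ℝ) ^ (-2 * φ)) ^ 2))
    {n K : ℕ} (hK : 2 ≤ K) (hKn : K ≤ n) {i : ℕ} {b : ℝ}
    (hb : ∀ ω, ((train n (fold n K ω) (fold n K ω i)).card : ℝ) ^ (-2 * φ) ≤ b) :
    ∫⁻ ω, ‖foldQuad S N φ W fold n K i ω‖ₑ ^ 2 ∂μ ≤ ENNReal.ofReal ((C * b) ^ 2) := by
  let _ : MeasurableSpace (Finset ℕ) := ⊤
  have hg : Measurable fun c : ℕ → ℕ => train n c (c i) :=
    measurable_to_countable' fun A => measurableSet_train_eq n i A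
  have hF : Measurable fun q : Finset ℕ × (ℕ → 𝒲) => ‖quad S N φ q.1 i q.2‖ₑ ^ 2 :=
    measurable_from_prod_countable_right fun A =>
      (measurable_quad N φ hS A i).enorm.pow_const 2
  have hind := (hfold.indep n K hK hKn).comp hg measurable_id
  have h := lintegral_of_indepFun (hg.comp (hfold.measurable n K hK hKn)) hW.measurable_seq hind
    (F := fun A w => ‖quad S N φ A i w‖ₑ ^ 2) hF
  refine (le_of_eq h).trans ?_
  calc _ ≤ ∫⁻ _ω', ENNReal.ofReal ((C * b) ^ 2) ∂μ := by
        refine lintegral_mono fun ω' => ?_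
        refine (hC _ (hfold.train_nonempty hK hKn ω' _) i (notMem_train n _ i)).trans ?_
        have hpos : 0 ≤ ((train n (fold n K ω') (fold n K ω' i)).card : ℝ) ^ (-2 * φ) := by
          positivity
        exact ENNReal.ofReal_le_ofReal
          (pow_le_pow_left₀ (by positivity) (mul_le_mul_of_nonneg_left (hb ω') hC0) 2)
    _ = _ := by simp

/-- The split is independent of the sample, so the expectation is an average over realized splits;
an estimate with the same c and e for all of them survives averaging. -/
theorem abs_integral_Tstar_mul_foldQuad_sub_le {n K : ℕ} (hK : 2 ≤ K) (hKn : K ≤ n) {i : ℕ}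
    {c e : ℝ}
    (hint : Integrable (fun ω => Tstar S W n ω * foldQuad S N φ W fold n K i ω) μ)
    (h : ∀ ω', |∫ ω, Tstar S W n ω *
      quad S N φ (train n (fold n K ω') (fold n K ω' i)) i (fun l => W l ω) ∂μ - c| ≤ e) :
    |∫ ω, Tstar S W n ω * foldQuad S N φ W fold n K i ω ∂μ - c| ≤ e := by
  let _ : MeasurableSpace (Finset ℕ) := ⊤
  have hg : Measurable fun c : ℕ → ℕ => train n c (c i) :=
    measurable_to_countable' fun A => measurableSet_train_eq n i A
  have hF : Measurable fun q : Finset ℕ × (ℕ → 𝒲) =>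
      Tstar S (fun i (w : ℕ → 𝒲) => w i) n q.2 * quad S N φ q.1 i q.2 :=
    measurable_from_prod_countable_right fun A =>
      (measurable_Tstar_seq n).mul (measurable_quad N φ hS A i)
  have hA := hg.comp (hfold.measurable n K hK hKn)
  have hind := (hfold.indep n K hK hKn).comp hg measurable_id
  have h2 := integral_of_indepFun hA hW.measurable_seq hind
    (F := fun A w => Tstar S (fun i (w : ℕ → 𝒲) => w i) n w * quad S N φ A i w) hF hint
  have h3 : ∫ ω, Tstar S W n ω * foldQuad S N φ W fold n K i ω ∂μ = ∫ ω', ∫ ω, Tstar S W n ω *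
      quad S N φ (train n (fold n K ω') (fold n K ω' i)) i (fun l => W l ω) ∂μ ∂μ := h2
  rw [h3]
  refine abs_integral_sub_le ?_ h
  have hH : Measurable fun A : Finset ℕ =>
      ∫ ω, Tstar S W n ω * quad S N φ A i (fun l => W l ω) ∂μ := measurable_from_top
  exact hH.comp hA

end FoldSample

section Moments

variable (hW : IsSample μ S.P W) (hS : S.MomentAssumption)
include hW hS

theorem memLp_Tstar (n : ℕ) : MemLp (Tstar S W n) 2 μ := by
  have hm2 : MemLp S.m₀ 2 S.P := hS.memLp_m₀.mono_exponent (by norm_num)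
  have h1 : ∀ i, MemLp (fun ω => S.m₀ (W i ω) / S.J₀) 2 μ := fun i => by
    simpa only [div_eq_mul_inv] using (hW.memLp_comp hm2 i).mul_const S.J₀⁻¹
  have h2 : MemLp (fun ω => ∑ i ∈ Finset.range n, S.m₀ (W i ω) / S.J₀) 2 μ :=
    memLp_finsetSum _ fun i _ => h1 i
  exact h2.const_mul ((n : ℝ) ^ (-(1 / 2) : ℝ))

theorem integral_Tstar (hθ : S.MomentCondition) (n : ℕ) : ∫ ω, Tstar S W n ω ∂μ = 0 := by
  have h : ∀ i ∈ Finset.range n, Integrable (fun ω => S.m₀ (W i ω) / S.J₀) μ := fun i _ =>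
    ((hW.measurePreserving i).integrable_comp_of_integrable hθ.1).div_const _
  simp only [Tstar]
  rw [integral_const_mul, integral_finsetSum _ h]
  simp [integral_div, hW.integral_comp S.measurable_m₀, hθ.2]

theorem variance_Tstar (hθ : S.MomentCondition) {n : ℕ} (hn : 1 ≤ n) :
    variance (Tstar S W n) μ = S.σsq := by
  have hn0 : (0 : ℝ) < n := by exact_mod_cast hn
  have hm2 : MemLp S.m₀ 2 S.P := hS.memLp_m₀.mono_exponent (by norm_num)
  have hX : ∀ i, MemLp (fun ω => S.m₀ (W i ω) / S.J₀) 2 μ := fun i => by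
    simpa only [div_eq_mul_inv] using (hW.memLp_comp hm2 i).mul_const S.J₀⁻¹
  have hvar : ∀ i, variance (fun ω => S.m₀ (W i ω) / S.J₀) μ = S.σsq := by
    intro i
    rw [variance_eq_sub (hX i)]
    have h1 : ∫ ω, S.m₀ (W i ω) / S.J₀ ∂μ = 0 := by
      rw [integral_div, hW.integral_comp S.measurable_m₀, hθ.2, zero_div]
    have h2 : ∫ ω, (S.m₀ (W i ω) / S.J₀) ^ 2 ∂μ = S.σsq := by
      simp only [div_pow]
      rw [integral_div, hW.integral_comp (S.measurable_m₀.pow_const 2)]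
      rfl
    simp only [Pi.pow_apply]
    rw [h1, h2]; ring
  have hsum := IndepFun.variance_sum (μ := μ) (s := Finset.range n)
    (X := fun i ω => S.m₀ (W i ω) / S.J₀) (fun i _ => hX i) (fun i _ j _ hij =>
      (hW.indep.indepFun hij).comp (S.measurable_m₀.div_const _) (S.measurable_m₀.div_const _))
  have hT : Tstar S W n = fun ω => (n : ℝ) ^ (-(1 / 2) : ℝ) *
      (∑ i ∈ Finset.range n, fun ω => S.m₀ (W i ω) / S.J₀) ω := by
    ext ω; simp [Tstar]
  have hpow : ((n : ℝ) ^ (-(1 / 2) : ℝ)) ^ 2 * n = 1 := by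
    rw [← Real.rpow_natCast, ← Real.rpow_mul hn0.le, ← Real.rpow_add_one hn0.ne']
    norm_num
  rw [hT, variance_const_mul, hsum]
  simp only [hvar, Finset.sum_const, Finset.card_range, nsmul_eq_mul]
  rw [← mul_assoc, hpow, one_mul]

end Moments

theorem Tnl_eq (n K : ℕ) (ω : Ω) : Tnl S N φ φ W fold n K ω =
    (1 / 2) * (n : ℝ) ^ (-(1 / 2) : ℝ) * ∑ i ∈ Finset.range n, foldQuad S N φ W fold n K i ω := rfl

theorem Tapprox_eq (n K : ℕ) :
    Tapprox S N φ φ W fold n K = Tstar S W n + Tnl S N φ φ W fold n K := rfl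

theorem memLp_Tnl {n K : ℕ} (h : ∀ i < n, MemLp (foldQuad S N φ W fold n K i) 2 μ) :
    MemLp (Tnl S N φ φ W fold n K) 2 μ := by
  have h1 : MemLp (fun ω => ∑ i ∈ Finset.range n, foldQuad S N φ W fold n K i ω) 2 μ :=
    memLp_finsetSum _ fun i hi => h i (Finset.mem_range.1 hi)
  exact h1.const_mul ((1 / 2) * (n : ℝ) ^ (-(1 / 2) : ℝ))

/-- The variance of the approximation in terms of bounds on the second moments of the quadratic
forms and on their covariances with the first-order term. -/
theorem abs_variance_Tapprox_sub_le (hW : IsSample μ S.P W) (hS : S.MomentAssumption)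
    (hθ : S.MomentCondition) {n K : ℕ} (hn : 1 ≤ n) {D e b : ℝ} (hb0 : 0 ≤ b)
    (hmem : ∀ i < n, MemLp (foldQuad S N φ W fold n K i) 2 μ)
    (hb : ∀ i < n, ∫⁻ ω, ‖foldQuad S N φ W fold n K i ω‖ₑ ^ 2 ∂μ ≤ ENNReal.ofReal (b ^ 2))
    (hD : ∀ i < n, |∫ ω, Tstar S W n ω * foldQuad S N φ W fold n K i ω ∂μ -
      (n : ℝ) ^ (-(1 / 2) : ℝ) * D| ≤ (n : ℝ) ^ (-(1 / 2) : ℝ) * e) :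
    |variance (Tapprox S N φ φ W fold n K) μ - S.σsq - D| ≤ e + n * b ^ 2 := by
  have hn0 : (0 : ℝ) < n := by exact_mod_cast hn
  have hT := memLp_Tstar hW hS n
  have hT' := memLp_Tnl hmem
  set α := (n : ℝ) ^ (-(1 / 2) : ℝ) with hα
  have hα0 : 0 ≤ α := by positivity
  have hpow : α ^ 2 * n = 1 := by
    rw [hα, ← Real.rpow_natCast, ← Real.rpow_mul hn0.le, ← Real.rpow_add_one hn0.ne']
    norm_num
  have hint : ∀ i ∈ Finset.range n,
      Integrable (fun ω => Tstar S W n ω * foldQuad S N φ W fold n K i ω) μ := fun i hi =>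
    hT.integrable_mul (hmem i (Finset.mem_range.1 hi))
  have hcov : cov[Tstar S W n, Tnl S N φ φ W fold n K; μ] = (1 / 2) * α *
      ∑ i ∈ Finset.range n, ∫ ω, Tstar S W n ω * foldQuad S N φ W fold n K i ω ∂μ := by
    rw [covariance_eq_sub hT hT', integral_Tstar hW hS hθ, zero_mul, sub_zero,
      ← integral_finsetSum _ hint, ← integral_const_mul]
    refine integral_congr_ae (ae_of_all _ fun ω => ?_)
    simp only [Pi.mul_apply, Tnl_eq, Finset.mul_sum]
    exact Finset.sum_congr rfl fun i _ => by ring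
  have hcovD : |2 * cov[Tstar S W n, Tnl S N φ φ W fold n K; μ] - D| ≤ e := by
    -- The factor 1/2 of `Tnl` cancels the 2, and D is spread evenly over the n indices by α² n = 1.
    have h1 : 2 * cov[Tstar S W n, Tnl S N φ φ W fold n K; μ] - D =
        α * ∑ i ∈ Finset.range n,
          (∫ ω, Tstar S W n ω * foldQuad S N φ W fold n K i ω ∂μ - α * D) := by
      rw [hcov, Finset.sum_sub_distrib]
      simp only [Finset.sum_const, Finset.card_range, nsmul_eq_mul]
      linear_combination D * hpow
    rw [h1, abs_mul, abs_of_nonneg hα0]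
    calc _ ≤ α * ∑ _i ∈ Finset.range n, α * e :=
          mul_le_mul_of_nonneg_left ((Finset.abs_sum_le_sum_abs _ _).trans
            (Finset.sum_le_sum fun i hi => hD i (Finset.mem_range.1 hi))) hα0
      _ = e := by
          simp only [Finset.sum_const, Finset.card_range, nsmul_eq_mul]
          linear_combination e * hpow
  have hsq : ∀ i ∈ Finset.range n, ∫ ω, foldQuad S N φ W fold n K i ω ^ 2 ∂μ ≤ b ^ 2 := by
    intro i hi
    have hi := Finset.mem_range.1 hi
    have h := abs_integral_mul_le (hmem i hi).1 (hmem i hi).1 hb0 (hb i hi) hb0 (hb i hi)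
    simp only [← sq] at h
    exact (le_abs_self _).trans h
  have hvar : variance (Tnl S N φ φ W fold n K) μ ≤ n * b ^ 2 := by
    refine (variance_le_expectation_sq hT'.1).trans ?_
    have hisq : ∀ i ∈ Finset.range n,
        Integrable (fun ω => foldQuad S N φ W fold n K i ω ^ 2) μ := fun i hi =>
      (hmem i (Finset.mem_range.1 hi)).integrable_sq
    have hpt : ∀ ω, (Tnl S N φ φ W fold n K ^ 2) ω ≤
        ∑ i ∈ Finset.range n, foldQuad S N φ W fold n K i ω ^ 2 := by
      intro ω
      have h1 := sq_sum_le_card_mul_sum_sq (s := Finset.range n)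
        (f := fun i => foldQuad S N φ W fold n K i ω)
      rw [Finset.card_range] at h1
      have hs : 0 ≤ ∑ i ∈ Finset.range n, foldQuad S N φ W fold n K i ω ^ 2 :=
        Finset.sum_nonneg fun _ _ => sq_nonneg _
      calc (Tnl S N φ φ W fold n K ^ 2) ω =
            1 / 4 * α ^ 2 * (∑ i ∈ Finset.range n, foldQuad S N φ W fold n K i ω) ^ 2 := by
            simp only [Pi.pow_apply, Tnl_eq]; ring
        _ ≤ 1 / 4 * α ^ 2 * (n * ∑ i ∈ Finset.range n, foldQuad S N φ W fold n K i ω ^ 2) :=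
            mul_le_mul_of_nonneg_left h1 (by positivity)
        _ = 1 / 4 * ∑ i ∈ Finset.range n, foldQuad S N φ W fold n K i ω ^ 2 := by
            linear_combination
              (1 / 4 * ∑ i ∈ Finset.range n, foldQuad S N φ W fold n K i ω ^ 2) * hpow
        _ ≤ _ := by linarith
    calc ∫ ω, (Tnl S N φ φ W fold n K ^ 2) ω ∂μ
        ≤ ∫ ω, ∑ i ∈ Finset.range n, foldQuad S N φ W fold n K i ω ^ 2 ∂μ :=
          integral_mono hT'.integrable_sq (integrable_finsetSum _ hisq) hpt
      _ = ∑ i ∈ Finset.range n, ∫ ω, foldQuad S N φ W fold n K i ω ^ 2 ∂μ :=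
          integral_finsetSum _ hisq
      _ ≤ ∑ _i ∈ Finset.range n, b ^ 2 := Finset.sum_le_sum hsq
      _ = _ := by simp
  rw [Tapprox_eq, variance_add hT hT', variance_Tstar hW hS hθ hn]
  have hv0 := variance_nonneg (Tnl S N φ φ W fold n K) μ
  rw [abs_le] at hcovD ⊢
  constructor <;> linarith [hcovD.1, hcovD.2]

end Variance

/-- Powers of the number of training observations, relative to its value for folds of equal
size. -/
theorem eventually_abs_rpow_mul_sub_le {ρ G : ℝ} (hρ0 : 0 < ρ) (hρ1 : ρ < 1) {h : ℕ → ℝ}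
    (hh : Tendsto h atTop (𝓝 G)) {ε : ℝ} (hε : 0 < ε) :
    ∀ᶠ n : ℕ in atTop, ∀ K, 2 ≤ K → K ≤ n → ∀ k : ℕ, (k = n - n / K ∨ k = n - n / K - 1) →
      |(k : ℝ) ^ (-ρ) * h k - G * (1 + 1 / ((K : ℝ) - 1)) ^ ρ * (n : ℝ) ^ (-ρ)| ≤
        ε * (n : ℝ) ^ (-ρ) := by
  -- Continuity at one point gives uniformity in K: the ratio t defined below tends to 1 and h k
  -- tends to G, both at rates independent of K.
  have hcont : ContinuousAt (fun q : ℝ × ℝ => q.1 ^ (-ρ) * q.2) (1, G) :=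
    (continuousAt_fst.rpow_const (Or.inl one_ne_zero)).mul continuousAt_snd
  obtain ⟨d, hd0, hd⟩ := Metric.continuousAt_iff.1 hcont (ε / 2) (by positivity)
  obtain ⟨n₁, hn₁⟩ := (Metric.tendsto_atTop.1 hh) d hd0
  obtain ⟨n₂, hn₂⟩ := exists_nat_gt (2 / d)
  filter_upwards [eventually_ge_atTop (max (4 * n₁) (max n₂ 4))] with n hn K hK hKn k hk
  have hna : 4 * n₁ ≤ n := (le_max_left _ _).trans hn
  have hnb : n₂ ≤ n := ((le_max_left _ _).trans (le_max_right _ _)).trans hn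
  have hnc : 4 ≤ n := ((le_max_right _ _).trans (le_max_right _ _)).trans hn
  have hn0 : (0 : ℝ) < n := by exact_mod_cast (by omega : 0 < n)
  have hdiv : n / K ≤ n / 2 := Nat.div_le_div_left hK (by norm_num)
  have hk4 : n ≤ 4 * k := by omega
  have hk0 : (0 : ℝ) < k := by exact_mod_cast (by omega : 0 < k)
  have hK2 : (2 : ℝ) ≤ K := by exact_mod_cast hK
  have hK1 : (0 : ℝ) < (K : ℝ) - 1 := by linarith
  set L := 1 + 1 / ((K : ℝ) - 1) with hL
  have hLK : L * ((K : ℝ) - 1) = K := by rw [hL]; field_simp; ring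
  have hL1 : 1 ≤ L := by rw [hL]; linarith [one_div_pos.2 hK1]
  have hL2 : L ≤ 2 := by
    have : 1 / ((K : ℝ) - 1) ≤ 1 := by rw [div_le_one hK1]; linarith
    rw [hL]; linarith
  have hL0 : 0 < L := by linarith
  -- `t` is the number of training observations relative to `n (K - 1) / K`
  set t := (k : ℝ) * L / n with ht
  have ht0 : 0 < t := by positivity
  have hmod := Nat.div_add_mod n K
  have hmlt := Nat.mod_lt n (by omega : 0 < K)
  have hle : n / K ≤ n := Nat.div_le_self _ _
  have hq : (K : ℝ) * ((n / K : ℕ) : ℝ) + ((n % K : ℕ) : ℝ) = n := by exact_mod_cast hmod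
  have hr : ((n % K : ℕ) : ℝ) < K := by exact_mod_cast hmlt
  have hr0 : (0 : ℝ) ≤ ((n % K : ℕ) : ℝ) := by positivity
  have hkr : (k : ℝ) = n - ((n / K : ℕ) : ℝ) ∨ (k : ℝ) = n - ((n / K : ℕ) : ℝ) - 1 := by
    rcases hk with rfl | rfl
    · left; push_cast [Nat.cast_sub hle]; ring
    · right
      rw [Nat.cast_sub (by omega), Nat.cast_sub hle]; simp
  -- With r the remainder of n modulo K, the difference is r or r - K. Division by n(K-1) then gives
  -- at most 2/n, because K/(K-1) ≤ 2.
  have hkn : |(k : ℝ) * K - n * ((K : ℝ) - 1)| ≤ K := by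
    rw [abs_le]
    rcases hkr with h1 | h1 <;> rw [h1] <;> constructor <;> nlinarith
  have ht1 : |t - 1| ≤ 2 / n := by
    have h1 : t - 1 = ((k : ℝ) * K - n * ((K : ℝ) - 1)) / (n * ((K : ℝ) - 1)) := by
      have h2 : t * n = k * L := by rw [ht]; field_simp
      rw [eq_div_iff (by positivity)]
      linear_combination ((K : ℝ) - 1) * h2 + (k : ℝ) * hLK
    rw [h1, abs_div, abs_of_pos (a := (n : ℝ) * ((K : ℝ) - 1)) (by positivity),
      div_le_div_iff₀ (by positivity) hn0]
    calc _ ≤ (K : ℝ) * n := mul_le_mul_of_nonneg_right hkn hn0.le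
      _ ≤ _ := by nlinarith
  have htd : |t - 1| < d := by
    refine ht1.trans_lt ?_
    rw [div_lt_iff₀ hd0] at hn₂
    rw [div_lt_iff₀ hn0]
    have : (n₂ : ℝ) ≤ n := by exact_mod_cast hnb
    nlinarith
  have hhk : |h k - G| < d := by
    have := hn₁ k (by omega)
    rwa [Real.dist_eq] at this
  have hclose : |t ^ (-ρ) * h k - G| ≤ ε / 2 := by
    have := hd (x := (t, h k)) (by
      rw [Prod.dist_eq, max_lt_iff, Real.dist_eq, Real.dist_eq]
      exact ⟨htd, hhk⟩)
    rw [Real.dist_eq] at this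
    simpa using this.le
  have hkpow : (k : ℝ) ^ (-ρ) = (n : ℝ) ^ (-ρ) * L ^ ρ * t ^ (-ρ) := by
    have h1 : (k : ℝ) = n * L⁻¹ * t := by rw [ht]; field_simp
    conv_lhs => rw [h1]
    rw [Real.mul_rpow (by positivity) ht0.le, Real.mul_rpow hn0.le (by positivity),
      Real.inv_rpow hL0.le, Real.rpow_neg hL0.le, inv_inv]
  have hLρ : L ^ ρ ≤ 2 := by
    calc L ^ ρ ≤ L ^ (1 : ℝ) := Real.rpow_le_rpow_of_exponent_le hL1 hρ1.le
      _ ≤ 2 := by rwa [Real.rpow_one]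
  have hfin : (k : ℝ) ^ (-ρ) * h k - G * L ^ ρ * (n : ℝ) ^ (-ρ) =
      (n : ℝ) ^ (-ρ) * L ^ ρ * (t ^ (-ρ) * h k - G) := by rw [hkpow]; ring
  have hnp : 0 ≤ (n : ℝ) ^ (-ρ) := by positivity
  have hLp : 0 ≤ L ^ ρ := by positivity
  rw [hfin, abs_mul, abs_of_nonneg (by positivity)]
  calc _ ≤ (n : ℝ) ^ (-ρ) * 2 * (ε / 2) :=
        mul_le_mul (mul_le_mul_of_nonneg_left hLρ hnp) hclose (abs_nonneg _) (by positivity)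
    _ = _ := by ring

end DML

namespace DML

open scoped ENNReal

set_option linter.unusedSectionVars false

/-! ### Assembly, uniformly in the number of folds. -/

section Main

variable {Ω 𝒲 𝒳 : Type*} [MeasurableSpace Ω] [MeasurableSpace 𝒲] [MeasurableSpace 𝒳] {p : ℕ}
  {S : Model 𝒲 𝒳 p} {N : Nuisance 𝒲 𝒳 p} {φ : ℝ}
  {μ : Measure Ω} [IsProbabilityMeasure μ] {W : ℕ → Ω → 𝒲} {fold : ℕ → ℕ → Ω → ℕ → ℕ}
  (hW : IsSample μ S.P W) (hfold : IsSplit μ W fold) (hS : S.MomentAssumption)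
  (he : ExpansionAssumption S N φ φ μ W fold) (hφ : φ ∈ Set.Ioo (1 / 4 : ℝ) (1 / 2))

/-- Training sets contain at least a quarter of the sample, and 4^(2φ) ≤ 4 since φ < 1/2. -/
theorem IsSplit.card_train_rpow_le (hfold : IsSplit μ W fold)
    (hφ : φ ∈ Set.Ioo (1 / 4 : ℝ) (1 / 2)) {n K : ℕ} (hK : 2 ≤ K) (hKn : K ≤ n) (ω : Ω) {i : ℕ}
    (hi : i < n) :
    ((train n (fold n K ω) (fold n K ω i)).card : ℝ) ^ (-2 * φ) ≤ 4 * (n : ℝ) ^ (-2 * φ) := by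
  have h1 : (n : ℝ) ≤ 4 * ((train n (fold n K ω) (fold n K ω i)).card : ℝ) := by
    exact_mod_cast hfold.le_four_mul_card_train hK hKn ω hi
  have hn0 : (0 : ℝ) < n := by exact_mod_cast (by omega : 0 < n)
  have h2 : (4 : ℝ) ^ (2 * φ) ≤ 4 := by
    calc (4 : ℝ) ^ (2 * φ) ≤ 4 ^ (1 : ℝ) :=
          Real.rpow_le_rpow_of_exponent_le (by norm_num) (by linarith [hφ.2])
      _ = 4 := Real.rpow_one 4
  calc _ ≤ ((n : ℝ) / 4) ^ (-2 * φ) :=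
        Real.rpow_le_rpow_of_nonpos (by positivity) (by linarith) (by linarith [hφ.1])
    _ = 4 ^ (2 * φ) * (n : ℝ) ^ (-2 * φ) := by
        rw [Real.div_rpow hn0.le (by norm_num), neg_mul, Real.rpow_neg (by norm_num : (0:ℝ) ≤ 4)]
        field_simp
    _ ≤ _ := mul_le_mul_of_nonneg_right h2 (by positivity)

include hW hfold hS he hφ

theorem exists_foldQuad_bound : ∃ C : ℝ, 0 ≤ C ∧ ∀ n K, 2 ≤ K → K ≤ n → ∀ i < n,
    MemLp (foldQuad S N φ W fold n K i) 2 μ ∧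
    ∫⁻ ω, ‖foldQuad S N φ W fold n K i ω‖ₑ ^ 2 ∂μ ≤
      ENNReal.ofReal ((C * (n : ℝ) ^ (-2 * φ)) ^ 2) := by
  obtain ⟨C, hC0, hC⟩ := exists_lintegral_quad_sq_le hW hS he hφ
  refine ⟨C * 4, by positivity, fun n K hK hKn i hi => ?_⟩
  have h := lintegral_foldQuad_sq_le hW hfold hS hC0 hC hK hKn (i := i)
    fun ω => hfold.card_train_rpow_le hφ hK hKn ω hi
  rw [← mul_assoc] at h
  refine ⟨?_, h⟩
  have hm := measurable_foldQuad (N := N) (φ := φ) hW hfold hS hK hKn i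
  have h2 := memLp_nat_iff (ν := μ) hm.aestronglyMeasurable 2 two_ne_zero
  exact h2.2 (h.trans_lt ENNReal.ofReal_lt_top)

theorem memLp_Tapprox {n K : ℕ} (hK : 2 ≤ K) (hKn : K ≤ n) :
    MemLp (Tapprox S N φ φ W fold n K) 2 μ := by
  obtain ⟨C, -, hC⟩ := exists_foldQuad_bound hW hfold hS he hφ
  rw [Tapprox_eq]
  exact (memLp_Tstar hW hS n).add (memLp_Tnl fun i hi => (hC n K hK hKn i hi).1)

theorem eventually_abs_variance_Tapprox_sub_le (hθ : S.MomentCondition) {Gδ Fδ Fb Gb : ℝ}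
    (hG : LeadingTerms S N Gδ Fδ Fb Gb) {ε : ℝ} (hε : 0 < ε) :
    ∀ᶠ n : ℕ in atTop, ∀ K, 2 ≤ K → K ≤ n →
      |variance (Tapprox S N φ φ W fold n K) μ - S.σsq -
        2 * Gb * (1 + 1 / ((K : ℝ) - 1)) ^ (2 * φ - 1 / 2) * (n : ℝ) ^ (1 / 2 - 2 * φ)| ≤
          ε * (n : ℝ) ^ (1 / 2 - 2 * φ) := by
  have hρ0 : 0 < 2 * φ - 1 / 2 := by linarith [hφ.1]
  have hρ1 : 2 * φ - 1 / 2 < 1 := by linarith [hφ.2]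
  have hneg : (1 / 2 - 2 * φ : ℝ) = -(2 * φ - 1 / 2) := by ring
  obtain ⟨C₁, hC₁0, hC₁⟩ := exists_foldQuad_bound hW hfold hS he hφ
  obtain ⟨C₂, hC₂0, hC₂⟩ := exists_abs_integral_Tstar_mul_quad_sub_le hW hS hθ he hφ
  have h1 := eventually_abs_rpow_mul_sub_le hρ0 hρ1 (tendsto_crossMoment hS he hφ hG)
    (half_pos hε)
  -- These are the errors from the index j = i and from Var `Tnl`, divided by n^(1/2-2φ).
  have hlim : Tendsto (fun n : ℕ => C₂ * 4 * (n : ℝ) ^ (-(1 / 2) : ℝ) +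
      C₁ ^ 2 * (n : ℝ) ^ (-(2 * φ - 1 / 2))) atTop (𝓝 0) := by
    have ha := ((tendsto_rpow_neg_atTop (by norm_num : (0 : ℝ) < 1 / 2)).comp
      tendsto_natCast_atTop_atTop).const_mul (C₂ * 4)
    have hb := ((tendsto_rpow_neg_atTop hρ0).comp tendsto_natCast_atTop_atTop).const_mul (C₁ ^ 2)
    simpa using ha.add hb
  filter_upwards [h1, hlim.eventually_le_const (half_pos hε), eventually_ge_atTop 1]
    with n hn1 hn2 hn K hK hKn
  have hn0 : (0 : ℝ) < n := by exact_mod_cast hn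
  rw [hneg]
  have h := abs_variance_Tapprox_sub_le (fold := fold) (N := N) (φ := φ) hW hS hθ (K := K) hn
    (D := 2 * Gb * (1 + 1 / ((K : ℝ) - 1)) ^ (2 * φ - 1 / 2) * (n : ℝ) ^ (-(2 * φ - 1 / 2)))
    (e := ε / 2 * (n : ℝ) ^ (-(2 * φ - 1 / 2)) + C₂ * (4 * (n : ℝ) ^ (-2 * φ)))
    (b := C₁ * (n : ℝ) ^ (-2 * φ)) (by positivity)
    (fun i hi => (hC₁ n K hK hKn i hi).1) (fun i hi => (hC₁ n K hK hKn i hi).2) ?_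
  · refine h.trans ?_
    have e1 : (n : ℝ) ^ (-2 * φ) = (n : ℝ) ^ (-(2 * φ - 1 / 2)) * (n : ℝ) ^ (-(1 / 2) : ℝ) := by
      rw [← Real.rpow_add hn0]; congr 1; ring
    have e2 : (n : ℝ) * ((n : ℝ) ^ (-(1 / 2) : ℝ)) ^ 2 = 1 := by
      rw [mul_comm, ← Real.rpow_natCast, ← Real.rpow_mul hn0.le, ← Real.rpow_add_one hn0.ne']
      norm_num
    have hp : 0 ≤ (n : ℝ) ^ (-(2 * φ - 1 / 2)) := by positivity
    have h3 := mul_le_mul_of_nonneg_left hn2 hp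
    rw [e1]
    linear_combination h3 + C₁ ^ 2 * ((n : ℝ) ^ (-(2 * φ - 1 / 2))) ^ 2 * e2
  · intro i hi
    have hint : Integrable (fun ω => Tstar S W n ω * foldQuad S N φ W fold n K i ω) μ :=
      (memLp_Tstar hW hS n).integrable_mul (hC₁ n K hK hKn i hi).1
    refine abs_integral_Tstar_mul_foldQuad_sub_le hW hfold hS hK hKn hint fun ω' => ?_
    have hne := hfold.train_nonempty hK hKn ω' (fold n K ω' i)
    have ha := hC₂ n _ (train_subset_range n _ _) hne i (notMem_train n _ i) hi
    have hb := hn1 K hK hKn _ (hfold.card_train hK hKn ω' hi)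
    have hc := hfold.card_train_rpow_le hφ hK hKn ω' hi
    have hcard : (0 : ℝ) < (train n (fold n K ω') (fold n K ω' i)).card := by
      exact_mod_cast hne.card_pos
    set k := (train n (fold n K ω') (fold n K ω' i)).card
    -- The normalization k^(1/2+2φ) of the cross moment times k^(1/2-2φ) is k, the number of
    -- training indices that contribute.
    rw [← mul_assoc, ← Real.rpow_add hcard,
      show -(2 * φ - 1 / 2) + (1 / 2 + 2 * φ) = (1 : ℝ) by ring, Real.rpow_one] at hb
    have hα : 0 ≤ (n : ℝ) ^ (-(1 / 2) : ℝ) := by positivity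
    have hd := mul_le_mul_of_nonneg_left hb hα
    rw [← abs_of_nonneg hα, ← abs_mul, abs_of_nonneg hα, mul_sub] at hd
    have hf := mul_le_mul_of_nonneg_left (mul_le_mul_of_nonneg_left hc hC₂0) hα
    refine (abs_sub_le _ _ _).trans ((add_le_add ha hd).trans ?_)
    linarith

end Main

end DML

theorem mainTheorem5 {Ω 𝒲 𝒳 : Type*} [MeasurableSpace Ω] [MeasurableSpace 𝒲] [MeasurableSpace 𝒳]
    (μ : Measure Ω) [IsProbabilityMeasure μ] {p : ℕ}
    (S : DML.Model 𝒲 𝒳 p) (N : DML.Nuisance 𝒲 𝒳 p)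
    (W : ℕ → Ω → 𝒲) (fold : ℕ → ℕ → Ω → ℕ → ℕ)
    (hW : DML.IsSample μ S.P W) (hfold : DML.IsSplit μ W fold)
    (hθ : S.MomentCondition)
    (φ : ℝ) (hφ : φ ∈ Set.Ioo (1 / 4 : ℝ) (1 / 2))
    (Gδ Fδ Fb Gb : ℝ)
    (hmoment : S.MomentAssumption)
    (hexpansion : DML.ExpansionAssumption S N φ φ μ W fold)
    (hleading : DML.LeadingTerms S N Gδ Fδ Fb Gb) :
    (∀ n K : ℕ, 2 ≤ K → K ≤ n → MemLp (DML.Tapprox S N φ φ W fold n K) 2 μ) ∧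
    ∃ r : ℕ → ℕ → ℝ,
      (∀ n K : ℕ, 2 ≤ K → K ≤ n →
        variance (DML.Tapprox S N φ φ W fold n K) μ =
          S.σsq + 2 * Gb * (1 + 1 / ((K : ℝ) - 1)) ^ (2 * φ - 1 / 2) * (n : ℝ) ^ (1 / 2 - 2 * φ)
            + r n K) ∧
      (fun n : ℕ => ⨆ K : Finset.Icc 2 n, |r n K|) =o[atTop]
        fun n : ℕ => (n : ℝ) ^ (1 / 2 - 2 * φ) := by
  refine ⟨fun n K hK hKn => DML.memLp_Tapprox hW hfold hmoment hexpansion hφ hK hKn,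
    fun n K => variance (DML.Tapprox S N φ φ W fold n K) μ - S.σsq -
      2 * Gb * (1 + 1 / ((K : ℝ) - 1)) ^ (2 * φ - 1 / 2) * (n : ℝ) ^ (1 / 2 - 2 * φ),
    fun n K _ _ => by ring, ?_⟩
  refine Asymptotics.isLittleO_iff.2 fun ε hε => ?_
  filter_upwards [DML.eventually_abs_variance_Tapprox_sub_le hW hfold hmoment hexpansion hφ hθ
    hleading hε] with n hn
  have hpow : 0 ≤ (n : ℝ) ^ (1 / 2 - 2 * φ) := by positivity
  rw [Real.norm_of_nonneg (Real.iSup_nonneg fun _ => abs_nonneg _), Real.norm_of_nonneg hpow]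
  -- Nonnegativity of the bound covers the empty range n < 2, where the supremum is 0.
  refine Real.iSup_le (fun K => ?_) (by positivity)
  have hK := Finset.mem_Icc.1 K.2
  exact hn K hK.1 hK.2
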